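/- **Conventions.** A standard probability space is one isomorphic to the unit interval with Lebesgue measure. For a measure preserving action of a countable group $\Lambda$ on a standard probability space $Y$, $\mathcal R_\Lambda$ denotes the equivalence relation on $Y$ of belonging to the same $\Lambda$-orbit. An action is called free if every non-trivial group element has a null set of fixed points. An orbit equivalence (isomorphism) of countable measure preserving equivalence relations $\mathcal R$ on $(X,\mu)$ and $\mathcal S$ on $(Y,\nu)$ is an isomorphism $\theta:(X,\mu)\to(Y,\nu)$ of probability spaces (up to null sets) which, for almost every $x\in X$, restricts to a bijection from the $\mathcal R$-class of $x$ onto the $\mathcal S$-class of $\theta(x)$. Two actions are orbit equivalent if their orbit equivalence relations are. For an ergodic countable measure preserving equivalence relation $\mathcal R$ on $(X,\mu)$ and $t>0$, the amplification $\mathcal R^t$ is, up to isomorphism, the restriction of the relation $(x,i)\sim(y,j)\Leftrightarrow x\,\mathcal R\,y$ on $X\times\mathbb N$ to a measurable subset $Y\subset X\times\mathbb N$ of measure $t$ for $\mu\times(\text{counting measure})$, where $Y$ carries the normalized restricted measure. Let $\mathcal S(\mathcal R)$ be the set of $t>0$ such that $\mathcal R^t$ is isomorphic to $\mathcal R_\Lambda$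 for some free ergodic measure preserving action of a countable group $\Lambda$ on a standard probability space. **Corollary 5.8.** Fix $n\ge 2$. For a sequence $J=\{d_i\}_{i\ge1}$ of positive integers with $d_i<d_{i+1}$ and $d_i\mid d_{i+1}$ for all $i$, let $\beta_J$ be the action of $\mathrm{SL}_n(\mathbb Z)\ltimes\mathbb Z^n$ on $\varprojlim(\mathbb Z/d_i\mathbb Z)^n$ obtained as the inverse limit of the affine actions on $(\mathbb Z/d_i\mathbb Z)^n$ (where $\mathrm{SL}_n(\mathbb Z)$ acts by matrix multiplication and $\mathbb Z^n$ by translations), with the inverse limit of the counting probability measures (the Haar probability measure), and let $\mathcal R_J$ be its orbit equivalence relation. Then: 1. $\mathcal S(\mathcal R_J)=\{k/d_i^n \mid k,i\ge 1\}$ for every such $J$. 2. There is such a $J$ with $\mathcal S(\mathcal R_J)=\mathbb Q_+^*$, the set of all positive rational numbers. 3. If $J_1=\{d_i^1\}_{i\ge1}$ and $J_2=\{d_i^2\}_{i\ge1}$ are two such sequences and there exists $i$ such that either $d_i^2\nmid d_j^1$ for all $j$, or $d_i^1\nmid d_j^2$ for all $j$, then the actions $\beta_{J_1}$ and $\beta_{J_2}$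 are not orbit equivalent. -/

import Mathlib

open MeasureTheory

/-! ### Measured equivalence relations -/

section EquivalenceRelations

/-- `θ` is an isomorphism of the measure spaces `(X, μ)` and `(Y, ν)` up to null sets: it is
measure preserving and has a measure preserving inverse almost everywhere. -/
def IsMeasureIso {X Y : Type} [MeasurableSpace X] [MeasurableSpace Y]
    (μ : Measure X) (ν : Measure Y) (θ : X → Y) : Prop :=
  MeasurePreserving θ μ ν ∧
    ∃ θ' : Y → X, MeasurePreserving θ' ν μ ∧ (∀ᵐ x ∂μ, θ' (θ x) = x) ∧ ∀ᵐ y ∂ν, θ (θ' y) = y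

/-- The equivalence relations `R` on `(X, μ)` and `S` on `(Y, ν)` are orbit equivalent
(isomorphic): there is an isomorphism of measure spaces which, for almost every `x`, restricts to
a bijection between the `R`-class of `x` and the `S`-class of `θ x`. -/
def OrbitEquivalent {X Y : Type} [MeasurableSpace X] [MeasurableSpace Y]
    (R : Setoid X) (μ : Measure X) (S : Setoid Y) (ν : Measure Y) : Prop :=
  ∃ θ : X → Y, IsMeasureIso μ ν θ ∧ ∀ᵐ x ∂μ, Set.BijOn θ {x' | R x x'} {y | S (θ x) y}

/-- The equivalence relation `R` on `(X, μ)` is isomorphic to the orbit equivalence relation of a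
free ergodic measure preserving action of a countable group on a standard (nonatomic)
probability space. -/
def InducedByFreeErgodicAction {X : Type} [MeasurableSpace X]
    (R : Setoid X) (μ : Measure X) : Prop :=
  ∃ (Λ : Type) (_ : Group Λ) (_ : Countable Λ)
    (Z : Type) (_ : MeasurableSpace Z) (_ : StandardBorelSpace Z)
    (_ : MulAction Λ Z) (_ : MeasurableConstSMul Λ Z)
    (η : Measure Z) (_ : IsProbabilityMeasure η) (_ : NullSingletonClass η),
    ErgodicSMul Λ Z η ∧ (∀ g : Λ, g ≠ 1 → ∀ᵐ z ∂η, g • z ≠ z) ∧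
      OrbitEquivalent R μ (MulAction.orbitRel Λ Z) η

/-- The measure `μ × c` on `X × ℕ`, where `c` is the counting measure. -/
noncomputable def stabMeasure {X : Type} [MeasurableSpace X] (μ : Measure X) : Measure (X × ℕ) :=
  μ.prod Measure.count

/-- The restriction to `Y ⊆ X × ℕ` of the relation `(x, i) ∼ (y, j) ↔ R x y`. -/
def amplifiedRel {X : Type} (R : Setoid X) (Y : Set (X × ℕ)) : Setoid Y :=
  R.comap (fun y : Y => y.1.1)

/-- The normalized restriction to `Y ⊆ X × ℕ` of the measure `μ × c`. -/
noncomputable def amplifiedMeasure {X : Type} [MeasurableSpace X]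
    (μ : Measure X) (Y : Set (X × ℕ)) : Measure Y :=
  (stabMeasure μ Y)⁻¹ • (stabMeasure μ).comap Subtype.val

/-- The invariant `𝓢(R)` of an (ergodic, countable, measure preserving) equivalence relation `R`
on `(X, μ)`: the set of `t > 0` such that the amplification `R^t`, i.e. the restriction of
`R × (ℕ × ℕ)` to a measurable set `Y ⊆ X × ℕ` of measure `t`, is induced by a free ergodic measure
preserving action of a countable group. -/
def sInvariant {X : Type} [MeasurableSpace X] (R : Setoid X) (μ : Measure X) : Set ℝ :=
  {t | 0 < t ∧ ∃ Y : Set (X × ℕ), MeasurableSet Y ∧ stabMeasure μ Y = ENNReal.ofReal t ∧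
    InducedByFreeErgodicAction (amplifiedRel R Y) (amplifiedMeasure μ Y)}

end EquivalenceRelations

/-! ### The profinite actions -/

/-- A strictly increasing sequence of positive integers, each dividing the next. (Positivity is
automatic for natural numbers, see `DivChain.pos`.) -/
structure DivChain where
  d : ℕ → ℕ
  lt : ∀ i, d i < d (i + 1)
  dvd : ∀ i, d i ∣ d (i + 1)

namespace DivChain

theorem pos (J : DivChain) (i : ℕ) : 0 < J.d i := by
  rcases Nat.eq_zero_or_pos (J.d i) with h | h
  · have h1 := J.lt i
    have h2 := J.dvd i
    rw [h] at h1 h2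
    rw [Nat.eq_zero_of_zero_dvd h2] at h1
    exact absurd h1 (lt_irrefl 0)
  · exact h

instance (J : DivChain) (i : ℕ) : NeZero (J.d i) := ⟨(J.pos i).ne'⟩

/-- The reduction map `(ℤ/d_{i+1}ℤ)ⁿ → (ℤ/d_iℤ)ⁿ`. -/
def red (J : DivChain) (n i : ℕ) : (Fin n → ZMod (J.d (i + 1))) →+ (Fin n → ZMod (J.d i)) where
  toFun v k := ZMod.castHom (J.dvd i) (ZMod (J.d i)) (v k)
  map_zero' := by ext; simp
  map_add' v w := by ext; simp [-ZMod.castHom_apply]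

/-- The inverse limit `lim← (ℤ/d_iℤ)ⁿ`, as a subgroup of `∏ᵢ (ℤ/d_iℤ)ⁿ`. -/
def limit (J : DivChain) (n : ℕ) : AddSubgroup (∀ i, Fin n → ZMod (J.d i)) where
  carrier := {x | ∀ i, J.red n i (x (i + 1)) = x i}
  zero_mem' i := by simp
  add_mem' {x y} hx hy i := by simp [hx i, hy i]
  neg_mem' {x} hx i := by simp [hx i]

theorem isClosed_limit (J : DivChain) (n : ℕ) :
    IsClosed (J.limit n : Set (∀ i, Fin n → ZMod (J.d i))) := by
  have : (J.limit n : Set (∀ i, Fin n → ZMod (J.d i))) =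
      ⋂ i, {x | J.red n i (x (i + 1)) = x i} := by
    ext x; simp [limit]
  rw [this]
  refine isClosed_iInter fun i => isClosed_eq ?_ (continuous_apply i)
  exact continuous_of_discreteTopology.comp (continuous_apply (i + 1))

instance (J : DivChain) (n : ℕ) : CompactSpace (J.limit n) :=
  isCompact_iff_compactSpace.mp (J.isClosed_limit n).isCompact

/-- The Haar probability measure of `lim← (ℤ/d_iℤ)ⁿ`. It is the limit of the counting probability
measures, see `limitMeasure_fiber`. -/
noncomputable def limitMeasure (J : DivChain) (n : ℕ) : Measure (J.limit n) :=
  Measure.addHaarMeasure ⊤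

instance (J : DivChain) (n : ℕ) : IsProbabilityMeasure (J.limitMeasure n) :=
  ⟨Measure.addHaarMeasure_self
    (K₀ := (⊤ : TopologicalSpace.PositiveCompacts (J.limit n)))⟩

end DivChain

/-- The automorphism action of `SL_n(ℤ)` on `ℤⁿ`. -/
def slAut (n : ℕ) :
    Matrix.SpecialLinearGroup (Fin n) ℤ →* MulAut (Multiplicative (Fin n → ℤ)) where
  toFun A := AddEquiv.toMultiplicative (Matrix.SpecialLinearGroup.toLin' A).toAddEquiv
  map_one' := by ext; simp
  map_mul' A B := by ext; simp

/-- The group `SL_n(ℤ) ⋉ ℤⁿ`. -/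
abbrev AffineSL (n : ℕ) : Type :=
  Multiplicative (Fin n → ℤ) ⋊[slAut n] Matrix.SpecialLinearGroup (Fin n) ℤ

namespace DivChain

/-- The affine action of `b · A ∈ SL_n(ℤ) ⋉ ℤⁿ` (`b ∈ ℤⁿ`, `A ∈ SL_n(ℤ)`) on `(ℤ/mℤ)ⁿ`:
`c ↦ A c + b`. -/
def affineMap (n m : ℕ) (g : AffineSL n) (c : Fin n → ZMod m) : Fin n → ZMod m :=
  (g.right.1.map (Int.castRingHom (ZMod m))).mulVec c + fun k => ((g.left.toAdd k : ℤ) : ZMod m)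

theorem affineMap_one (n m : ℕ) (c : Fin n → ZMod m) : affineMap n m 1 c = c := by
  ext k
  simp [affineMap]

theorem affineMap_mul (n m : ℕ) (g h : AffineSL n) (c : Fin n → ZMod m) :
    affineMap n m (g * h) c = affineMap n m g (affineMap n m h c) := by
  have h1 : (fun k => (((g * h).left.toAdd k : ℤ) : ZMod m)) =
      (fun k => ((g.left.toAdd k : ℤ) : ZMod m)) +
        (g.right.1.map (Int.castRingHom (ZMod m))).mulVec
          (fun k => ((h.left.toAdd k : ℤ) : ZMod m)) := by
    ext k
    simp [slAut, Matrix.mulVec, dotProduct, Matrix.SpecialLinearGroup.toLin'_apply]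
  have h2 : (g * h).right.1.map (Int.castRingHom (ZMod m)) =
      g.right.1.map (Int.castRingHom (ZMod m)) * h.right.1.map (Int.castRingHom (ZMod m)) := by
    rw [← Matrix.map_mul]
    rfl
  unfold affineMap
  rw [h1, h2, Matrix.mulVec_add, Matrix.mulVec_mulVec]
  abel

theorem red_affineMap (J : DivChain) (n i : ℕ) (g : AffineSL n)
    (c : Fin n → ZMod (J.d (i + 1))) :
    J.red n i (affineMap n _ g c) = affineMap n _ g (J.red n i c) := by
  ext k
  simp [affineMap, red, Matrix.mulVec, dotProduct, -ZMod.castHom_apply]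

/-- The action `β_J` of `SL_n(ℤ) ⋉ ℤⁿ` on `lim← (ℤ/d_iℤ)ⁿ`: the limit of the affine actions. -/
instance (J : DivChain) (n : ℕ) : MulAction (AffineSL n) (J.limit n) where
  smul g x := ⟨fun i => affineMap n _ g (x.1 i), fun i => by
    rw [red_affineMap, x.2 i]⟩
  one_smul x := Subtype.ext <| funext fun i => affineMap_one n _ _
  mul_smul g h x := Subtype.ext <| funext fun i => affineMap_mul n _ g h _

theorem smul_apply (J : DivChain) (n : ℕ) (g : AffineSL n) (x : J.limit n) (i : ℕ) :
    (g • x).1 i = affineMap n (J.d i) g (x.1 i) := rfl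

/-- The diagonal embedding of `ℤⁿ` in the inverse limit. -/
def diag (J : DivChain) (n : ℕ) (v : Fin n → ℤ) : J.limit n :=
  ⟨fun i k => (v k : ZMod (J.d i)), fun i => by ext k; simp [red, -ZMod.castHom_apply]⟩

theorem exists_diag_eq (J : DivChain) (n : ℕ) (x : J.limit n) (i : ℕ) :
    ∃ v : Fin n → ℤ, ∀ j ≤ i, (J.diag n v).1 j = x.1 j := by
  choose v hv using fun k => ZMod.intCast_surjective (x.1 i k)
  refine ⟨v, fun j hj => ?_⟩
  induction hj using Nat.decreasingInduction with
  | self => ext k; exact hv k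
  | of_succ j _ ih =>
    rw [← (J.diag n v).2 j, ← x.2 j, ih]

theorem denseRange_diag (J : DivChain) (n : ℕ) : DenseRange (J.diag n) := by
  intro x
  choose v hv using J.exists_diag_eq n x
  refine mem_closure_of_tendsto (f := fun i => J.diag n (v i)) (b := Filter.atTop) ?_
    (Filter.Eventually.of_forall fun i => ⟨v i, rfl⟩)
  rw [tendsto_subtype_rng, tendsto_pi_nhds]
  intro j
  refine tendsto_const_nhds.congr' ?_
  filter_upwards [Filter.eventually_ge_atTop j] with i hi
  exact (hv i j hi).symm

/-- The quotient maps `lim← (ℤ/d_iℤ)ⁿ → (ℤ/d_iℤ)ⁿ` push the measure forward to the counting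
probability measure. -/
theorem limitMeasure_fiber (J : DivChain) (n i : ℕ) (c : Fin n → ZMod (J.d i)) :
    J.limitMeasure n {x | x.1 i = c} = ((J.d i : ENNReal) ^ n)⁻¹ := by
  have hm : ∀ c : Fin n → ZMod (J.d i), MeasurableSet {x : J.limit n | x.1 i = c} := fun c =>
    (measurableSet_singleton c).preimage ((measurable_pi_apply i).comp measurable_subtype_coe)
  have hc : ∀ c : Fin n → ZMod (J.d i),
      J.limitMeasure n {x | x.1 i = c} = J.limitMeasure n {x | x.1 i = 0} := by
    intro c
    choose v hv using fun k => ZMod.intCast_surjective (c k)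
    have h := measure_preimage_add (Measure.addHaarMeasure ⊤) (J.diag n v) {x | x.1 i = c}
    rw [limitMeasure, ← h]
    congr 1
    ext x
    have hvc : (J.diag n v).1 i = c := by ext k; exact hv k
    simp [hvc]
  have hs : ∑ c : Fin n → ZMod (J.d i), J.limitMeasure n {x | x.1 i = c} = 1 := by
    rw [← measure_biUnion_finset (fun a _ b _ hab => ?_) (fun c _ => hm c)]
    · rw [← measure_univ (μ := J.limitMeasure n)]
      congr 1
      ext x
      simp
    · exact Set.disjoint_left.mpr fun x hx hx' => hab (hx.symm.trans hx')
  simp only [hc, Finset.sum_const, nsmul_eq_mul] at hs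
  rw [hc c]
  refine ENNReal.eq_inv_of_mul_eq_one_left ?_
  rw [mul_comm, ← hs]
  simp [ZMod.card]

/-- `β_J` is an ergodic measure preserving action. -/
instance (J : DivChain) (n : ℕ) : ErgodicSMul (AffineSL n) (J.limit n) (J.limitMeasure n) where
  measure_preimage_smul g s hs := by
    let f : J.limit n →+ J.limit n :=
      { toFun := fun x => (⟨1, g.right⟩ : AffineSL n) • x
        map_zero' := by
          ext i k
          simp [smul_apply, affineMap]
        map_add' := fun x y => by
          ext i k
          simp [smul_apply, affineMap, Matrix.mulVec_add] }
    have hf : ∀ x, f x = (⟨1, g.right⟩ : AffineSL n) • x := fun _ => rfl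
    have hfc : Continuous f := by
      refine Continuous.subtype_mk (continuous_pi fun i => ?_) _
      exact (continuous_of_discreteTopology (f := affineMap n (J.d i) ⟨1, g.right⟩)).comp
        ((continuous_apply i).comp continuous_subtype_val)
    have hfs : Function.Surjective f := MulAction.surjective _
    have hfm : MeasurePreserving f (J.limitMeasure n) (J.limitMeasure n) :=
      f.measurePreserving (μ := Measure.addHaarMeasure ⊤) (ν := Measure.addHaarMeasure ⊤)
        hfc hfs rfl
    have hg : (fun x : J.limit n => g • x) = (fun x => J.diag n g.left.toAdd + x) ∘ f := by
      funext x
      ext i k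
      simp [hf, smul_apply, affineMap, diag, add_comm]
    have ht : MeasurePreserving (fun x => J.diag n g.left.toAdd + x)
        (J.limitMeasure n) (J.limitMeasure n) :=
      measurePreserving_add_left (Measure.addHaarMeasure ⊤) _
    rw [hg]
    exact (ht.comp hfm).measure_preimage hs.nullMeasurableSet
  aeconst_of_forall_preimage_smul_ae_eq {s} hs h := by
    have : (J.limitMeasure n).IsAddHaarMeasure := by unfold limitMeasure; infer_instance
    have : SecondCountableTopology (J.limit n) :=
      TopologicalSpace.Subtype.secondCountableTopology _
    have : MeasurableAdd₂ (J.limit n) := inferInstance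
    have : ErgodicVAdd (J.limit n) (J.limit n) (J.limitMeasure n) := inferInstance
    refine aeconst_of_dense_setOfPred_preimage_vadd_ae (M := J.limit n) hs.nullMeasurableSet
      ((J.denseRange_diag n).mono ?_)
    rintro _ ⟨v, rfl⟩
    have h1 := h ⟨Multiplicative.ofAdd v, 1⟩
    have h2 : (fun x : J.limit n => (⟨Multiplicative.ofAdd v, 1⟩ : AffineSL n) • x) =
        fun x => J.diag n v +ᵥ x := by
      funext x
      ext i k
      simp [smul_apply, affineMap, diag, add_comm]
    rw [h2] at h1
    exact h1

/-- The equivalence relation `R_J` of `β_J`: belonging to the same orbit. -/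
def rel (J : DivChain) (n : ℕ) : Setoid (J.limit n) :=
  MulAction.orbitRel (AffineSL n) (J.limit n)

end DivChain

/-!
The proof rests on the relative property (T) of the pair `ℤⁿ ⊆ SL_n(ℤ) ⋉ ℤⁿ`, which makes cocycles
of the profinite actions rigid.

*Relative property (T).* Let a unit vector be almost fixed by the generators of `ℤ²` and by the two
elementary matrices. Its spectral measure on the dual torus is concentrated near the neutral
element and almost invariant under the shears of the torus. Each quadrant around the neutral
element has two disjoint images inside itself under shears, so it has small measure, and the
spectral measure is concentrated at the neutral element itself (`torus_measure_compl_one_le`,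
`norm_unitary_pow_sub_sq_le`). Hence the vector is almost fixed by all of `ℤⁿ`, uniformly
(`norm_translElt_sub_le`). For the Koopman representation on a possibly infinite measure space this
is a statement about almost invariant sets (`measureReal_symmDiff_translElt_le`), and a set which is
uniformly almost invariant is close to an invariant one (`exists_invariant_set`).

*Cocycle superrigidity.* Write `K` for `lim← (ℤ/d_iℤ)ⁿ`, and call the fibres of `K → (ℤ/d_iℤ)ⁿ`
cosets of level `i`. A cocycle `w` with values in a countable group `Λ` gives an action on
`K × K × Λ`, namely `g (x, y, l) = (g x, g y, w(g, x) l w(g, y)⁻¹)`. The set of all `(x, y, 1)` with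
`x` and `y` in the same coset of level `i` is almost invariant under the finitely many generators if
`i` is large, hence almost invariant under `ℤⁿ`. So `w(v, ·)` is nearly constant on most cosets,
uniformly in `v ∈ ℤⁿ` (`IsCocycle.exists_sum_discrepancy_le`). Its most frequent values on a good
coset form a homomorphism of `d_i ℤⁿ`, and an invariant set in the skew product over the coset is
the graph of a transfer map which turns `w` into this homomorphism
(`IsCocycle.exists_trivialization`). Since `ℤⁿ` permutes the cosets, and since a level set of the new cocycle on a coset is invariant
under the ergodic action of `d_i ℤⁿ` as soon as it fills more than half of the coset, the new
cocycle is constant on cosets for the translations and for the elementary matrices, which generate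
`SL_n(ℤ)`. This is `IsCocycle.superrigidity`.

*The invariant.* An isomorphism of the amplification by `t` with the orbit relation of a free
ergodic action of `Λ` on `Z` provides a map `q` from `K` to `Z` which sends orbits to orbits and
scales measures locally by `t⁻¹` (`exists_isOrbitMap`). By superrigidity for its cocycle, `q` can be
twisted so as to be equivariant along a homomorphism `ρ` from the stabilizer of the coset of zero
of some level `i` to `Λ` (`IsOrbitMap.exists_equivariant`); `ρ` is injective
(`IsOrbitMap.injective_hom`), and the twisted map is injective on the coset. The translates of the
image of the coset by `Λ` are disjoint or equal, according to the cosets of the range of `ρ`, and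
fill `Z` by ergodicity. So the index `k` of the range is finite and `t = k / d_iⁿ`
(`IsOrbitMap.exists_scaling_eq`). Conversely, `k / d_iⁿ` is the measure of `k` copies of the coset
of zero, on which the product of the stabilizer of the coset and `ℤ/kℤ` acts freely and
ergodically, with the restricted relation as orbit relation (`mem_sInvariant`).

The sequence `(i + 1)!` gives all positive rational numbers. Finally, the invariant only depends on
the relation up to orbit equivalence (`OrbitEquivalent.sInvariant_subset`), so that for orbit
equivalent actions every `1 / d_iⁿ` of one sequence is some `k / d_jⁿ` of the other one; then
`d_iⁿ` divides `d_jⁿ`, and `d_i` divides `d_j` (`exists_dvd_of_orbitEquivalent`).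
-/

/-! ### Joint functional calculus of two commuting unitaries -/

section JointCalculus

open scoped CStarAlgebra

/-- The first coordinate, as a complex valued function on the torus. -/
def torusFst : C(Circle × Circle, ℂ) := ⟨fun p => (p.1 : ℂ), by fun_prop⟩

/-- The second coordinate, as a complex valued function on the torus. -/
def torusSnd : C(Circle × Circle, ℂ) := ⟨fun p => (p.2 : ℂ), by fun_prop⟩

theorem torus_adjoin_closure :
    (StarAlgebra.adjoin ℂ {torusFst, torusSnd}).topologicalClosure = ⊤ := by
  apply ContinuousMap.starSubalgebra_topologicalClosure_eq_top_of_separatesPoints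
  intro p q hpq
  have h1 : torusFst ∈ StarAlgebra.adjoin ℂ {torusFst, torusSnd} :=
    StarAlgebra.subset_adjoin ℂ _ (by simp)
  have h2 : torusSnd ∈ StarAlgebra.adjoin ℂ {torusFst, torusSnd} :=
    StarAlgebra.subset_adjoin ℂ _ (by simp)
  by_cases h : p.1 = q.1
  · refine ⟨torusSnd, ⟨torusSnd, h2, rfl⟩, fun h' => hpq (Prod.ext h (Circle.ext h'))⟩
  · exact ⟨torusFst, ⟨torusFst, h1, rfl⟩, fun h' => h (Circle.ext h')⟩

/-- A star homomorphism on the continuous functions on the torus is determined by its values at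
the two coordinate functions. -/
theorem torus_starAlgHom_ext {B : Type*} [CStarAlgebra B] {Φ Ψ : C(Circle × Circle, ℂ) →⋆ₐ[ℂ] B}
    (h1 : Φ torusFst = Ψ torusFst) (h2 : Φ torusSnd = Ψ torusSnd) : Φ = Ψ := by
  have hc : IsClosed {f | Φ f = Ψ f} :=
    isClosed_eq (map_continuous Φ) (map_continuous Ψ)
  have hle : (StarAlgebra.adjoin ℂ {torusFst, torusSnd}) ≤ StarAlgHom.equalizer Φ Ψ := by
    refine StarAlgebra.adjoin_le ?_
    rintro f (rfl | rfl)
    · exact h1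
    · exact h2
  have := StarSubalgebra.topologicalClosure_minimal hle hc
  rw [torus_adjoin_closure] at this
  ext f
  exact this (StarSubalgebra.mem_top (x := f))

/-- Two commuting unitaries have a joint functional calculus on the torus. It is obtained by Gelfand
duality for the commutative C*-algebra generated by the two unitaries. -/
theorem exists_joint_calculus {B : Type*} [CStarAlgebra B] {a b : B} (ha : a ∈ unitary B)
    (hb : b ∈ unitary B) (hab : a * b = b * a) :
    ∃ Φ : C(Circle × Circle, ℂ) →⋆ₐ[ℂ] B, Φ torusFst = a ∧ Φ torusSnd = b := by
  -- the adjoints commute with the unitaries as well, so that `a` and `b` generate a commutative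
  -- star algebra
  have hca : Commute (star a) b := by
    have h1 : star a * (a * b) * star a = star a * (b * a) * star a := by rw [hab]
    have e1 := Unitary.star_mul_self_of_mem ha
    have e2 := Unitary.mul_star_self_of_mem ha
    rw [← mul_assoc, e1, one_mul, mul_assoc, mul_assoc, e2, mul_one] at h1
    exact h1.symm
  have hcb : Commute (star b) a := by
    have := congrArg star hca.eq
    rwa [star_mul, star_mul, star_star] at this
  let S : StarSubalgebra ℂ B := StarAlgebra.adjoin ℂ {a, b}
  have hS : ∀ x y : S, x * y = y * x := by
    intro x y
    refine (StarAlgebra.isMulCommutative_adjoin ℂ (s := {a, b}) ?_ ?_).is_comm.comm x y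
    · rintro x (rfl | rfl) y (rfl | rfl)
      · rfl
      · exact hab
      · exact hab.symm
      · rfl
    · rintro x (rfl | rfl) y (rfl | rfl)
      · rw [Unitary.star_mul_self_of_mem ha, Unitary.mul_star_self_of_mem ha]
      · exact hcb.symm
      · exact hca.symm
      · rw [Unitary.star_mul_self_of_mem hb, Unitary.mul_star_self_of_mem hb]
  let T := S.topologicalClosure
  let _ : CStarAlgebra T :=
    StarSubalgebra.cstarAlgebra T (h_closed := S.isClosed_topologicalClosure)
  let _ : CommCStarAlgebra T :=
    { (inferInstance : CStarAlgebra T) with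
      mul_comm := (S.commRingTopologicalClosure hS).mul_comm }
  have hSa : a ∈ T := S.le_topologicalClosure (StarAlgebra.subset_adjoin ℂ _ (by simp))
  have hSb : b ∈ T := S.le_topologicalClosure (StarAlgebra.subset_adjoin ℂ _ (by simp))
  -- characters map unitaries into the circle
  have key : ∀ (c : B) (hc : c ∈ T), c ∈ unitary B →
      ∀ χ : WeakDual.characterSpace ℂ T, χ ⟨c, hc⟩ ∈ Submonoid.unitSphere ℂ := by
    intro c hc hu χ
    have : star (⟨c, hc⟩ : T) * ⟨c, hc⟩ = 1 := Subtype.ext (Unitary.star_mul_self_of_mem hu)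
    have h2 := congrArg χ this
    rw [map_mul, map_star, map_one] at h2
    change _ ∈ Metric.sphere (0 : ℂ) 1
    rw [mem_sphere_zero_iff_norm]
    have h3 : (‖χ ⟨c, hc⟩‖ ^ 2 : ℂ) = 1 := by
      rw [← Complex.conj_mul']; exact h2
    have h4 : ‖χ ⟨c, hc⟩‖ ^ 2 = 1 := by exact_mod_cast h3
    nlinarith [norm_nonneg (χ ⟨c, hc⟩)]
  -- the map from the spectrum of the algebra to the torus given by the values at `a` and `b`
  let p : C(WeakDual.characterSpace ℂ T, Circle × Circle) :=
    ⟨fun χ => (⟨χ ⟨a, hSa⟩, key a hSa ha χ⟩, ⟨χ ⟨b, hSb⟩, key b hSb hb χ⟩), by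
      refine Continuous.prodMk (Continuous.subtype_mk ?_ _) (Continuous.subtype_mk ?_ _)
      · exact map_continuous (WeakDual.gelfandTransform ℂ T ⟨a, hSa⟩)
      · exact map_continuous (WeakDual.gelfandTransform ℂ T ⟨b, hSb⟩)⟩
  refine ⟨T.subtype.comp (((gelfandStarTransform T).symm : _ →⋆ₐ[ℂ] T).comp
    (ContinuousMap.compStarAlgHom' ℂ ℂ p)), ?_, ?_⟩
  · have : ContinuousMap.compStarAlgHom' ℂ ℂ p torusFst = gelfandStarTransform T ⟨a, hSa⟩ := by
      ext χ; rfl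
    simp only [StarAlgHom.comp_apply, this]
    simp
  · have : ContinuousMap.compStarAlgHom' ℂ ℂ p torusSnd = gelfandStarTransform T ⟨b, hSb⟩ := by
      ext χ; rfl
    simp only [StarAlgHom.comp_apply, this]
    simp

end JointCalculus

/-! ### Spectral measures on the torus -/

section SpectralMeasure

open scoped CStarAlgebra

/-- The Borel σ-algebra of the circle. -/
noncomputable instance : MeasurableSpace Circle := borel Circle

instance : BorelSpace Circle := ⟨rfl⟩

/-- If integrals of continuous functions with values in `[0, 1]` against `μ` exceed those against
`ν` by at most `c`, then so do the measures of Borel sets. -/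
theorem measureReal_le_add_of_integral_le {X : Type*} [TopologicalSpace X] [CompactSpace X]
    [T2Space X] [MeasurableSpace X] [BorelSpace X]
    (μ ν : Measure X) [IsFiniteMeasure μ] [IsFiniteMeasure ν] [μ.Regular] [ν.Regular] (c : ℝ)
    (h : ∀ f : C(X, ℝ), (∀ x, f x ∈ Set.Icc (0 : ℝ) 1) → ∫ x, f x ∂μ ≤ ∫ x, f x ∂ν + c)
    {E : Set X} (hE : MeasurableSet E) : μ.real E ≤ ν.real E + c := by
  refine le_of_forall_pos_le_add fun ε hε => ?_
  -- approximate the set from inside by a compact set for `μ` and from outside by an open set for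
  -- `ν`, and separate the two by a continuous function
  obtain ⟨F, hFE, hF, hμF⟩ := hE.exists_isCompact_lt_add (μ := μ) (measure_ne_top _ _)
    (ε := ENNReal.ofReal (ε / 2)) (by simpa using hε)
  obtain ⟨O, hEO, hO, hνO⟩ := E.exists_isOpen_lt_add (μ := ν) (measure_ne_top _ _)
    (ε := ENNReal.ofReal (ε / 2)) (by simpa using hε)
  have h1 : μ.real E ≤ μ.real F + ε / 2 := by
    have := (ENNReal.toReal_mono (by finiteness) hμF.le)
    rwa [ENNReal.toReal_add (by finiteness) (by finiteness),
      ENNReal.toReal_ofReal (by positivity)] at this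
  have h2 : ν.real O ≤ ν.real E + ε / 2 := by
    have := (ENNReal.toReal_mono (by finiteness) hνO.le)
    rwa [ENNReal.toReal_add (by finiteness) (by finiteness),
      ENNReal.toReal_ofReal (by positivity)] at this
  obtain ⟨f, hf0, hf1, hf⟩ := exists_continuous_zero_one_of_isClosed (s := Oᶜ) (t := F)
    hO.isClosed_compl hF.isClosed
    (Set.disjoint_left.mpr fun x hx hx' => hx (hEO (hFE hx')))
  have hint : ∀ (m : Measure X) [IsFiniteMeasure m], Integrable f m := fun m _ =>
    f.continuous.integrable_of_hasCompactSupport (HasCompactSupport.of_compactSpace _)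
  have h3 : μ.real F ≤ ∫ x, f x ∂μ := by
    rw [← integral_indicator_one hF.measurableSet]
    refine integral_mono ((integrable_const _).indicator hF.measurableSet) (hint μ) fun x => ?_
    by_cases hx : x ∈ F
    · rw [Set.indicator_of_mem hx, hf1 hx]
    · rw [Set.indicator_of_notMem hx]; exact (hf x).1
  have h4 : ∫ x, f x ∂ν ≤ ν.real O := by
    rw [← integral_indicator_one hO.measurableSet]
    refine integral_mono (hint ν) ((integrable_const _).indicator hO.measurableSet) fun x => ?_
    by_cases hx : x ∈ O
    · rw [Set.indicator_of_mem hx]; exact (hf x).2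
    · rw [Set.indicator_of_notMem hx]
      exact (hf0 (show x ∈ Oᶜ from hx)).le
  linarith [h f hf]

/-- Real valued functions on the torus, seen as complex valued functions. -/
noncomputable def torusOfReal (f : C(Circle × Circle, ℝ)) : C(Circle × Circle, ℂ) :=
  ⟨fun p => (f p : ℂ), by fun_prop⟩

variable {H : Type*} [NormedAddCommGroup H] [InnerProductSpace ℂ H] [CompleteSpace H]

open scoped InnerProductSpace

/-- A positive functional `f ↦ ⟪ξ, Φ f ξ⟫` on the continuous functions on the torus is given by a
measure. -/
theorem exists_spectral_measure (Φ : C(Circle × Circle, ℂ) →⋆ₐ[ℂ] (H →L[ℂ] H)) (ξ : H) :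
    ∃ μ : Measure (Circle × Circle), IsFiniteMeasure μ ∧ μ.Regular ∧
      ∀ f : C(Circle × Circle, ℝ), ∫ p, f p ∂μ = (⟪ξ, Φ (torusOfReal f) ξ⟫_ℂ).re := by
  let L : C(Circle × Circle, ℝ) →ₗ[ℝ] ℝ :=
    { toFun := fun f => (⟪ξ, Φ (torusOfReal f) ξ⟫_ℂ).re
      map_add' := fun f g => by
        have : torusOfReal (f + g) = torusOfReal f + torusOfReal g := by
          ext p; simp [torusOfReal]
        rw [this, map_add, add_apply, inner_add_right, Complex.add_re]
      map_smul' := fun c f => by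
        have : torusOfReal (c • f) = (c : ℂ) • torusOfReal f := by
          ext p; simp [torusOfReal]
        rw [this, map_smul, smul_apply, inner_smul_right]
        simp }
  have hL : ∀ f : C(Circle × Circle, ℝ), 0 ≤ f → 0 ≤ L f := by
    intro f hf
    -- `f` is the square of its square root, and `Φ` is a star homomorphism
    let g : C(Circle × Circle, ℝ) := ⟨fun p => √(f p), by fun_prop⟩
    have hg : torusOfReal f = star (torusOfReal g) * torusOfReal g := by
      ext p
      have h0 : 0 ≤ f p := hf p
      simp only [torusOfReal, ContinuousMap.coe_mk, ContinuousMap.mul_apply,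
        ContinuousMap.star_apply, g, RCLike.star_def, Complex.conj_ofReal]
      rw [← Complex.ofReal_mul, Real.mul_self_sqrt h0]
    change 0 ≤ (⟪ξ, Φ (torusOfReal f) ξ⟫_ℂ).re
    rw [hg, map_mul, map_star, ContinuousLinearMap.star_eq_adjoint,
      mul_apply_eq_comp, ContinuousLinearMap.adjoint_inner_right]
    exact inner_self_nonneg (𝕜 := ℂ)
  let L' : CompactlySupportedContinuousMap (Circle × Circle) ℝ →ₚ[ℝ] ℝ :=
    PositiveLinearMap.mk₀
      { toFun := fun f => L f.toContinuousMap
        map_add' := fun f g => by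
          rw [← map_add]; rfl
        map_smul' := fun c f => by
          rw [← map_smul]; rfl }
      (fun f hf => hL _ hf)
  refine ⟨RealRMK.rieszMeasure L', ?_, ?_, fun f => ?_⟩
  · infer_instance
  · infer_instance
  · exact RealRMK.integral_rieszMeasure L' ⟨f, HasCompactSupport.of_compactSpace _⟩

end SpectralMeasure

/-! ### Measures on the torus which are almost invariant under shears -/

section TorusDynamics

/-- The shear `(z, w) ↦ (z, z w)` of the torus. -/
noncomputable def shearSnd : C(Circle × Circle, Circle × Circle) :=
  ⟨fun p => (p.1, p.1 * p.2), by fun_prop⟩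

/-- The shear `(z, w) ↦ (z, z⁻¹ w)` of the torus. -/
noncomputable def shearSndInv : C(Circle × Circle, Circle × Circle) :=
  ⟨fun p => (p.1, p.1⁻¹ * p.2), by fun_prop⟩

/-- The shear `(z, w) ↦ (z w, w)` of the torus. -/
noncomputable def shearFst : C(Circle × Circle, Circle × Circle) :=
  ⟨fun p => (p.1 * p.2, p.2), by fun_prop⟩

/-- The shear `(z, w) ↦ (z w⁻¹, w)` of the torus. -/
noncomputable def shearFstInv : C(Circle × Circle, Circle × Circle) :=
  ⟨fun p => (p.1 * p.2⁻¹, p.2), by fun_prop⟩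

/-- A set which has two disjoint copies in itself, up to a set of small measure, has small
measure. -/
theorem measureReal_le_of_two_copies {X : Type*} [MeasurableSpace X] (μ : Measure X)
    [IsFiniteMeasure μ] {Q A B D : Set X} {η : ℝ} (hB : MeasurableSet B)
    (hA' : μ.real Q ≤ μ.real A + η) (hB' : μ.real Q ≤ μ.real B + η) (hAB : Disjoint A B)
    (hA : A ⊆ Q ∪ Dᶜ) (hB2 : B ⊆ Q ∪ Dᶜ) : μ.real Q ≤ 2 * η + μ.real Dᶜ := by
  have h1 : μ.real (A ∪ B) = μ.real A + μ.real B := measureReal_union hAB hB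
  have h2 : μ.real (A ∪ B) ≤ μ.real Q + μ.real Dᶜ :=
    (measureReal_mono (Set.union_subset hA hB2)).trans (measureReal_union_le _ _)
  linarith

/-- A measure on the torus which is almost invariant under the four shears and concentrated near
the neutral element is concentrated at the neutral element. Each of the four half open quadrants
around the neutral element has two almost disjoint images in itself under shears, and hence
small measure. -/
theorem torus_measure_compl_one_le (μ : Measure (Circle × Circle)) [IsFiniteMeasure μ] {η κ : ℝ}
    (h1 : ∀ E, MeasurableSet E → μ.real (shearSnd ⁻¹' E) ≤ μ.real E + η)
    (h2 : ∀ E, MeasurableSet E → μ.real (shearSndInv ⁻¹' E) ≤ μ.real E + η)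
    (h3 : ∀ E, MeasurableSet E → μ.real (shearFst ⁻¹' E) ≤ μ.real E + η)
    (h4 : ∀ E, MeasurableSet E → μ.real (shearFstInv ⁻¹' E) ≤ μ.real E + η)
    (hκ : μ.real {p | 0 < (p.1 : ℂ).re ∧ 0 < (p.2 : ℂ).re}ᶜ ≤ κ) :
    μ.real {1}ᶜ ≤ 8 * η + 5 * κ := by
  set D : Set (Circle × Circle) := {p | 0 < (p.1 : ℂ).re ∧ 0 < (p.2 : ℂ).re} with hD
  have r1 : Measurable fun p : Circle × Circle => (p.1 : ℂ).re :=
    Continuous.measurable (by fun_prop)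
  have r2 : Measurable fun p : Circle × Circle => (p.2 : ℂ).re :=
    Continuous.measurable (by fun_prop)
  have i1 : Measurable fun p : Circle × Circle => (p.1 : ℂ).im :=
    Continuous.measurable (by fun_prop)
  have i2 : Measurable fun p : Circle × Circle => (p.2 : ℂ).im :=
    Continuous.measurable (by fun_prop)
  have c0 : Measurable fun _ : Circle × Circle => (0 : ℝ) := measurable_const
  have hDm : MeasurableSet D := (measurableSet_lt c0 r1).inter (measurableSet_lt c0 r2)
  -- pullback along mutually inverse shears
  have inv : ∀ (f g : C(Circle × Circle, Circle × Circle)),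
      (∀ E, MeasurableSet E → μ.real (f ⁻¹' E) ≤ μ.real E + η) → (∀ p, g (f p) = p) →
      ∀ E, MeasurableSet E → μ.real E ≤ μ.real (g ⁻¹' E) + η := by
    intro f g hf hfg E hE
    have := hf (g ⁻¹' E) (g.continuous.measurable hE)
    have e : f ⁻¹' (g ⁻¹' E) = E := by ext p; simp [hfg]
    rwa [e] at this
  have k1 := inv shearSnd shearSndInv h1 (fun p => by simp [shearSnd, shearSndInv])
  have k2 := inv shearSndInv shearSnd h2 (fun p => by simp [shearSnd, shearSndInv])
  have k3 := inv shearFst shearFstInv h3 (fun p => by simp [shearFst, shearFstInv])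
  have k4 := inv shearFstInv shearFst h4 (fun p => by simp [shearFst, shearFstInv])
  -- half open quadrants, numbered counterclockwise, which cover `D` except for the neutral element
  let Q1 := D ∩ {p : Circle × Circle | 0 < (p.1 : ℂ).im ∧ 0 ≤ (p.2 : ℂ).im}
  let Q2 := D ∩ {p : Circle × Circle | (p.1 : ℂ).im ≤ 0 ∧ 0 < (p.2 : ℂ).im}
  let Q3 := D ∩ {p : Circle × Circle | (p.1 : ℂ).im < 0 ∧ (p.2 : ℂ).im ≤ 0}
  let Q4 := D ∩ {p : Circle × Circle | 0 ≤ (p.1 : ℂ).im ∧ (p.2 : ℂ).im < 0}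
  have m1 : MeasurableSet Q1 :=
    hDm.inter ((measurableSet_lt c0 i1).inter (measurableSet_le c0 i2))
  have m2 : MeasurableSet Q2 :=
    hDm.inter ((measurableSet_le i1 c0).inter (measurableSet_lt c0 i2))
  have m3 : MeasurableSet Q3 :=
    hDm.inter ((measurableSet_lt i1 c0).inter (measurableSet_le i2 c0))
  have m4 : MeasurableSet Q4 :=
    hDm.inter ((measurableSet_le c0 i1).inter (measurableSet_lt i2 c0))
  -- In terms of angles, the images of the first quadrant under the shears `(a, b) ↦ (a, a + b)` and
  -- `(a, b) ↦ (a + b, b)` are disjoint, since the second angle is at least the first one in one of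
  -- them and smaller in the other, and they stay in the quadrant as long as they stay in `D`. The
  -- inverse shears serve the second and the fourth quadrant.
  have hQ1 : μ.real Q1 ≤ 2 * η + μ.real Dᶜ := by
    refine measureReal_le_of_two_copies μ (shearFstInv.continuous.measurable m1)
      (k1 Q1 m1) (k3 Q1 m1) (Set.disjoint_left.mpr ?_) ?_ ?_
    · rintro ⟨z, w⟩ ⟨⟨h1, h2⟩, h3, h4⟩ ⟨⟨h5, h6⟩, h7, h8⟩
      simp only [shearSndInv, shearFstInv, ContinuousMap.coe_mk, Circle.coe_mul,
        Circle.coe_inv_eq_conj, Complex.mul_im, Complex.conj_re, Complex.conj_im] at h4 h7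
      linarith
    · rintro ⟨z, w⟩ ⟨⟨h1, h2⟩, h3, h4⟩
      refine or_iff_not_imp_right.mpr fun hd => ⟨not_not.mp hd, ?_⟩
      obtain ⟨h5, h6⟩ := not_not.mp hd
      simp only [shearSndInv, ContinuousMap.coe_mk, Circle.coe_mul, Circle.coe_inv_eq_conj,
        Complex.mul_im, Complex.conj_re, Complex.conj_im] at h3 h4 h5 h6
      exact ⟨by nlinarith, by nlinarith⟩
    · rintro ⟨z, w⟩ ⟨⟨h1, h2⟩, h3, h4⟩
      refine or_iff_not_imp_right.mpr fun hd => ⟨not_not.mp hd, ?_⟩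
      obtain ⟨h5, h6⟩ := not_not.mp hd
      simp only [shearFstInv, ContinuousMap.coe_mk, Circle.coe_mul, Circle.coe_inv_eq_conj,
        Complex.mul_im, Complex.conj_re, Complex.conj_im] at h3 h4 h5 h6
      exact ⟨by nlinarith, by nlinarith⟩
  have hQ2 : μ.real Q2 ≤ 2 * η + μ.real Dᶜ := by
    refine measureReal_le_of_two_copies μ (shearFst.continuous.measurable m2)
      (k2 Q2 m2) (k4 Q2 m2) (Set.disjoint_left.mpr ?_) ?_ ?_
    · rintro ⟨z, w⟩ ⟨⟨h1, h2⟩, h3, h4⟩ ⟨⟨h5, h6⟩, h7, h8⟩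
      simp only [shearSnd, shearFst, ContinuousMap.coe_mk, Circle.coe_mul, Complex.mul_im] at h4 h7
      linarith
    · rintro ⟨z, w⟩ ⟨⟨h1, h2⟩, h3, h4⟩
      refine or_iff_not_imp_right.mpr fun hd => ⟨not_not.mp hd, ?_⟩
      obtain ⟨h5, h6⟩ := not_not.mp hd
      simp only [shearSnd, ContinuousMap.coe_mk, Circle.coe_mul, Complex.mul_im] at h3 h4 h5 h6
      exact ⟨by nlinarith, by nlinarith⟩
    · rintro ⟨z, w⟩ ⟨⟨h1, h2⟩, h3, h4⟩
      refine or_iff_not_imp_right.mpr fun hd => ⟨not_not.mp hd, ?_⟩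
      obtain ⟨h5, h6⟩ := not_not.mp hd
      simp only [shearFst, ContinuousMap.coe_mk, Circle.coe_mul, Complex.mul_im] at h3 h4 h5 h6
      exact ⟨by nlinarith, by nlinarith⟩
  have hQ3 : μ.real Q3 ≤ 2 * η + μ.real Dᶜ := by
    refine measureReal_le_of_two_copies μ (shearFstInv.continuous.measurable m3)
      (k1 Q3 m3) (k3 Q3 m3) (Set.disjoint_left.mpr ?_) ?_ ?_
    · rintro ⟨z, w⟩ ⟨⟨h1, h2⟩, h3, h4⟩ ⟨⟨h5, h6⟩, h7, h8⟩
      simp only [shearSndInv, shearFstInv, ContinuousMap.coe_mk, Circle.coe_mul,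
        Circle.coe_inv_eq_conj, Complex.mul_im, Complex.conj_re, Complex.conj_im] at h4 h7
      linarith
    · rintro ⟨z, w⟩ ⟨⟨h1, h2⟩, h3, h4⟩
      refine or_iff_not_imp_right.mpr fun hd => ⟨not_not.mp hd, ?_⟩
      obtain ⟨h5, h6⟩ := not_not.mp hd
      simp only [shearSndInv, ContinuousMap.coe_mk, Circle.coe_mul, Circle.coe_inv_eq_conj,
        Complex.mul_im, Complex.conj_re, Complex.conj_im] at h3 h4 h5 h6
      exact ⟨by nlinarith, by nlinarith⟩
    · rintro ⟨z, w⟩ ⟨⟨h1, h2⟩, h3, h4⟩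
      refine or_iff_not_imp_right.mpr fun hd => ⟨not_not.mp hd, ?_⟩
      obtain ⟨h5, h6⟩ := not_not.mp hd
      simp only [shearFstInv, ContinuousMap.coe_mk, Circle.coe_mul, Circle.coe_inv_eq_conj,
        Complex.mul_im, Complex.conj_re, Complex.conj_im] at h3 h4 h5 h6
      exact ⟨by nlinarith, by nlinarith⟩
  have hQ4 : μ.real Q4 ≤ 2 * η + μ.real Dᶜ := by
    refine measureReal_le_of_two_copies μ (shearFst.continuous.measurable m4)
      (k2 Q4 m4) (k4 Q4 m4) (Set.disjoint_left.mpr ?_) ?_ ?_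
    · rintro ⟨z, w⟩ ⟨⟨h1, h2⟩, h3, h4⟩ ⟨⟨h5, h6⟩, h7, h8⟩
      simp only [shearSnd, shearFst, ContinuousMap.coe_mk, Circle.coe_mul, Complex.mul_im] at h4 h7
      linarith
    · rintro ⟨z, w⟩ ⟨⟨h1, h2⟩, h3, h4⟩
      refine or_iff_not_imp_right.mpr fun hd => ⟨not_not.mp hd, ?_⟩
      obtain ⟨h5, h6⟩ := not_not.mp hd
      simp only [shearSnd, ContinuousMap.coe_mk, Circle.coe_mul, Complex.mul_im] at h3 h4 h5 h6
      exact ⟨by nlinarith, by nlinarith⟩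
    · rintro ⟨z, w⟩ ⟨⟨h1, h2⟩, h3, h4⟩
      refine or_iff_not_imp_right.mpr fun hd => ⟨not_not.mp hd, ?_⟩
      obtain ⟨h5, h6⟩ := not_not.mp hd
      simp only [shearFst, ContinuousMap.coe_mk, Circle.coe_mul, Complex.mul_im] at h3 h4 h5 h6
      exact ⟨by nlinarith, by nlinarith⟩
  have hcover : ({1}ᶜ : Set (Circle × Circle)) ⊆ Dᶜ ∪ (Q1 ∪ Q2 ∪ (Q3 ∪ Q4)) := by
    rintro ⟨z, w⟩ hp
    refine or_iff_not_imp_left.mpr fun hd => ?_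
    have hd := not_not.mp hd
    by_contra hn
    simp only [Set.mem_union, not_or] at hn
    obtain ⟨⟨n1, n2⟩, n3, n4⟩ := hn
    replace n1 := fun h h' => n1 ⟨hd, h, h'⟩
    replace n2 := fun h h' => n2 ⟨hd, h, h'⟩
    replace n3 := fun h h' => n3 ⟨hd, h, h'⟩
    replace n4 := fun h h' => n4 ⟨hd, h, h'⟩
    have hz : (z : ℂ).im = 0 ∧ (w : ℂ).im = 0 := by
      rcases lt_trichotomy (z : ℂ).im 0 with h | h | h
      · exact (le_or_gt (w : ℂ).im 0).elim (fun h' => (n3 h h').elim) fun h' => (n2 h.le h').elim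
      · exact ⟨h, le_antisymm (not_lt.mp (n2 h.le)) (not_lt.mp (n4 h.ge))⟩
      · exact (le_or_gt 0 (w : ℂ).im).elim (fun h' => (n1 h h').elim) fun h' => (n4 h.le h').elim
    have one_of : ∀ u : Circle, 0 < (u : ℂ).re → (u : ℂ).im = 0 → u = 1 := by
      intro u h1 h2
      have h3 := Circle.normSq_coe u
      rw [Complex.normSq_apply, h2] at h3
      refine Circle.ext (Complex.ext ?_ ?_)
      · simp only [Circle.coe_one, Complex.one_re]; nlinarith
      · simpa using h2
    exact hp (Prod.ext (one_of z hd.1 hz.1) (one_of w hd.2 hz.2))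
  have e0 := measureReal_mono (μ := μ) hcover
  have e1 := measureReal_union_le (μ := μ) Dᶜ (Q1 ∪ Q2 ∪ (Q3 ∪ Q4))
  have e2 := measureReal_union_le (μ := μ) (Q1 ∪ Q2) (Q3 ∪ Q4)
  have e3 := measureReal_union_le (μ := μ) Q1 Q2
  have e4 := measureReal_union_le (μ := μ) Q3 Q4
  linarith

end TorusDynamics

/-! ### Rigidity of unitary representations of `SL₂(ℤ) ⋉ ℤ²` -/

section UnitaryRigidity

open scoped CStarAlgebra

open scoped InnerProductSpace

variable {H : Type*} [NormedAddCommGroup H] [InnerProductSpace ℂ H] [CompleteSpace H]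

/-- The spectral measure `μ` of `ξ` makes `F ↦ Φ F ξ` an isometry from `L²(μ)`. -/
theorem norm_sq_apply_eq_integral {Φ : C(Circle × Circle, ℂ) →⋆ₐ[ℂ] (H →L[ℂ] H)} {ξ : H}
    {μ : Measure (Circle × Circle)}
    (hμ : ∀ f : C(Circle × Circle, ℝ), ∫ p, f p ∂μ = (⟪ξ, Φ (torusOfReal f) ξ⟫_ℂ).re)
    (F : C(Circle × Circle, ℂ)) : ‖Φ F ξ‖ ^ 2 = ∫ p, ‖F p‖ ^ 2 ∂μ := by
  have h := hμ ⟨fun p => ‖F p‖ ^ 2, by fun_prop⟩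
  have e : torusOfReal ⟨fun p => ‖F p‖ ^ 2, by fun_prop⟩ = star F * F := by
    ext p
    simp [torusOfReal, Complex.conj_mul']
  rw [e, map_mul, map_star, ContinuousLinearMap.star_eq_adjoint, mul_apply_eq_comp,
    ContinuousLinearMap.adjoint_inner_right] at h
  rw [← inner_self_eq_norm_sq (𝕜 := ℂ)]
  exact h.symm

/-- A unitary which intertwines the calculus `Φ` with its composition with a map `M` of the torus,
and which almost fixes `ξ`, makes the spectral measure of `ξ` almost invariant under `M`. -/
theorem spectral_measure_almost_invariant
    {Φ : C(Circle × Circle, ℂ) →⋆ₐ[ℂ] (H →L[ℂ] H)} {ξ : H}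
    {μ : Measure (Circle × Circle)} [IsFiniteMeasure μ] [μ.Regular]
    (hμ : ∀ f : C(Circle × Circle, ℝ), ∫ p, f p ∂μ = (⟪ξ, Φ (torusOfReal f) ξ⟫_ℂ).re)
    (hξ : ‖ξ‖ = 1) {u : H →L[ℂ] H} (hu : u ∈ unitary (H →L[ℂ] H))
    (M : C(Circle × Circle, Circle × Circle))
    (h1 : star u * Φ torusFst * u = Φ (torusFst.comp M))
    (h2 : star u * Φ torusSnd * u = Φ (torusSnd.comp M))
    {ε : ℝ} (hε : ‖u ξ - ξ‖ ≤ ε) {E : Set (Circle × Circle)} (hE : MeasurableSet E) :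
    μ.real (M ⁻¹' E) ≤ μ.real E + 2 * ε := by
  have hΦ : ∀ F, Φ (F.comp M) = star u * Φ F * u := by
    have : Φ.comp (ContinuousMap.compStarAlgHom' ℂ ℂ M) =
        ((Unitary.conjStarAlgAut ℂ (H →L[ℂ] H) (star ⟨u, hu⟩) :
          (H →L[ℂ] H) →⋆ₐ[ℂ] (H →L[ℂ] H))).comp Φ := by
      apply torus_starAlgHom_ext
      · simpa using! h1.symm
      · simpa using! h2.symm
    intro F
    simpa using! congrArg (fun Ψ => Ψ F) this
  have hmap : (μ.map M).real E = μ.real (M ⁻¹' E) :=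
    map_measureReal_apply M.continuous.measurable hE
  rw [← hmap]
  have : IsFiniteMeasure (μ.map M) := inferInstance
  refine measureReal_le_add_of_integral_le (μ.map M) μ _ (fun f hf => ?_) hE
  have hi : ∫ p, f p ∂(μ.map M) = ∫ p, f (M p) ∂μ :=
    integral_map M.continuous.measurable.aemeasurable f.continuous.aestronglyMeasurable
  have h3 := hμ (f.comp M)
  have h4 : torusOfReal (f.comp M) = (torusOfReal f).comp M := rfl
  simp only [ContinuousMap.comp_apply] at h3
  rw [hi, h3, hμ f, h4, hΦ]
  set A := Φ (torusOfReal f)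
  have hA : ‖A‖ ≤ 1 := by
    refine (NonUnitalStarAlgHom.norm_apply_le Φ (torusOfReal f)).trans ?_
    refine (ContinuousMap.norm_le _ zero_le_one).mpr fun p => ?_
    simp only [torusOfReal, ContinuousMap.coe_mk, Complex.norm_real, Real.norm_eq_abs]
    rw [abs_of_nonneg (hf p).1]
    exact (hf p).2
  have hAv : ∀ v, ‖A v‖ ≤ ‖v‖ := fun v =>
    (A.le_opNorm v).trans (by nlinarith [norm_nonneg v])
  have huξ : ‖u ξ‖ = 1 := by
    rw [ContinuousLinearMap.norm_map_of_mem_unitary hu, hξ]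
  have e1 : ⟪ξ, (star u * A * u) ξ⟫_ℂ = ⟪u ξ, A (u ξ)⟫_ℂ := by
    rw [mul_assoc, mul_apply_eq_comp, ContinuousLinearMap.star_eq_adjoint,
      ContinuousLinearMap.adjoint_inner_right, mul_apply_eq_comp]
  have e2 : ⟪u ξ, A (u ξ)⟫_ℂ = ⟪ξ, A ξ⟫_ℂ + ⟪u ξ - ξ, A (u ξ)⟫_ℂ + ⟪ξ, A (u ξ - ξ)⟫_ℂ := by
    rw [map_sub, inner_sub_left, inner_sub_right]; ring
  have b1 : (⟪u ξ - ξ, A (u ξ)⟫_ℂ).re ≤ ε := by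
    refine (Complex.re_le_norm _).trans ((norm_inner_le_norm _ _).trans ?_)
    have := hAv (u ξ)
    nlinarith [norm_nonneg (u ξ - ξ), norm_nonneg (A (u ξ))]
  have b2 : (⟪ξ, A (u ξ - ξ)⟫_ℂ).re ≤ ε := by
    refine (Complex.re_le_norm _).trans ((norm_inner_le_norm _ _).trans ?_)
    have := hAv (u ξ - ξ)
    rw [hξ, one_mul]
    linarith
  rw [e1, e2, Complex.add_re, Complex.add_re]
  linarith

/-- The quantitative relative property (T) of the pair `ℤ² ⊆ SL₂(ℤ) ⋉ ℤ²`: the unitaries `a`, `b`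
represent the generators of `ℤ²`, and `g`, `h` the elementary matrices. -/
theorem norm_unitary_pow_sub_sq_le {a b g h : H →L[ℂ] H} (ha : a ∈ unitary (H →L[ℂ] H))
    (hb : b ∈ unitary (H →L[ℂ] H)) (hg : g ∈ unitary (H →L[ℂ] H))
    (hh : h ∈ unitary (H →L[ℂ] H)) (hab : a * b = b * a)
    (hga : g * a = a * g) (hgb : g * b = a * b * g) (hha : h * a = a * b * h)
    (hhb : h * b = b * h) {ξ : H} (hξ : ‖ξ‖ = 1) {ε : ℝ} (hε1 : ε ≤ 1)
    (ea : ‖a ξ - ξ‖ ≤ ε) (eb : ‖b ξ - ξ‖ ≤ ε) (eg : ‖g ξ - ξ‖ ≤ ε) (eh : ‖h ξ - ξ‖ ≤ ε)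
    (k : ℕ) : ‖(a ^ k) ξ - ξ‖ ^ 2 ≤ 104 * ε := by
  have hε : 0 ≤ ε := (norm_nonneg _).trans ea
  obtain ⟨Φ, hΦ1, hΦ2⟩ := exists_joint_calculus ha hb hab
  obtain ⟨μ, hfin, hreg, hμ⟩ := exists_spectral_measure Φ ξ
  have hnorm := fun F => norm_sq_apply_eq_integral hμ F
  have haa := Unitary.star_mul_self_of_mem ha
  have hbb := Unitary.star_mul_self_of_mem hb
  have hbb' := Unitary.mul_star_self_of_mem hb
  have hgg := Unitary.star_mul_self_of_mem hg
  have hhh := Unitary.star_mul_self_of_mem hh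
  have hgg' := Unitary.mul_star_self_of_mem hg
  have hhh' := Unitary.mul_star_self_of_mem hh
  have star_move : ∀ u : H →L[ℂ] H, u ∈ unitary (H →L[ℂ] H) → ‖star u ξ - ξ‖ = ‖u ξ - ξ‖ := by
    intro u hu
    have h1 : star u ξ - ξ = star u (ξ - u ξ) := by
      rw [map_sub, ← mul_apply_eq_comp, Unitary.star_mul_self_of_mem hu]; simp
    rw [h1, ContinuousLinearMap.norm_map_of_mem_unitary (Unitary.star_mem hu), norm_sub_rev]
  -- the four shears
  have s1 : ∀ E, MeasurableSet E → μ.real (shearSnd ⁻¹' E) ≤ μ.real E + 2 * ε := by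
    intro E hE
    refine spectral_measure_almost_invariant hμ hξ (Unitary.star_mem hg) shearSnd ?_ ?_
      ((star_move g hg).trans_le eg) hE
    · have : torusFst.comp shearSnd = torusFst := rfl
      rw [this, hΦ1, star_star, hga, mul_assoc, hgg', mul_one]
    · have : torusSnd.comp shearSnd = torusFst * torusSnd := by
        ext p; simp [torusFst, torusSnd, shearSnd]
      rw [this, map_mul, hΦ1, hΦ2, star_star, hgb, mul_assoc, hgg', mul_one]
  have s2 : ∀ E, MeasurableSet E → μ.real (shearSndInv ⁻¹' E) ≤ μ.real E + 2 * ε := by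
    intro E hE
    refine spectral_measure_almost_invariant hμ hξ hg shearSndInv ?_ ?_ eg hE
    · have : torusFst.comp shearSndInv = torusFst := rfl
      rw [this, hΦ1, mul_assoc, ← hga, ← mul_assoc, hgg, one_mul]
    · have : torusSnd.comp shearSndInv = star torusFst * torusSnd := by
        ext p
        change ((p.1⁻¹ * p.2 : Circle) : ℂ) = starRingEnd ℂ (p.1 : ℂ) * (p.2 : ℂ)
        rw [Circle.coe_mul, Circle.coe_inv_eq_conj]
      rw [this, map_mul, map_star, hΦ1, hΦ2]
      have : b * g = star a * (g * b) := by
        rw [hgb, mul_assoc, ← mul_assoc, haa, one_mul]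
      have h2 : star a * g = g * star a := by
        have h3 : star a * (g * a) * star a = star a * (a * g) * star a := by rw [hga]
        rw [← mul_assoc (star a) a g, haa, one_mul, mul_assoc, mul_assoc,
          Unitary.mul_star_self_of_mem ha, mul_one] at h3
        exact h3
      rw [mul_assoc, this, ← mul_assoc (star a), h2, mul_assoc g, ← mul_assoc, hgg, one_mul]
  have s3 : ∀ E, MeasurableSet E → μ.real (shearFst ⁻¹' E) ≤ μ.real E + 2 * ε := by
    intro E hE
    refine spectral_measure_almost_invariant hμ hξ (Unitary.star_mem hh) shearFst ?_ ?_
      ((star_move h hh).trans_le eh) hE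
    · have : torusFst.comp shearFst = torusFst * torusSnd := by
        ext p; simp [torusFst, torusSnd, shearFst]
      rw [this, map_mul, hΦ1, hΦ2, star_star, hha, mul_assoc, hhh', mul_one]
    · have : torusSnd.comp shearFst = torusSnd := rfl
      rw [this, hΦ2, star_star, hhb, mul_assoc, hhh', mul_one]
  have s4 : ∀ E, MeasurableSet E → μ.real (shearFstInv ⁻¹' E) ≤ μ.real E + 2 * ε := by
    intro E hE
    refine spectral_measure_almost_invariant hμ hξ hh shearFstInv ?_ ?_ eh hE
    · have : torusFst.comp shearFstInv = torusFst * star torusSnd := by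
        ext p
        change ((p.1 * p.2⁻¹ : Circle) : ℂ) = (p.1 : ℂ) * starRingEnd ℂ (p.2 : ℂ)
        rw [Circle.coe_mul, Circle.coe_inv_eq_conj]
      rw [this, map_mul, map_star, hΦ1, hΦ2]
      have h2 : star b * h = h * star b := by
        have h3 : star b * (h * b) * star b = star b * (b * h) * star b := by rw [hhb]
        rw [← mul_assoc (star b) b h, hbb, one_mul, mul_assoc, mul_assoc, hbb', mul_one] at h3
        exact h3
      have : a * h = h * a * star b := by
        rw [hha, mul_assoc, ← h2, mul_assoc a, ← mul_assoc b, hbb', one_mul]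
      rw [mul_assoc, this, mul_assoc h, ← mul_assoc, hhh, one_mul]
    · have : torusSnd.comp shearFstInv = torusSnd := rfl
      rw [this, hΦ2, mul_assoc, ← hhb, ← mul_assoc, hhh, one_mul]
  -- Concentration near the neutral element: where the real part of `F` is not positive, `F` has
  -- distance at least `1` from `1`.
  have conc : ∀ F : C(Circle × Circle, ℂ), (∀ p, ‖F p‖ = 1) → ‖Φ F ξ - ξ‖ ≤ ε →
      μ.real {p | 0 < (F p).re}ᶜ ≤ ε ^ 2 := by
    intro F hF hFξ
    have h1 := hnorm (F - 1)
    rw [map_sub, map_one, sub_apply, one_apply_eq_self] at h1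
    have hm : MeasurableSet {p | 0 < (F p).re}ᶜ :=
      (measurableSet_lt measurable_const (Continuous.measurable (by fun_prop))).compl
    have h2 : μ.real {p | 0 < (F p).re}ᶜ ≤ ∫ p, ‖(F - 1) p‖ ^ 2 ∂μ := by
      rw [← integral_indicator_one hm]
      refine integral_mono ((integrable_const _).indicator hm) ?_ fun p => ?_
      · exact Continuous.integrable_of_hasCompactSupport (by fun_prop)
          (HasCompactSupport.of_compactSpace _)
      · by_cases hp : p ∈ {p | 0 < (F p).re}ᶜ
        · rw [Set.indicator_of_mem hp]
          have h3 : (F p).re ≤ 0 := not_lt.mp hp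
          have h4 : 1 ≤ ‖(F - 1) p‖ := by
            have := Complex.abs_re_le_norm ((F - 1) p)
            refine le_trans ?_ this
            rw [abs_of_nonpos] <;> simp <;> linarith
          simp only [Pi.one_apply]
          nlinarith
        · rw [Set.indicator_of_notMem hp]; positivity
    rw [← h1] at h2
    nlinarith [norm_nonneg (Φ F ξ - ξ)]
  have hD : μ.real {p : Circle × Circle | 0 < (p.1 : ℂ).re ∧ 0 < (p.2 : ℂ).re}ᶜ ≤ 2 * ε ^ 2 := by
    have c1 := conc torusFst (fun p => Circle.norm_coe p.1) (by rwa [hΦ1])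
    have c2 := conc torusSnd (fun p => Circle.norm_coe p.2) (by rwa [hΦ2])
    have e : {p : Circle × Circle | 0 < (p.1 : ℂ).re ∧ 0 < (p.2 : ℂ).re}ᶜ =
        {p | 0 < (torusFst p).re}ᶜ ∪ {p | 0 < (torusSnd p).re}ᶜ := by
      rw [← Set.compl_inter]; rfl
    rw [e]
    have := measureReal_union_le (μ := μ) {p | 0 < (torusFst p).re}ᶜ {p | 0 < (torusSnd p).re}ᶜ
    linarith
  -- The complement of the neutral element has measure at most `8 * (2 ε) + 5 * (2 ε²) ≤ 26 ε`, and
  -- `‖z ^ k - 1‖² ≤ 4` there.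
  have hmain := torus_measure_compl_one_le μ s1 s2 s3 s4 hD
  have h1 := hnorm (torusFst ^ k - 1)
  rw [map_sub, map_one, map_pow, hΦ1, sub_apply, one_apply_eq_self] at h1
  rw [h1]
  have hm : MeasurableSet ({1}ᶜ : Set (Circle × Circle)) := (measurableSet_singleton 1).compl
  have h2 : ∫ p, ‖(torusFst ^ k - 1) p‖ ^ 2 ∂μ ≤ 4 * μ.real {1}ᶜ := by
    rw [← integral_indicator_one hm, ← integral_const_mul]
    refine integral_mono ?_ (((integrable_const _).indicator hm).const_mul _) fun p => ?_
    · exact Continuous.integrable_of_hasCompactSupport (by fun_prop)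
          (HasCompactSupport.of_compactSpace _)
    · by_cases hp : p = 1
      · subst hp
        rw [Set.indicator_of_notMem (by simp)]
        simp [torusFst]
      · simp only [Set.indicator_of_mem (show p ∈ ({1}ᶜ : Set (Circle × Circle)) from hp)]
        have h3 : ‖(torusFst ^ k - 1) p‖ ≤ 2 := by
          refine (norm_sub_le _ _).trans ?_
          have h4 : ‖torusFst p‖ = 1 := Circle.norm_coe p.1
          rw [ContinuousMap.pow_apply, norm_pow, h4, ContinuousMap.one_apply, norm_one]
          norm_num
        simp only [Pi.one_apply]
        nlinarith [norm_nonneg ((torusFst ^ k - 1) p)]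
  nlinarith

end UnitaryRigidity

/-! ### Generation of `SL_n(ℤ)` by elementary matrices -/

section ElementaryGeneration

open Matrix

/-- The subgroup of `SL_n(ℤ)` generated by the elementary matrices. -/
def elementarySubgroup (n : ℕ) : Subgroup (SpecialLinearGroup (Fin n) ℤ) :=
  Subgroup.closure {g | ∃ (i j : Fin n) (h : i ≠ j), g = SpecialLinearGroup.transvection h 1}

theorem transvection_mem_elementarySubgroup {n : ℕ} {i j : Fin n} (h : i ≠ j) (c : ℤ) :
    SpecialLinearGroup.transvection h c ∈ elementarySubgroup n := by
  have h1 : SpecialLinearGroup.transvection h (1 : ℤ) ∈ elementarySubgroup n :=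
    Subgroup.subset_closure ⟨i, j, h, rfl⟩
  induction c using Int.induction_on with
  | zero => simp
  | succ k ih => rw [SpecialLinearGroup.transvection_add]; exact mul_mem ih h1
  | pred k ih =>
    rw [sub_eq_add_neg, SpecialLinearGroup.transvection_add,
      ← SpecialLinearGroup.transvection_inv h 1]
    exact mul_mem ih (inv_mem h1)

/-- The first `k` columns of `A` are those of the identity. -/
def ColumnsCleared {n : ℕ} (k : ℕ) (A : SpecialLinearGroup (Fin n) ℤ) : Prop :=
  ∀ i j : Fin n, (j : ℕ) < k → A.1 i j = if i = j then 1 else 0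

theorem coe_transvection_mul_same {n : ℕ} {i j : Fin n} (h : i ≠ j) (c : ℤ)
    (A : SpecialLinearGroup (Fin n) ℤ) (b : Fin n) :
    (SpecialLinearGroup.transvection h c * A).1 i b = A.1 i b + c * A.1 j b :=
  transvection_mul_apply_same i j b c A.1

theorem coe_transvection_mul_of_ne {n : ℕ} {i j : Fin n} (h : i ≠ j) (c : ℤ)
    (A : SpecialLinearGroup (Fin n) ℤ) {a : Fin n} (ha : a ≠ i) (b : Fin n) :
    (SpecialLinearGroup.transvection h c * A).1 a b = A.1 a b :=
  transvection_mul_apply_of_ne i j a b ha c A.1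

theorem ColumnsCleared.transvection_mul {n k : ℕ} {A : SpecialLinearGroup (Fin n) ℤ}
    (hA : ColumnsCleared k A) {i j : Fin n} (h : i ≠ j) (hj : k ≤ j) (c : ℤ) :
    ColumnsCleared k (SpecialLinearGroup.transvection h c * A) := by
  intro a b hb
  have hjb : j ≠ b := fun e => by subst e; omega
  by_cases ha : a = i
  · subst ha
    rw [coe_transvection_mul_same, hA a b hb, hA j b hb, if_neg hjb]
    ring
  · rw [coe_transvection_mul_of_ne h c A ha, hA a b hb]

/-- One step of the reduction to the identity: the next column can be given a diagonal entry `1`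
by the Euclidean algorithm. -/
theorem exists_elementary_mul_diag_one {n : ℕ} (K : Fin n) (A : SpecialLinearGroup (Fin n) ℤ)
    (hA : ColumnsCleared K A) :
    ∃ g ∈ elementarySubgroup n, ColumnsCleared K (g * A) ∧ (g * A).1 K K = 1 := by
  classical
  -- among the products of `A` with elementary matrices from the left, choose one whose column `K`
  -- has the smallest sum of absolute values in the rows from `K` on
  let size : SpecialLinearGroup (Fin n) ℤ → ℕ := fun B =>
    ∑ i ∈ Finset.univ.filter (fun i => K ≤ i), (B.1 i K).natAbs
  let P : ℕ → Prop := fun s => ∃ g ∈ elementarySubgroup n, ColumnsCleared K (g * A) ∧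
    size (g * A) = s
  have hP : ∃ s, P s := ⟨size A, 1, one_mem _, by rwa [one_mul], by rw [one_mul]⟩
  obtain ⟨g, hg, hgA, hs⟩ := Nat.find_spec hP
  have hmin : ∀ g' ∈ elementarySubgroup n, ColumnsCleared K (g' * (g * A)) →
      size (g * A) ≤ size (g' * (g * A)) := by
    intro g' hg' hc
    rw [hs]
    exact Nat.find_min' hP ⟨g' * g, mul_mem hg' hg, by rwa [mul_assoc], by rw [mul_assoc]⟩
  -- it suffices to treat `B = g * A`
  suffices h : ∃ g' ∈ elementarySubgroup n, ColumnsCleared K (g' * (g * A)) ∧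
      (g' * (g * A)).1 K K = 1 by
    obtain ⟨g', h1, h2, h3⟩ := h
    exact ⟨g' * g, mul_mem h1 hg, by rwa [mul_assoc], by rwa [mul_assoc]⟩
  generalize g * A = B at hgA hmin
  clear hs hP P hA hg
  -- otherwise adding or subtracting row `j` to row `i` decreases the size of the column
  have key : ∀ i j, K ≤ i → K ≤ j → i ≠ j → B.1 j K ≠ 0 →
      (B.1 j K).natAbs ≤ (B.1 i K).natAbs → False := by
    intro i j hi hj hij h0 hle
    let c := -((B.1 i K).sign * (B.1 j K).sign)
    have h1 := hmin _ (transvection_mem_elementarySubgroup hij c) (hgA.transvection_mul hij hj c)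
    refine absurd h1 (not_le.mpr ?_)
    refine Finset.sum_lt_sum (fun a _ => ?_) ⟨i, by simp [hi], ?_⟩
    · by_cases ha : a = i
      · subst ha
        rw [coe_transvection_mul_same]
        rcases lt_trichotomy (B.1 a K) 0 with h | h | h <;>
        rcases lt_trichotomy (B.1 j K) 0 with h' | h' | h' <;>
        simp only [c, h, h', Int.sign_eq_neg_one_of_neg, Int.sign_eq_one_of_pos, Int.sign_zero] <;>
        omega
      · rw [coe_transvection_mul_of_ne hij c B ha]
    · rw [coe_transvection_mul_same]
      rcases lt_trichotomy (B.1 i K) 0 with h | h | h <;>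
      rcases lt_trichotomy (B.1 j K) 0 with h' | h' | h' <;>
      simp only [c, h, h', Int.sign_eq_neg_one_of_neg, Int.sign_eq_one_of_pos, Int.sign_zero] <;>
      omega
  have huniq : ∀ i j, K ≤ i → K ≤ j → i ≠ j → B.1 i K ≠ 0 → B.1 j K = 0 := by
    intro i j hi hj hij h0
    by_contra h1
    rcases le_total (B.1 j K).natAbs (B.1 i K).natAbs with h | h
    · exact key i j hi hj hij h1 h
    · exact key j i hj hi hij.symm h0 h
  -- there is a nonzero entry, and it is a unit
  have hinv : ∑ i, (B⁻¹).1 K i * B.1 i K = 1 := by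
    have h1 : (B⁻¹).1 * B.1 = 1 := congrArg Subtype.val (inv_mul_cancel B)
    have h2 := congrFun (congrFun h1 K) K
    rwa [Matrix.mul_apply, Matrix.one_apply_eq] at h2
  have hinvK : ∀ i : Fin n, i < K → (B⁻¹).1 K i = 0 := by
    intro i hi
    have h1 : (B⁻¹).1 * B.1 = 1 := congrArg Subtype.val (inv_mul_cancel B)
    have h2 := congrFun (congrFun h1 K) i
    rw [Matrix.mul_apply, Matrix.one_apply_ne hi.ne'] at h2
    simpa [hgA _ i hi] using h2
  obtain ⟨i0, hi0, hne⟩ : ∃ i, K ≤ i ∧ B.1 i K ≠ 0 := by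
    by_contra hcon
    push Not at hcon
    rw [Finset.sum_eq_zero] at hinv
    · exact zero_ne_one hinv
    · intro i _
      rcases lt_or_ge i K with h | h
      · rw [hinvK i h, zero_mul]
      · rw [hcon i h, mul_zero]
  have hunit : (B⁻¹).1 K i0 * B.1 i0 K = 1 := by
    refine Eq.trans ?_ hinv
    rw [Finset.sum_eq_single i0]
    · intro i _ hi
      rcases lt_or_ge i K with h | h
      · rw [hinvK i h, zero_mul]
      · rw [huniq i0 i hi0 h hi.symm hne, mul_zero]
    · simp
  have hd : B.1 i0 K = 1 ∨ B.1 i0 K = -1 := Int.isUnit_iff.mp (IsUnit.of_mul_eq_one_right _ hunit)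
  by_cases hiK : i0 = K
  · subst hiK
    rcases hd with hd | hd
    · exact ⟨1, one_mem _, by rwa [one_mul], by rwa [one_mul]⟩
    -- A diagonal entry `-1` is corrected with the help of a lower row. In the last column there is
    -- none, but then the matrix is upper triangular with determinant `-1`.
    · by_cases hlast : ∃ i, i0 < i
      · obtain ⟨i, hi⟩ := hlast
        have h0 := huniq i0 i le_rfl hi.le hi.ne hne
        refine ⟨SpecialLinearGroup.transvection hi.ne 2 *
          SpecialLinearGroup.transvection hi.ne' (-1),
          mul_mem (transvection_mem_elementarySubgroup _ _)
            (transvection_mem_elementarySubgroup _ _), ?_, ?_⟩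
        · rw [mul_assoc]
          exact (hgA.transvection_mul _ le_rfl _).transvection_mul _ hi.le _
        · rw [mul_assoc, coe_transvection_mul_same, coe_transvection_mul_same,
            coe_transvection_mul_of_ne _ _ _ hi.ne, hd, h0]
          norm_num
      · exfalso
        push Not at hlast
        have htri : B.1.BlockTriangular id := by
          intro i j hij
          have hj : j < i0 := lt_of_lt_of_le hij (hlast i)
          have h : i ≠ j := ne_of_gt (show j < i from hij)
          rw [hgA i j hj, if_neg h]
        have hdet := B.2
        rw [Matrix.det_of_isUpperTriangular htri, Finset.prod_eq_single i0] at hdet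
        · rw [hd] at hdet; norm_num at hdet
        · intro j _ hj
          rw [hgA j j (show j < i0 from lt_of_le_of_ne (hlast j) hj), if_pos rfl]
        · simp
  · refine ⟨SpecialLinearGroup.transvection (Ne.symm hiK) (B.1 i0 K),
      transvection_mem_elementarySubgroup _ _, hgA.transvection_mul _ hi0 _, ?_⟩
    rw [coe_transvection_mul_same, huniq i0 K hi0 le_rfl hiK hne]
    rcases hd with hd | hd <;> rw [hd] <;> norm_num

/-- Gaussian elimination, column by column. -/
theorem exists_elementary_mul_columnsCleared {n : ℕ} (A : SpecialLinearGroup (Fin n) ℤ) (k : ℕ)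
    (hk : k ≤ n) : ∃ g ∈ elementarySubgroup n, ColumnsCleared k (g * A) := by
  classical
  induction k with
  | zero => exact ⟨1, one_mem _, fun i j h => absurd h (Nat.not_lt_zero _)⟩
  | succ k ih =>
    obtain ⟨g1, hg1, hc1⟩ := ih (by omega)
    let K : Fin n := ⟨k, by omega⟩
    obtain ⟨g2, hg2, hc2, hd2⟩ := exists_elementary_mul_diag_one K (g1 * A) hc1
    generalize hB : g2 * (g1 * A) = B at hc2 hd2
    -- clear the column `K` off the rows in a finite set
    have clear : ∀ s : Finset (Fin n), K ∉ s → ∃ g ∈ elementarySubgroup n,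
        ColumnsCleared k (g * B) ∧ (g * B).1 K K = 1 ∧ ∀ i ∈ s, (g * B).1 i K = 0 := by
      intro s
      induction s using Finset.induction_on with
      | empty =>
        intro _
        exact ⟨1, one_mem _, by rwa [one_mul], by rwa [one_mul], by simp⟩
      | insert a s ha ih' =>
        intro hs
        rw [Finset.mem_insert, not_or] at hs
        obtain ⟨g, hg, h1, h2, h3⟩ := ih' hs.2
        refine ⟨SpecialLinearGroup.transvection (Ne.symm hs.1) (-(g * B).1 a K) * g,
          mul_mem (transvection_mem_elementarySubgroup _ _) hg, ?_, ?_, ?_⟩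
        · rw [mul_assoc]
          exact h1.transvection_mul _ le_rfl _
        · rw [mul_assoc, coe_transvection_mul_of_ne _ _ _ hs.1, h2]
        · intro i hi
          rw [mul_assoc]
          rcases Finset.mem_insert.mp hi with rfl | hi
          · rw [coe_transvection_mul_same, h2]; ring
          · rw [coe_transvection_mul_of_ne _ _ _ (ne_of_mem_of_not_mem hi ha), h3 i hi]
    obtain ⟨g, hg, h1, h2, h3⟩ := clear (Finset.univ.erase K) (by simp)
    refine ⟨g * (g2 * g1), mul_mem hg (mul_mem hg2 hg1), ?_⟩
    rw [mul_assoc, mul_assoc, hB]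
    intro i j hj
    by_cases hjK : j = K
    · subst hjK
      split_ifs with h
      · rw [h]; exact h2
      · exact h3 i (by simp [h])
    · refine h1 i j ?_
      have : (j : ℕ) ≠ k := fun e => hjK (Fin.ext e)
      omega

/-- `SL_n(ℤ)` is generated by elementary matrices. -/
theorem elementarySubgroup_eq_top (n : ℕ) : elementarySubgroup n = ⊤ := by
  rw [eq_top_iff]
  intro A _
  obtain ⟨g, hg, hc⟩ := exists_elementary_mul_columnsCleared A n le_rfl
  have h1 : g * A = 1 := by
    ext i j
    rw [hc i j j.2]
    simp [Matrix.one_apply]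
  rw [eq_inv_of_mul_eq_one_right h1]
  exact inv_mem hg

end ElementaryGeneration

/-! ### Relative property (T) for `ℤⁿ ⊆ SL_n(ℤ) ⋉ ℤⁿ` -/

section RelativePropertyT

open Matrix

/-- The translation by `v ∈ ℤⁿ`, as an element of `SL_n(ℤ) ⋉ ℤⁿ`. -/
def translElt {n : ℕ} (v : Fin n → ℤ) : AffineSL n := ⟨Multiplicative.ofAdd v, 1⟩

/-- The linear map `A ∈ SL_n(ℤ)`, as an element of `SL_n(ℤ) ⋉ ℤⁿ`. -/
def linElt {n : ℕ} (A : SpecialLinearGroup (Fin n) ℤ) : AffineSL n := ⟨1, A⟩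

theorem translElt_add {n : ℕ} (v w : Fin n → ℤ) :
    translElt (v + w) = translElt v * translElt w := by
  refine SemidirectProduct.ext ?_ ?_ <;> simp [translElt]

theorem translElt_zero {n : ℕ} : translElt (0 : Fin n → ℤ) = 1 := rfl

theorem translElt_neg {n : ℕ} (v : Fin n → ℤ) : translElt (-v) = (translElt v)⁻¹ := by
  rw [eq_inv_iff_mul_eq_one, ← translElt_add, neg_add_cancel, translElt_zero]

theorem linElt_mul {n : ℕ} (A B : SpecialLinearGroup (Fin n) ℤ) :
    linElt (A * B) = linElt A * linElt B := by
  refine SemidirectProduct.ext ?_ ?_ <;> simp [linElt]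

theorem linElt_inv {n : ℕ} (A : SpecialLinearGroup (Fin n) ℤ) :
    linElt A⁻¹ = (linElt A)⁻¹ := by
  rw [eq_inv_iff_mul_eq_one, ← linElt_mul, inv_mul_cancel]; rfl

theorem linElt_mul_translElt {n : ℕ} (A : SpecialLinearGroup (Fin n) ℤ) (v : Fin n → ℤ) :
    linElt A * translElt v = translElt (A.1 *ᵥ v) * linElt A := by
  refine SemidirectProduct.ext ?_ ?_
  · change 1 * slAut n A (Multiplicative.ofAdd v) =
      Multiplicative.ofAdd (A.1 *ᵥ v) * slAut n 1 1
    rw [map_one, one_mul]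
    simp [slAut, SpecialLinearGroup.toLin'_apply]
  · simp [translElt, linElt]

theorem eq_translElt_mul_linElt {n : ℕ} (g : AffineSL n) :
    g = translElt g.left.toAdd * linElt g.right := by
  refine SemidirectProduct.ext ?_ ?_ <;> simp [translElt, linElt]

theorem translElt_zsmul {n : ℕ} (v : Fin n → ℤ) (k : ℤ) :
    translElt (k • v) = translElt v ^ k := by
  induction k using Int.induction_on with
  | zero => simp [translElt_zero]
  | succ k ih => rw [add_zsmul, one_zsmul, translElt_add, ih, _root_.zpow_add_one]
  | pred k ih => rw [sub_zsmul, one_zsmul, sub_eq_add_neg, translElt_add, ih, translElt_neg,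
      ← sub_eq_add_neg, _root_.zpow_sub_one]

variable {H : Type*} [NormedAddCommGroup H] [InnerProductSpace ℂ H] [CompleteSpace H]

theorem norm_apply_inv_sub {G : Type*} [Group G] (π : G →* (H →L[ℂ] H))
    (hπ : ∀ g, π g ∈ unitary (H →L[ℂ] H)) (g : G) (ξ : H) : ‖π g⁻¹ ξ - ξ‖ = ‖π g ξ - ξ‖ := by
  have h1 : π g⁻¹ ξ - ξ = π g⁻¹ (ξ - π g ξ) := by
    rw [map_sub, ← mul_apply_eq_comp, ← map_mul]; simp
  rw [h1, ContinuousLinearMap.norm_map_of_mem_unitary (hπ _), norm_sub_rev]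

/-- The displacement of a vector is subadditive on the group. -/
theorem norm_apply_mul_sub_le {G : Type*} [Group G] (π : G →* (H →L[ℂ] H))
    (hπ : ∀ g, π g ∈ unitary (H →L[ℂ] H)) (g h : G) (ξ : H) :
    ‖π (g * h) ξ - ξ‖ ≤ ‖π g ξ - ξ‖ + ‖π h ξ - ξ‖ := by
  have h1 : π (g * h) ξ - ξ = (π g ξ - ξ) + π g (π h ξ - ξ) := by
    rw [map_sub, map_mul, mul_apply_eq_comp]; abel
  rw [h1]
  refine (norm_add_le _ _).trans_eq ?_
  rw [ContinuousLinearMap.norm_map_of_mem_unitary (hπ _)]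

/-- The pair `ℤⁿ ⊆ SL_n(ℤ) ⋉ ℤⁿ` has the relative property (T): a vector which is almost fixed by
the elementary matrices and the generators of `ℤⁿ` is almost fixed by `ℤⁿ`, uniformly. -/
theorem norm_translElt_sub_le {n : ℕ} (hn : 2 ≤ n) (π : AffineSL n →* (H →L[ℂ] H))
    (hπ : ∀ g, π g ∈ unitary (H →L[ℂ] H)) {ξ : H} (hξ : ‖ξ‖ = 1) {ε : ℝ} (hε1 : ε ≤ 1)
    (h1 : ∀ (i j : Fin n) (h : i ≠ j),
      ‖π (linElt (SpecialLinearGroup.transvection h 1)) ξ - ξ‖ ≤ ε)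
    (h2 : ∀ i : Fin n, ‖π (translElt (Pi.single i 1)) ξ - ξ‖ ≤ ε) (v : Fin n → ℤ) :
    ‖π (translElt v) ξ - ξ‖ ≤ n * √(104 * ε) := by
  -- the multiples of a basis vector `e_i` are treated in a copy of `SL₂(ℤ) ⋉ ℤ²`
  have hcoord : ∀ (i : Fin n) (k : ℤ),
      ‖π (translElt (k • Pi.single i 1)) ξ - ξ‖ ≤ √(104 * ε) := by
    intro i k
    obtain ⟨j, hij⟩ : ∃ j : Fin n, i ≠ j := by
      have : Nontrivial (Fin n) := Fin.nontrivial_iff_two_le.mpr hn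
      obtain ⟨j, hj⟩ := exists_ne i
      exact ⟨j, hj.symm⟩
    have rel : ∀ {k l : Fin n} (h : k ≠ l),
        linElt (SpecialLinearGroup.transvection h 1) * translElt (Pi.single k 1) =
          translElt (Pi.single k 1) * linElt (SpecialLinearGroup.transvection h 1) ∧
        linElt (SpecialLinearGroup.transvection h 1) * translElt (Pi.single l 1) =
          translElt (Pi.single k 1) * translElt (Pi.single l 1) *
            linElt (SpecialLinearGroup.transvection h 1) := by
      intro k l h
      rw [linElt_mul_translElt, linElt_mul_translElt, ← translElt_add]
      have e1 := SpecialLinearGroup.transvection_smul_single_fst h (1 : ℤ)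
      have e2 := SpecialLinearGroup.transvection_smul_single_snd h (1 : ℤ)
      rw [one_smul, add_comm] at e2
      exact ⟨congrArg (fun v => translElt v * _) e1, congrArg (fun v => translElt v * _) e2⟩
    have comm : translElt (Pi.single i 1 : Fin n → ℤ) * translElt (Pi.single j 1) =
        translElt (Pi.single j 1) * translElt (Pi.single i 1) := by
      rw [← translElt_add, ← translElt_add, add_comm]
    have main : ∀ m : ℕ, ‖π (translElt (Pi.single i 1) ^ m) ξ - ξ‖ ≤ √(104 * ε) := by
      intro m
      apply Real.le_sqrt_of_sq_le
      rw [map_pow]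
      refine norm_unitary_pow_sub_sq_le (hπ _) (hπ (translElt (Pi.single j 1)))
        (hπ (linElt (SpecialLinearGroup.transvection hij 1)))
        (hπ (linElt (SpecialLinearGroup.transvection hij.symm 1))) ?_ ?_ ?_ ?_ ?_ hξ hε1
        (h2 i) (h2 j) (h1 _ _ _) (h1 _ _ _) m
      · rw [← map_mul, ← map_mul, comm]
      · rw [← map_mul, ← map_mul, (rel hij).1]
      · rw [← map_mul, ← map_mul, ← map_mul, (rel hij).2]
      · rw [← map_mul, ← map_mul, ← map_mul, (rel hij.symm).2, comm]
      · rw [← map_mul, ← map_mul, (rel hij.symm).1]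
    rw [translElt_zsmul]
    obtain ⟨m, rfl | rfl⟩ := k.eq_nat_or_neg
    · rw [zpow_natCast]; exact main m
    · rw [_root_.zpow_neg, zpow_natCast, norm_apply_inv_sub π hπ]; exact main m
  have hsum : ∀ s : Finset (Fin n),
      ‖π (translElt (∑ i ∈ s, v i • Pi.single i 1)) ξ - ξ‖ ≤ s.card * √(104 * ε) := by
    intro s
    induction s using Finset.induction_on with
    | empty => simp [translElt_zero]
    | insert a s ha ih =>
      rw [Finset.sum_insert ha, translElt_add, Finset.card_insert_of_notMem ha]
      refine (norm_apply_mul_sub_le π hπ _ _ ξ).trans ?_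
      push_cast
      linarith [hcoord a (v a)]
  have := hsum Finset.univ
  have hv : ∑ i, v i • Pi.single i (1 : ℤ) = v := by
    ext j
    simp [Finset.sum_apply, Pi.single_apply]
  rwa [hv, Finset.card_univ, Fintype.card_fin] at this

end RelativePropertyT

/-! ### Almost invariant sets of measure preserving actions -/

section Koopman

/-- The maps `T g` form an action of the group `G` by measure preserving maps of `(Ω, m)`. -/
structure IsMeasurePreservingAction {G Ω : Type*} [Group G] [MeasurableSpace Ω] (m : Measure Ω)
    (T : G → Ω → Ω) : Prop where
  one : ∀ x, T 1 x = x
  mul : ∀ g h x, T (g * h) x = T g (T h x)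
  mp : ∀ g, MeasurePreserving (T g) m m

variable {G Ω : Type*} [Group G] [MeasurableSpace Ω] {m : Measure Ω} {T : G → Ω → Ω}

theorem IsMeasurePreservingAction.inv_apply (hT : IsMeasurePreservingAction m T) (g : G) (x : Ω) :
    T g⁻¹ (T g x) = x := by rw [← hT.mul, inv_mul_cancel, hT.one]

/-- The Koopman representation of a measure preserving action on `L²`: `g` maps `f` to
`f ∘ T g⁻¹`. -/
noncomputable def koopman (𝕜 : Type*) [RCLike 𝕜] (hT : IsMeasurePreservingAction m T) :
    G →* (Lp 𝕜 2 m →L[𝕜] Lp 𝕜 2 m) where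
  toFun g := (Lp.compMeasurePreservingₗᵢ 𝕜 (T g⁻¹) (hT.mp g⁻¹)).toContinuousLinearMap
  map_one' := by
    ext1 f
    apply Lp.ext
    refine (Lp.coeFn_compMeasurePreserving f (hT.mp 1⁻¹)).trans ?_
    have : (f : Ω → 𝕜) ∘ T 1⁻¹ = f := by funext x; simp [hT.one]
    rw [this]; rfl
  map_mul' g h := by
    ext1 f
    apply Lp.ext
    refine (Lp.coeFn_compMeasurePreserving f (hT.mp (g * h)⁻¹)).trans ?_
    symm
    refine (Lp.coeFn_compMeasurePreserving
      (Lp.compMeasurePreserving (T h⁻¹) (hT.mp h⁻¹) f) (hT.mp g⁻¹)).trans ?_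
    have h1 := (hT.mp g⁻¹).quasiMeasurePreserving.ae_eq_comp
      (Lp.coeFn_compMeasurePreserving f (hT.mp h⁻¹))
    refine h1.trans (Filter.EventuallyEq.of_eq ?_)
    funext x
    simp [hT.mul]

theorem norm_koopman {𝕜 : Type*} [RCLike 𝕜] (hT : IsMeasurePreservingAction m T) (g : G)
    (f : Lp 𝕜 2 m) : ‖koopman 𝕜 hT g f‖ = ‖f‖ :=
  (Lp.compMeasurePreservingₗᵢ 𝕜 (T g⁻¹) (hT.mp g⁻¹)).norm_map f

theorem koopman_coeFn {𝕜 : Type*} [RCLike 𝕜] (hT : IsMeasurePreservingAction m T) (g : G)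
    (f : Lp 𝕜 2 m) : koopman 𝕜 hT g f =ᵐ[m] f ∘ T g⁻¹ :=
  Lp.coeFn_compMeasurePreserving f (hT.mp g⁻¹)

theorem koopman_mem_unitary (hT : IsMeasurePreservingAction m T) (g : G) :
    koopman ℂ hT g ∈ unitary (Lp ℂ 2 m →L[ℂ] Lp ℂ 2 m) := by
  have h1 : star (koopman ℂ hT g) * koopman ℂ hT g = 1 :=
    (ContinuousLinearMap.norm_map_iff_adjoint_comp_self _).mp (norm_koopman hT g)
  have h2 : koopman ℂ hT g * koopman ℂ hT g⁻¹ = 1 := by rw [← map_mul]; simp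
  rw [Unitary.mem_iff]
  refine ⟨h1, ?_⟩
  rw [left_inv_eq_right_inv h1 h2, h2]

theorem koopman_indicator {𝕜 : Type*} [RCLike 𝕜] (hT : IsMeasurePreservingAction m T) (g : G)
    {E : Set Ω} (hE : MeasurableSet E) (hfin : m E ≠ ⊤) :
    koopman 𝕜 hT g (indicatorConstLp 2 hE hfin (1 : 𝕜)) =
      indicatorConstLp 2 ((hT.mp g⁻¹).measurable hE)
        (by rwa [(hT.mp g⁻¹).measure_preimage hE.nullMeasurableSet]) 1 :=
  Lp.indicatorConstLp_compMeasurePreserving hE hfin 1 (hT.mp g⁻¹)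

theorem norm_koopman_indicator_sub_sq {𝕜 : Type*} [RCLike 𝕜]
    (hT : IsMeasurePreservingAction m T) (g : G)
    {E : Set Ω} (hE : MeasurableSet E) (hfin : m E ≠ ⊤) :
    ‖koopman 𝕜 hT g (indicatorConstLp 2 hE hfin (1 : 𝕜)) - indicatorConstLp 2 hE hfin (1 : 𝕜)‖ ^ 2
      = m.real (symmDiff (T g⁻¹ ⁻¹' E) E) := by
  rw [koopman_indicator, ← dist_eq_norm, dist_indicatorConstLp_eq_norm,
    norm_indicatorConstLp (by norm_num) (by norm_num)]
  simp only [norm_one, one_mul, ENNReal.toReal_ofNat]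
  rw [← Real.sqrt_eq_rpow, Real.sq_sqrt measureReal_nonneg]

theorem measureReal_symmDiff_inv (hT : IsMeasurePreservingAction m T) (g : G)
    {E : Set Ω} (hE : MeasurableSet E) :
    m.real (symmDiff (T g⁻¹ ⁻¹' E) E) = m.real (symmDiff (T g ⁻¹' E) E) := by
  rw [← (hT.mp g).measureReal_preimage (((hT.mp g⁻¹).measurable hE).symmDiff hE).nullMeasurableSet,
    Set.preimage_symmDiff, ← Set.preimage_comp]
  have : T g⁻¹ ∘ T g = id := funext (hT.inv_apply g)
  rw [this, Set.preimage_id, symmDiff_comm]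

/-- A vector whose orbit under a group of linear isometries has small diameter is close to a fixed
vector, namely the point of minimal norm in the closed convex hull of the orbit. -/
theorem exists_fixed_vector {H : Type*} [NormedAddCommGroup H] [InnerProductSpace ℝ H]
    [CompleteSpace H] (π : G →* (H →L[ℝ] H)) (hπ : ∀ g f, ‖π g f‖ = ‖f‖) (ξ : H) {δ : ℝ}
    (h : ∀ g, ‖π g ξ - ξ‖ ≤ δ) : ∃ η, (∀ g, π g η = η) ∧ ‖η - ξ‖ ≤ δ := by
  let K : Set H := closure (convexHull ℝ (Set.range fun g => π g ξ))
  have hK : Convex ℝ K := (convex_convexHull ℝ _).closure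
  have hne : K.Nonempty := ⟨π 1 ξ, subset_closure (subset_convexHull ℝ _ ⟨1, rfl⟩)⟩
  obtain ⟨η, hη, hmin⟩ := exists_norm_eq_iInf_of_complete_convex hne
    isClosed_closure.isComplete hK 0
  -- `⟪-η, ζ - η⟫ ≤ 0` for all `ζ ∈ K`; for `ζ = π g η`, which has the same norm as `η`, this forces
  -- `π g η = η`
  have hvar := (norm_eq_iInf_iff_real_inner_le_zero hK hη).mp hmin
  refine ⟨η, fun g => ?_, ?_⟩
  · have hmem : π g η ∈ K := by
      have h1 : π g '' K ⊆ closure (π g '' convexHull ℝ (Set.range fun g => π g ξ)) :=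
        image_closure_subset_closure_image (π g).continuous
      have h2 : π g '' convexHull ℝ (Set.range fun g => π g ξ) ⊆
          convexHull ℝ (Set.range fun g => π g ξ) := by
        have := (π g : H →ₗ[ℝ] H).image_convexHull (Set.range fun g => π g ξ)
        refine (this.subset.trans (convexHull_mono ?_))
        rintro _ ⟨_, ⟨k, rfl⟩, rfl⟩
        refine ⟨g * k, ?_⟩
        simp only [map_mul]
        rfl
      exact closure_mono h2 (h1 ⟨η, hη, rfl⟩)
    have h3 := hvar _ hmem
    rw [zero_sub, inner_neg_left, inner_sub_right, real_inner_self_eq_norm_sq] at h3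
    have h4 := norm_sub_sq_real (π g η) η
    rw [hπ, real_inner_comm] at h4
    have h5 : ‖π g η - η‖ ^ 2 ≤ 0 := by linarith
    have h6 : ‖π g η - η‖ = 0 := by nlinarith [norm_nonneg (π g η - η)]
    exact sub_eq_zero.mp (norm_eq_zero.mp h6)
  · have hsub : K ⊆ Metric.closedBall ξ δ := by
      refine closure_minimal (convexHull_min ?_ (convex_closedBall _ _)) Metric.isClosed_closedBall
      rintro _ ⟨g, rfl⟩
      rw [mem_closedBall_iff_norm]
      exact h g
    exact mem_closedBall_iff_norm.mp (hsub hη)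

/-- A set which is almost invariant, uniformly over the group, is close to an invariant set: a
superlevel set of a nearby invariant function. -/
theorem exists_invariant_set (hT : IsMeasurePreservingAction m T) {E : Set Ω}
    (hE : MeasurableSet E) (hfin : m E ≠ ⊤) {δ : ℝ}
    (h : ∀ g, m.real (symmDiff (T g ⁻¹' E) E) ≤ δ) :
    ∃ F, MeasurableSet F ∧ (∀ g, ∀ᵐ x ∂m, T g x ∈ F ↔ x ∈ F) ∧ m (symmDiff F E) ≠ ⊤ ∧
      m.real (symmDiff F E) ≤ 4 * δ := by
  have hδ : 0 ≤ δ := measureReal_nonneg.trans (h 1)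
  set ξ : Lp ℝ 2 m := indicatorConstLp 2 hE hfin (1 : ℝ) with hξ
  obtain ⟨η, hη, hηξ⟩ := exists_fixed_vector (koopman ℝ hT) (norm_koopman hT) ξ (δ := √δ)
    (fun g => by
      apply Real.le_sqrt_of_sq_le
      rw [hξ, norm_koopman_indicator_sub_sq, measureReal_symmDiff_inv hT g hE]
      exact h g)
  obtain ⟨f, hfm, hfη⟩ := (Lp.aestronglyMeasurable η).aemeasurable
  let F : Set Ω := {x | 1 / 2 < f x}
  have hF : MeasurableSet F := measurableSet_lt measurable_const hfm
  -- on `F ∆ E` the functions `η` and `1_E` differ by at least `1/2`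
  have hcheb : m (symmDiff F E) ≤ ENNReal.ofReal (4 * δ) := by
    have hsub : ∀ᵐ x ∂m, x ∈ symmDiff F E → ENNReal.ofReal (1 / 2) ≤ ‖(η - ξ : Lp ℝ 2 m) x‖ₑ := by
      filter_upwards [hfη, Lp.coeFn_sub η ξ, (indicatorConstLp_coeFn : ξ =ᵐ[m] _)] with
        x h1 h2 h3 hx
      rw [h2, Pi.sub_apply, h3, h1, Real.enorm_eq_ofReal_abs]
      apply ENNReal.ofReal_le_ofReal
      rcases hx with ⟨hx1, hx2⟩ | ⟨hx1, hx2⟩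
      · rw [Set.indicator_of_notMem hx2, sub_zero]
        exact (le_of_lt hx1).trans (le_abs_self _)
      · rw [Set.indicator_of_mem hx1]
        have : f x ≤ 1 / 2 := not_lt.mp hx2
        rw [abs_sub_comm]
        exact le_trans (by linarith) (le_abs_self _)
    have h1 : m (symmDiff F E) ≤ m {x | ENNReal.ofReal (1 / 2) ≤ ‖(η - ξ : Lp ℝ 2 m) x‖ₑ} :=
      measure_mono_ae hsub
    have h2 := meas_ge_le_mul_pow_eLpNorm_enorm m (p := 2) (by norm_num) (by norm_num)
      (Lp.aestronglyMeasurable (η - ξ)) (ε := ENNReal.ofReal (1 / 2)) (by simp) (by simp)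
    refine h1.trans (h2.trans ?_)
    rw [← Lp.enorm_def, ← ofReal_norm, ENNReal.toReal_ofNat,
      ENNReal.rpow_ofNat, ENNReal.rpow_ofNat, ← ENNReal.ofReal_inv_of_pos (by norm_num),
      ← ENNReal.ofReal_pow (by norm_num), ← ENNReal.ofReal_pow (norm_nonneg _),
      ← ENNReal.ofReal_mul (by positivity)]
    apply ENNReal.ofReal_le_ofReal
    have : ‖η - ξ‖ ^ 2 ≤ δ := by
      rw [← Real.sq_sqrt hδ]
      gcongr
    norm_num
    linarith
  refine ⟨F, hF, fun g => ?_, (hcheb.trans_lt ENNReal.ofReal_lt_top).ne, ?_⟩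
  · have h1 : η =ᵐ[m] η ∘ T g := by
      have h2 := koopman_coeFn (𝕜 := ℝ) hT g⁻¹ η
      rw [hη, inv_inv] at h2
      exact h2
    have h3 := (hT.mp g).quasiMeasurePreserving.ae_eq_comp hfη
    filter_upwards [h1, h3, hfη] with x a1 a2 a3
    simp only [Function.comp_apply] at a1 a2
    change 1 / 2 < f (T g x) ↔ 1 / 2 < f x
    rw [← a2, ← a1, a3]
  · exact ENNReal.toReal_le_of_le_ofReal (by positivity) hcheb

/-- Relative property (T) of `ℤⁿ ⊆ SL_n(ℤ) ⋉ ℤⁿ`, for subsets of a measure preserving action. -/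
theorem measureReal_symmDiff_translElt_le {n : ℕ} (hn : 2 ≤ n) {T : AffineSL n → Ω → Ω}
    (hT : IsMeasurePreservingAction m T) {E : Set Ω} (hE : MeasurableSet E) (hfin : m E ≠ ⊤)
    {ε : ℝ} (hε : 0 ≤ ε) (hε1 : ε ≤ 1)
    (h1 : ∀ (i j : Fin n) (h : i ≠ j),
      m.real (symmDiff (T (linElt (Matrix.SpecialLinearGroup.transvection h 1)) ⁻¹' E) E) ≤
        ε ^ 2 * m.real E)
    (h2 : ∀ i : Fin n, m.real (symmDiff (T (translElt (Pi.single i 1)) ⁻¹' E) E) ≤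
        ε ^ 2 * m.real E) (v : Fin n → ℤ) :
    m.real (symmDiff (T (translElt v) ⁻¹' E) E) ≤ n ^ 2 * (104 * ε) * m.real E := by
  set ξ : Lp ℂ 2 m := indicatorConstLp 2 hE hfin (1 : ℂ) with hξ
  have hnorm : ‖ξ‖ ^ 2 = m.real E := by
    rw [hξ, norm_indicatorConstLp (by norm_num) (by norm_num)]
    simp only [norm_one, one_mul, ENNReal.toReal_ofNat]
    rw [← Real.sqrt_eq_rpow, Real.sq_sqrt measureReal_nonneg]
  have hsq : ∀ g, ‖koopman ℂ hT g ξ - ξ‖ ^ 2 = m.real (symmDiff (T g ⁻¹' E) E) := fun g => by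
    rw [hξ, norm_koopman_indicator_sub_sq, measureReal_symmDiff_inv hT g hE]
  rcases eq_or_ne ξ 0 with h0 | h0
  · have := hsq (translElt v)
    rw [h0, map_zero, sub_zero, norm_zero] at this
    rw [← this]
    have := measureReal_nonneg (μ := m) (s := E)
    rw [zero_pow two_ne_zero]
    positivity
  have hpos : 0 < ‖ξ‖ := norm_pos_iff.mpr h0
  let ξ₀ : Lp ℂ 2 m := ((‖ξ‖⁻¹ : ℝ) : ℂ) • ξ
  have hξ₀ : ‖ξ₀‖ = 1 := by
    rw [norm_smul, Complex.norm_real, norm_inv, norm_norm, inv_mul_cancel₀ hpos.ne']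
  have hscale : ∀ g, ‖koopman ℂ hT g ξ₀ - ξ₀‖ = ‖ξ‖⁻¹ * ‖koopman ℂ hT g ξ - ξ‖ := by
    intro g
    rw [map_smul, ← smul_sub, norm_smul, Complex.norm_real, norm_inv, norm_norm]
  have hsmall : ∀ g, m.real (symmDiff (T g ⁻¹' E) E) ≤ ε ^ 2 * m.real E →
      ‖koopman ℂ hT g ξ₀ - ξ₀‖ ≤ ε := by
    intro g hg
    rw [hscale, inv_mul_le_iff₀ hpos]
    rw [← hsq, ← hnorm, ← mul_pow] at hg
    rw [mul_comm]
    exact le_of_sq_le_sq hg (by positivity)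
  have := norm_translElt_sub_le hn (koopman ℂ hT) (koopman_mem_unitary hT) hξ₀ hε1
    (fun i j h => hsmall _ (h1 i j h)) (fun i => hsmall _ (h2 i)) v
  rw [hscale, inv_mul_le_iff₀ hpos] at this
  rw [← hsq, ← hnorm]
  calc ‖koopman ℂ hT (translElt v) ξ - ξ‖ ^ 2 ≤ (‖ξ‖ * (n * √(104 * ε))) ^ 2 := by gcongr
    _ = n ^ 2 * (104 * ε) * ‖ξ‖ ^ 2 := by
      rw [mul_pow, mul_pow, Real.sq_sqrt (by positivity)]; ring

end Koopman

/-! ### Cosets in the profinite space and ergodicity -/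

section ProfiniteSpace

namespace DivChain

variable (J : DivChain) (n : ℕ)

instance : SecondCountableTopology (J.limit n) :=
  TopologicalSpace.Subtype.secondCountableTopology _

instance : StandardBorelSpace (J.limit n) :=
  (J.isClosed_limit n).measurableSet.standardBorel

instance : (J.limitMeasure n).IsAddHaarMeasure := by
  unfold limitMeasure; infer_instance

instance : Countable (Matrix.SpecialLinearGroup (Fin n) ℤ) :=
  have : Countable (Matrix (Fin n) (Fin n) ℤ) := inferInstanceAs (Countable (Fin n → Fin n → ℤ))
  Subtype.val_injective.countable (α := Matrix.SpecialLinearGroup (Fin n) ℤ)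
    (β := Matrix (Fin n) (Fin n) ℤ)

instance : Countable (AffineSL n) :=
  have : Countable (Multiplicative (Fin n → ℤ)) := inferInstanceAs (Countable (Fin n → ℤ))
  Function.Injective.countable (f := fun g : AffineSL n => (g.left, g.right)) fun _ _ e =>
    SemidirectProduct.ext (congrArg Prod.fst e) (congrArg Prod.snd e)

theorem continuous_smul (g : AffineSL n) : Continuous fun x : J.limit n => g • x := by
  refine Continuous.subtype_mk (continuous_pi fun i => ?_) _
  exact (continuous_of_discreteTopology (f := affineMap n (J.d i) g)).comp
    ((continuous_apply i).comp continuous_subtype_val)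

instance : MeasurableConstSMul (AffineSL n) (J.limit n) :=
  ⟨fun g => (J.continuous_smul n g).measurable⟩

variable {J n}

theorem apply_eq_of_le {x y : J.limit n} {i j : ℕ} (hji : j ≤ i) (h : x.1 i = y.1 i) :
    x.1 j = y.1 j := by
  induction hji using Nat.decreasingInduction with
  | self => exact h
  | of_succ k _ ih => rw [← x.2 k, ← y.2 k, ih]

theorem measurable_apply (i : ℕ) : Measurable fun x : J.limit n => x.1 i :=
  (measurable_pi_apply i).comp measurable_subtype_coe

theorem measurableSet_cyl (i : ℕ) (c : Fin n → ZMod (J.d i)) :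
    MeasurableSet {x : J.limit n | x.1 i = c} :=
  (measurable_apply i) (measurableSet_singleton c)

/-- The number of points of `(ℤ/d_iℤ)ⁿ`, as a real number. -/
noncomputable def cylCard (J : DivChain) (n i : ℕ) : ℝ := (J.d i : ℝ) ^ n

theorem cylCard_pos (J : DivChain) (n i : ℕ) : 0 < cylCard J n i :=
  pow_pos (Nat.cast_pos.mpr (J.pos i)) n

theorem card_cyl (i : ℕ) : (Fintype.card (Fin n → ZMod (J.d i)) : ℝ) = cylCard J n i := by
  simp [cylCard, ZMod.card]

theorem measureReal_cyl (i : ℕ) (c : Fin n → ZMod (J.d i)) :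
    (J.limitMeasure n).real {x | x.1 i = c} = (cylCard J n i)⁻¹ := by
  rw [measureReal_def, limitMeasure_fiber]
  simp [cylCard]

/-- The cosets form a basis of the topology. -/
theorem mem_nhds_cyl {x : J.limit n} {U : Set (J.limit n)} (hU : IsOpen U) (hx : x ∈ U) :
    ∃ i, ∀ y : J.limit n, y.1 i = x.1 i → y ∈ U := by
  obtain ⟨V, hV, rfl⟩ := isOpen_induced_iff.mp hU
  obtain ⟨I, u, hu, hsub⟩ := isOpen_pi_iff.mp hV x.1 hx
  refine ⟨I.sup id, fun y hy => hsub fun j hj => ?_⟩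
  have hj : j ∈ I := hj
  have h : y.1 j = x.1 j := apply_eq_of_le (Finset.le_sup (f := id) hj) hy
  rw [h]
  exact (hu j hj).2

/-- Measurable sets are approximated by unions of cosets of `d_i · lim←(ℤ/d_iℤ)ⁿ`, for large
`i`. -/
theorem exists_cylinder_approx {E : Set (J.limit n)} (hE : MeasurableSet E) {ε : ℝ} (hε : 0 < ε) :
    ∃ i₀, ∀ i ≥ i₀, ∃ E' : Set (J.limit n), MeasurableSet E' ∧
      (∀ x y : J.limit n, x.1 i = y.1 i → x ∈ E' → y ∈ E') ∧
      (J.limitMeasure n).real (symmDiff E E') ≤ ε := by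
  set μ := J.limitMeasure n
  obtain ⟨U, hEU, hU, hμU⟩ := E.exists_isOpen_lt_add (μ := μ) (measure_ne_top _ _)
    (ε := ENNReal.ofReal (ε / 2)) (by simpa using hε)
  have h1 : μ.real (U \ E) ≤ ε / 2 := by
    rw [measureReal_sdiff hEU hE]
    have := (ENNReal.toReal_mono (by finiteness) hμU.le)
    rw [ENNReal.toReal_add (by finiteness) (by finiteness),
      ENNReal.toReal_ofReal (by positivity)] at this
    simp only [measureReal_def]
    linarith
  -- the union of the cosets of level `i` which are contained in the open set `U`
  let W : ℕ → Set (J.limit n) := fun i => {x | ∀ y : J.limit n, y.1 i = x.1 i → y ∈ U}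
  have hWm : ∀ i, MeasurableSet (W i) := by
    intro i
    have : W i = (fun x : J.limit n => x.1 i) ⁻¹' {c | ∀ y : J.limit n, y.1 i = c → y ∈ U} := rfl
    rw [this]
    exact measurable_apply i (Set.toFinite _).measurableSet
  have hWmono : Monotone W := fun i j hij x hx y hy => hx y (apply_eq_of_le hij hy)
  have hWU : ⋃ i, W i = U := by
    ext x
    simp only [Set.mem_iUnion]
    exact ⟨fun ⟨i, hi⟩ => hi x rfl, fun hx => mem_nhds_cyl hU hx⟩
  have hlim := tendsto_measure_iUnion_atTop (μ := μ) hWmono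
  rw [hWU] at hlim
  have hlim' : Filter.Tendsto (fun i => μ.real (W i)) Filter.atTop (nhds (μ.real U)) :=
    (ENNReal.tendsto_toReal (measure_ne_top _ _)).comp hlim
  obtain ⟨i₀, hi₀⟩ := Filter.eventually_atTop.mp
    (hlim'.eventually (lt_mem_nhds (show μ.real U - ε / 2 < μ.real U by linarith)))
  refine ⟨i₀, fun i hi => ⟨W i, hWm i, fun x y hxy hx z hz => hx z (hz.trans hxy.symm), ?_⟩⟩
  have hWiU : W i ⊆ U := fun x hx => hx x rfl
  have h2 : μ.real (U \ W i) ≤ ε / 2 := by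
    rw [measureReal_sdiff hWiU (hWm i)]
    linarith [hi₀ i hi]
  have h3 : symmDiff E (W i) ⊆ (U \ W i) ∪ (U \ E) := by
    rintro x (⟨h, h'⟩ | ⟨h, h'⟩)
    · exact Or.inl ⟨hEU h, h'⟩
    · exact Or.inr ⟨hWiU h, h'⟩
  exact (measureReal_mono h3).trans ((measureReal_union_le _ _).trans (by linarith))

theorem translElt_smul (v : Fin n → ℤ) (x : J.limit n) : translElt v • x = J.diag n v + x := by
  ext i k
  simp [smul_apply, affineMap, diag, translElt, add_comm]

theorem translElt_smul_apply (v : Fin n → ℤ) (x : J.limit n) (i : ℕ) :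
    (translElt v • x).1 i = (fun k => (v k : ZMod (J.d i))) + x.1 i := by
  rw [translElt_smul]; rfl

/-- `ℤⁿ` acts ergodically on `lim←(ℤ/d_iℤ)ⁿ`. -/
theorem eventuallyConst_of_translElt_invariant {s : Set (J.limit n)} (hs : MeasurableSet s)
    (h : ∀ (v : Fin n → ℤ) (x : J.limit n), translElt v • x ∈ s ↔ x ∈ s) :
    Filter.EventuallyConst s (ae (J.limitMeasure n)) := by
  have : MeasurableAdd₂ (J.limit n) := inferInstance
  have : ErgodicVAdd (J.limit n) (J.limit n) (J.limitMeasure n) := inferInstance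
  refine aeconst_of_dense_setOfPred_preimage_vadd_ae (M := J.limit n) hs.nullMeasurableSet
    ((J.denseRange_diag n).mono ?_)
  rintro _ ⟨v, rfl⟩
  change (fun x : J.limit n => J.diag n v +ᵥ x) ⁻¹' s =ᵐ[J.limitMeasure n] s
  refine Filter.EventuallyEq.of_eq (Set.ext fun x => ?_)
  have := h v x
  rw [translElt_smul] at this
  exact this

/-- The subgroup `d_i ℤⁿ` acts ergodically on each coset of `d_i · lim←(ℤ/d_iℤ)ⁿ`. -/
theorem ae_mem_of_invariant_of_cyl {E : Set (J.limit n)} (hE : MeasurableSet E) {i : ℕ}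
    {c : Fin n → ZMod (J.d i)}
    (hinv : ∀ v : Fin n → ℤ, (∀ k, (v k : ZMod (J.d i)) = 0) →
      ∀ᵐ x ∂J.limitMeasure n, x.1 i = c → translElt v • x ∈ E → x ∈ E)
    (hpos : (J.limitMeasure n) (E ∩ {x | x.1 i = c}) ≠ 0) :
    ∀ᵐ x ∂J.limitMeasure n, x.1 i = c → x ∈ E := by
  -- the `ℤⁿ`-saturation of the part of `E` in the coset; it is conull since `ℤⁿ` acts ergodically
  let s : Set (J.limit n) := ⋃ v : Fin n → ℤ, {x | translElt v • x ∈ E ∩ {x | x.1 i = c}}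
  have hs : MeasurableSet s := MeasurableSet.iUnion fun v =>
    (measurable_const_smul (translElt v)) (hE.inter (measurableSet_cyl i c))
  have hsub : E ∩ {x | x.1 i = c} ⊆ s := fun x hx => by
    refine Set.mem_iUnion.mpr ⟨0, ?_⟩
    change translElt (0 : Fin n → ℤ) • x ∈ E ∩ {x | x.1 i = c}
    rwa [translElt_zero, one_smul]
  have hc := eventuallyConst_of_translElt_invariant hs fun v x => by
    have key : ∀ (v : Fin n → ℤ) (x : J.limit n), translElt v • x ∈ s → x ∈ s := by
      intro v x hx
      obtain ⟨u, hu⟩ := Set.mem_iUnion.mp hx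
      refine Set.mem_iUnion.mpr ⟨u + v, ?_⟩
      change translElt (u + v) • x ∈ E ∩ {x | x.1 i = c}
      rwa [translElt_add, mul_smul]
    refine ⟨key v x, fun hx => key (-v) _ ?_⟩
    rwa [translElt_neg, inv_smul_smul]
  have hall : ∀ᵐ x ∂J.limitMeasure n, x ∈ s := by
    rcases Filter.eventuallyConst_set.mp hc with h | h
    · exact h
    · refine absurd ?_ hpos
      exact measure_mono_null hsub (measure_eq_zero_iff_ae_notMem.mpr h)
  have hinv' : ∀ᵐ x ∂J.limitMeasure n, ∀ v : Fin n → ℤ, (∀ k, (v k : ZMod (J.d i)) = 0) →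
      x.1 i = c → translElt v • x ∈ E → x ∈ E := by
    rw [ae_all_iff]
    intro v
    by_cases hv : ∀ k, (v k : ZMod (J.d i)) = 0
    · filter_upwards [hinv v hv] with x hx _ using hx
    · exact Filter.Eventually.of_forall fun x h => absurd h hv
  filter_upwards [hall, hinv'] with x hx hx' hxc
  -- a translation which maps a point of the coset into the coset belongs to `d_i ℤⁿ`
  obtain ⟨u, hu1, hu2⟩ := Set.mem_iUnion.mp hx
  refine hx' u (fun k => ?_) hxc hu1
  have : (translElt u • x).1 i = c := hu2
  rw [translElt_smul_apply, hxc] at this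
  exact congrFun (add_eq_right.mp this) k

end DivChain

end ProfiniteSpace

/-! ### Functions which are nearly constant on cosets -/

section Discrepancy

namespace DivChain

variable {J : DivChain} {n : ℕ} {Λ : Type*}

theorem affineMap_inv_left (m : ℕ) (g : AffineSL n) (c : Fin n → ZMod m) :
    affineMap n m g⁻¹ (affineMap n m g c) = c := by
  rw [← affineMap_mul, inv_mul_cancel, affineMap_one]

theorem affineMap_injective (m : ℕ) (g : AffineSL n) : Function.Injective (affineMap n m g) :=
  Function.LeftInverse.injective (affineMap_inv_left m g)

theorem affineMap_bijective (m : ℕ) (g : AffineSL n) : Function.Bijective (affineMap n m g) :=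
  ⟨affineMap_injective m g, fun c => ⟨affineMap n m g⁻¹ c, by
    rw [← affineMap_mul, mul_inv_cancel, affineMap_one]⟩⟩

theorem smul_mem_cyl_iff (g : AffineSL n) (x : J.limit n) (i : ℕ) (c : Fin n → ZMod (J.d i)) :
    (g • x).1 i = affineMap n (J.d i) g c ↔ x.1 i = c := by
  rw [smul_apply]
  exact (affineMap_injective _ g).eq_iff

/-- The measure of the set of pairs of points of the coset `c` at which `f` takes different
values. It is small when `f` is nearly constant on the coset. -/
noncomputable def discrepancy (i : ℕ) (f : J.limit n → Λ) (c : Fin n → ZMod (J.d i)) : ℝ :=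
  ((J.limitMeasure n).prod (J.limitMeasure n)).real
    {p | p.1.1 i = c ∧ p.2.1 i = c ∧ f p.1 ≠ f p.2}

theorem discrepancy_nonneg (i : ℕ) (f : J.limit n → Λ) (c : Fin n → ZMod (J.d i)) :
    0 ≤ discrepancy i f c := measureReal_nonneg

theorem discrepancy_le_add {Λ₁ Λ₂ : Type*} {i : ℕ} {f : J.limit n → Λ} {g₁ : J.limit n → Λ₁}
    {g₂ : J.limit n → Λ₂} {c : Fin n → ZMod (J.d i)}
    (h : ∀ x y, x.1 i = c → y.1 i = c → g₁ x = g₁ y → g₂ x = g₂ y → f x = f y) :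
    discrepancy i f c ≤ discrepancy i g₁ c + discrepancy i g₂ c := by
  refine (measureReal_mono ?_).trans (measureReal_union_le _ _)
  rintro ⟨x, y⟩ ⟨h1, h2, h3⟩
  by_cases h4 : g₁ x = g₁ y
  · exact Or.inr ⟨h1, h2, fun h5 => h3 (h x y h1 h2 h4 h5)⟩
  · exact Or.inl ⟨h1, h2, h4⟩

theorem discrepancy_mono {Λ₁ : Type*} {i : ℕ} {f : J.limit n → Λ} {g₁ : J.limit n → Λ₁}
    {c : Fin n → ZMod (J.d i)}
    (h : ∀ x y, x.1 i = c → y.1 i = c → g₁ x = g₁ y → f x = f y) :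
    discrepancy i f c ≤ discrepancy i g₁ c := by
  refine measureReal_mono ?_
  rintro ⟨x, y⟩ ⟨h1, h2, h3⟩
  exact ⟨h1, h2, fun h4 => h3 (h x y h1 h2 h4)⟩

theorem discrepancy_le_of_measureReal_ne {i : ℕ} {f : J.limit n → Λ}
    (c : Fin n → ZMod (J.d i)) (l : Λ) :
    discrepancy i f c ≤
      2 * (J.limitMeasure n).real {x | x.1 i = c ∧ f x ≠ l} / cylCard J n i := by
  set μ := J.limitMeasure n
  have h1 : {p : J.limit n × J.limit n | p.1.1 i = c ∧ p.2.1 i = c ∧ f p.1 ≠ f p.2} ⊆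
      ({x | x.1 i = c ∧ f x ≠ l} ×ˢ {x | x.1 i = c}) ∪
        ({x | x.1 i = c} ×ˢ {x | x.1 i = c ∧ f x ≠ l}) := by
    rintro ⟨x, y⟩ ⟨h1, h2, h3⟩
    by_cases h : f x = l
    · exact Or.inr ⟨h1, h2, fun h' => h3 (h.trans h'.symm)⟩
    · exact Or.inl ⟨⟨h1, h⟩, h2⟩
  refine (measureReal_mono h1).trans ((measureReal_union_le _ _).trans_eq ?_)
  rw [measureReal_prod_prod, measureReal_prod_prod, measureReal_cyl]
  ring

/-- The pairs of points in a common coset, one of which lies in `B`, make up at most the proportion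
`2 μ(B)` of all pairs of points in a common coset. -/
theorem measureReal_prod_same_cyl_le (i : ℕ) {B : Set (J.limit n)} (hB : MeasurableSet B) :
    ((J.limitMeasure n).prod (J.limitMeasure n)).real
      {p | p.1.1 i = p.2.1 i ∧ (p.1 ∈ B ∨ p.2 ∈ B)} ≤
      2 * (J.limitMeasure n).real B / cylCard J n i := by
  set μ := J.limitMeasure n
  have h1 : {p : J.limit n × J.limit n | p.1.1 i = p.2.1 i ∧ (p.1 ∈ B ∨ p.2 ∈ B)} ⊆
      ⋃ c ∈ (Finset.univ : Finset (Fin n → ZMod (J.d i))),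
        (((B ∩ {x | x.1 i = c}) ×ˢ {x | x.1 i = c}) ∪
          ({x | x.1 i = c} ×ˢ (B ∩ {x | x.1 i = c}))) := by
    rintro ⟨x, y⟩ ⟨h1, h2⟩
    refine Set.mem_biUnion (Finset.mem_univ (x.1 i)) ?_
    rcases h2 with h2 | h2
    · exact Or.inl ⟨⟨h2, rfl⟩, h1.symm⟩
    · exact Or.inr ⟨rfl, ⟨h2, h1.symm⟩⟩
  refine (measureReal_mono h1 (measure_ne_top _ _)).trans
    ((measureReal_biUnion_finset_le _ _).trans ?_)
  have h2 : ∀ c : Fin n → ZMod (J.d i), (μ.prod μ).real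
      (((B ∩ {x | x.1 i = c}) ×ˢ {x | x.1 i = c}) ∪
          ({x | x.1 i = c} ×ˢ (B ∩ {x | x.1 i = c}))) ≤
      2 * μ.real (B ∩ {x | x.1 i = c}) / cylCard J n i := by
    intro c
    refine (measureReal_union_le _ _).trans_eq ?_
    rw [measureReal_prod_prod, measureReal_prod_prod, measureReal_cyl]
    ring
  refine (Finset.sum_le_sum fun c _ => h2 c).trans_eq ?_
  rw [← Finset.sum_div, ← Finset.mul_sum]
  congr 2
  rw [← measureReal_biUnion_finset]
  · congr 1
    ext x
    simp
  · intro a _ b _ hab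
    refine Set.disjoint_left.mpr ?_
    rintro p ⟨_, h1⟩ ⟨_, h2⟩
    exact hab (h1.symm.trans h2)
  · exact fun c _ => hB.inter (measurableSet_cyl i c)

section Measurable

variable [MeasurableSpace Λ] [DiscreteMeasurableSpace Λ] [Countable Λ]

theorem measurableSet_discrepancy {i : ℕ} {f : J.limit n → Λ} (hf : Measurable f)
    (c : Fin n → ZMod (J.d i)) :
    MeasurableSet {p : J.limit n × J.limit n | p.1.1 i = c ∧ p.2.1 i = c ∧ f p.1 ≠ f p.2} :=
  (measurable_fst (measurableSet_cyl i c)).inter ((measurable_snd (measurableSet_cyl i c)).inter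
    (measurableSet_eq_fun (hf.comp measurable_fst) (hf.comp measurable_snd)).compl)

theorem discrepancy_comp_smul {i : ℕ} {f : J.limit n → Λ} (hf : Measurable f) (g : AffineSL n)
    (c : Fin n → ZMod (J.d i)) :
    discrepancy i (fun x => f (g • x)) c = discrepancy i f (affineMap n (J.d i) g c) := by
  have hmp := measurePreserving_smul g (J.limitMeasure n)
  have := (hmp.prod hmp).measureReal_preimage
    (measurableSet_discrepancy hf (affineMap n (J.d i) g c)).nullMeasurableSet
  rw [discrepancy, discrepancy, ← this]
  congr 1
  ext p
  simp only [Set.mem_preimage, Set.mem_ofPred_eq, Prod.map_fst, Prod.map_snd, smul_mem_cyl_iff]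

theorem sum_discrepancy {i : ℕ} {f : J.limit n → Λ} (hf : Measurable f) :
    ∑ c, discrepancy i f c = ((J.limitMeasure n).prod (J.limitMeasure n)).real
      {p | p.1.1 i = p.2.1 i ∧ f p.1 ≠ f p.2} := by
  unfold discrepancy
  rw [← measureReal_biUnion_finset]
  · congr 1
    ext p
    simp only [Finset.mem_univ, Set.iUnion_true, Set.mem_iUnion, Set.mem_ofPred_eq]
    constructor
    · rintro ⟨c, h1, h2, h3⟩
      exact ⟨h1.trans h2.symm, h3⟩
    · rintro ⟨h1, h2⟩
      exact ⟨_, rfl, h1.symm, h2⟩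
  · intro a _ b _ hab
    refine Set.disjoint_left.mpr ?_
    rintro p ⟨h1, _⟩ ⟨h2, _⟩
    exact hab (h1.symm.trans h2)
  · exact fun c _ => measurableSet_discrepancy hf c

/-- On a coset on which it has small discrepancy, a function takes a single value most of the time.
The value is that at a point `y` for which the section over `y` of the set of pairs defining the
discrepancy has at most average measure. -/
theorem exists_measureReal_ne_le {i : ℕ} {f : J.limit n → Λ} (hf : Measurable f)
    (c : Fin n → ZMod (J.d i)) :
    ∃ l, (J.limitMeasure n).real {x | x.1 i = c ∧ f x ≠ l} ≤ cylCard J n i * discrepancy i f c := by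
  set μ := J.limitMeasure n
  have hm := measurableSet_discrepancy hf c
  have hc0 : μ {x | x.1 i = c} ≠ 0 := by
    rw [limitMeasure_fiber]
    exact ENNReal.inv_ne_zero.mpr (by finiteness)
  obtain ⟨y, hy, hle⟩ := exists_le_setLAverage (μ := μ) (s := {x | x.1 i = c})
    (f := fun y => μ (Prod.mk y ⁻¹' {p | p.1.1 i = c ∧ p.2.1 i = c ∧ f p.1 ≠ f p.2}))
    hc0 (measure_ne_top _ _) (measurable_measure_prodMk_left hm).aemeasurable
  refine ⟨f y, ?_⟩
  have h1 : μ {x | x.1 i = c ∧ f x ≠ f y} =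
      μ (Prod.mk y ⁻¹' {p | p.1.1 i = c ∧ p.2.1 i = c ∧ f p.1 ≠ f p.2}) := by
    congr 1
    ext x
    simp only [Set.mem_preimage, Set.mem_ofPred_eq]
    exact ⟨fun h => ⟨hy, h.1, h.2.symm⟩, fun h => ⟨h.2.1, h.2.2.symm⟩⟩
  have h2 : μ {x | x.1 i = c ∧ f x ≠ f y} ≤
      (μ {x | x.1 i = c})⁻¹ * (μ.prod μ) {p | p.1.1 i = c ∧ p.2.1 i = c ∧ f p.1 ≠ f p.2} := by
    rw [h1]
    refine hle.trans ?_
    rw [setLAverage_eq, ENNReal.div_eq_inv_mul]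
    gcongr
    rw [Measure.prod_apply hm]
    exact setLIntegral_le_lintegral _ _
  have h3 := ENNReal.toReal_mono (ENNReal.mul_ne_top (ENNReal.inv_ne_top.mpr hc0)
    (measure_ne_top _ _)) h2
  rw [ENNReal.toReal_mul, ENNReal.toReal_inv] at h3
  change μ.real _ ≤ (μ.real _)⁻¹ * _ at h3
  rwa [measureReal_cyl, inv_inv] at h3

/-- A measurable function with countably many values is nearly constant on most cosets of
`d_i · lim←(ℤ/d_iℤ)ⁿ`, for large `i`. -/
theorem exists_sum_discrepancy_le {f : J.limit n → Λ} (hf : Measurable f) {ε : ℝ} (hε : 0 < ε) :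
    ∃ i₀, ∀ i ≥ i₀, ∑ c, discrepancy i f c ≤ ε / cylCard J n i := by
  set μ := J.limitMeasure n
  have := Encodable.ofCountable Λ
  -- outside a set of small measure `f` takes values in a finite set `F`, and the finitely many
  -- level sets are nearly unions of cosets
  let A : ℕ → Set (J.limit n) := fun k => {x | Encodable.encode (f x) ≤ k}
  have hAm : ∀ k, MeasurableSet (A k) := fun k =>
    hf (MeasurableSet.of_discrete (s := {l : Λ | Encodable.encode l ≤ k}))
  have hlim := tendsto_measure_iUnion_atTop (μ := μ) (s := A)
    (fun a b hab x hx => le_trans hx hab)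
  have hU : ⋃ k, A k = Set.univ := Set.eq_univ_of_forall fun x =>
    Set.mem_iUnion.mpr ⟨Encodable.encode (f x), le_refl (Encodable.encode (f x))⟩
  rw [hU] at hlim
  have hlim' : Filter.Tendsto (fun i => μ.real (A i)) Filter.atTop (nhds (μ.real Set.univ)) :=
    (ENNReal.tendsto_toReal (measure_ne_top _ _)).comp hlim
  rw [probReal_univ] at hlim'
  obtain ⟨k, hk⟩ := (hlim'.eventually (lt_mem_nhds (show 1 - ε / 4 < 1 by linarith))).exists
  have hfin : {l : Λ | Encodable.encode l ≤ k}.Finite :=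
    (Set.finite_Iic k).preimage Encodable.encode_injective.injOn
  let F : Finset Λ := hfin.toFinset
  have hε' : 0 < ε / (4 * (F.card + 1)) := by positivity
  have happ : ∀ l : Λ, ∃ i₀, ∀ i ≥ i₀, ∃ E' : Set (J.limit n), MeasurableSet E' ∧
      (∀ x y : J.limit n, x.1 i = y.1 i → x ∈ E' → y ∈ E') ∧
      μ.real (symmDiff (f ⁻¹' {l}) E') ≤ ε / (4 * (F.card + 1)) := fun l =>
    exists_cylinder_approx (hf (MeasurableSet.of_discrete)) hε'
  choose i₀ hi₀ using happ
  refine ⟨F.sup i₀, fun i hi => ?_⟩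
  have hi' : ∀ l ∈ F, i₀ l ≤ i := fun l hl => (Finset.le_sup hl).trans hi
  choose! E' hE'm hE'c hE'μ using fun l (hl : l ∈ F) => hi₀ l i (hi' l hl)
  let B : Set (J.limit n) := (A k)ᶜ ∪ ⋃ l ∈ F, symmDiff (f ⁻¹' {l}) (E' l)
  have hBm : MeasurableSet B := (hAm k).compl.union
    (Finset.measurableSet_biUnion F fun l hl =>
      (hf (MeasurableSet.of_discrete)).symmDiff (hE'm l hl))
  have hBμ : μ.real B ≤ ε / 2 := by
    refine (measureReal_union_le _ _).trans ?_
    have h1 : μ.real (A k)ᶜ ≤ ε / 4 := by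
      rw [probReal_compl_eq_one_sub (hAm k)]
      linarith
    have h2 : μ.real (⋃ l ∈ F, symmDiff (f ⁻¹' {l}) (E' l)) ≤ ε / 4 := by
      refine (measureReal_biUnion_finset_le _ _).trans
        ((Finset.sum_le_sum fun l hl => hE'μ l hl).trans ?_)
      rw [Finset.sum_const, nsmul_eq_mul]
      rw [← mul_div_assoc, div_le_div_iff₀ (by positivity) (by norm_num)]
      nlinarith
    linarith
  rw [sum_discrepancy hf]
  have hsub : {p : J.limit n × J.limit n | p.1.1 i = p.2.1 i ∧ f p.1 ≠ f p.2} ⊆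
      {p | p.1.1 i = p.2.1 i ∧ (p.1 ∈ B ∨ p.2 ∈ B)} := by
    rintro ⟨x, y⟩ ⟨h1, h2⟩
    refine ⟨h1, ?_⟩
    by_contra hcon
    rw [not_or] at hcon
    obtain ⟨hx, hy⟩ := hcon
    have hxA : x ∈ A k := by
      by_contra h
      exact hx (Or.inl h)
    have hlF : f x ∈ F := hfin.mem_toFinset.mpr hxA
    have hxE : x ∈ E' (f x) := by
      by_contra h
      exact hx (Or.inr (Set.mem_biUnion hlF (Or.inl ⟨rfl, h⟩)))
    have hyE : y ∈ E' (f x) := hE'c _ hlF x y h1 hxE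
    have : y ∈ f ⁻¹' {f x} := by
      by_contra h
      exact hy (Or.inr (Set.mem_biUnion hlF (Or.inr ⟨hyE, h⟩)))
    exact h2 (Eq.symm this)
  refine (measureReal_mono hsub).trans ((measureReal_prod_same_cyl_le i hBm).trans ?_)
  have := cylCard_pos J n i
  gcongr
  linarith

end Measurable

end DivChain

end Discrepancy

/-! ### Cocycles of the profinite action -/

section Cocycles

namespace DivChain

variable {J : DivChain} {n : ℕ} {Λ : Type*} [Group Λ] [MeasurableSpace Λ]

/-- `w` is a measurable cocycle of the action of `SL_n(ℤ) ⋉ ℤⁿ` with values in the discrete group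
`Λ`. -/
structure IsCocycle (w : AffineSL n → J.limit n → Λ) : Prop where
  measurable : ∀ g, Measurable (w g)
  mul : ∀ g h x, w (g * h) x = w g (h • x) * w h x

theorem IsCocycle.one {w : AffineSL n → J.limit n → Λ} (hw : IsCocycle w) (x : J.limit n) :
    w 1 x = 1 := by
  have := hw.mul 1 1 x
  rw [one_mul, one_smul] at this
  exact (left_eq_mul.mp this)

theorem IsCocycle.inv {w : AffineSL n → J.limit n → Λ} (hw : IsCocycle w) (g : AffineSL n)
    (x : J.limit n) : w g⁻¹ (g • x) = (w g x)⁻¹ := by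
  rw [eq_inv_iff_mul_eq_one, ← hw.mul, inv_mul_cancel, hw.one]

end DivChain

variable {Λ : Type*} [Group Λ] [MeasurableSpace Λ] [DiscreteMeasurableSpace Λ] [Countable Λ]

/-- A skew product by two sided multiplication on a discrete group preserves the product with the
counting measure. -/
theorem measurePreserving_skew {X : Type*} [MeasurableSpace X] {μ : Measure X} [SFinite μ]
    {f : X → X} (hf : MeasurePreserving f μ μ) {a b : X → Λ} (ha : Measurable a)
    (hb : Measurable b) :
    MeasurePreserving (fun p : X × Λ => (f p.1, a p.1 * p.2 * (b p.1)⁻¹))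
      (μ.prod Measure.count) (μ.prod Measure.count) := by
  refine hf.skew_product (g := fun x l => a x * l * (b x)⁻¹) ?_ ?_
  · exact (Measurable.of_discrete (f := fun q : (Λ × Λ) × Λ => q.1.1 * q.2 * q.1.2⁻¹)).comp
      (((ha.comp measurable_fst).prodMk (hb.comp measurable_fst)).prodMk measurable_snd)
  · refine Filter.Eventually.of_forall fun x => ?_
    let e : Λ ≃ Λ := (Equiv.mulLeft (a x)).trans (Equiv.mulRight (b x)⁻¹)
    ext s hs
    rw [Measure.map_apply Measurable.of_discrete hs]
    have : (fun l => a x * l * (b x)⁻¹) ⁻¹' s = e.symm '' s := (e.image_symm_eq_preimage s).symm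
    rw [this, Measure.count_injective_image e.symm.injective]

/-- For an invariant set `D`, the skew product with `a` and `b` moves `D × {1}` off itself over the
points of `D` where `a` and `b` differ. -/
theorem measureReal_symmDiff_skew {X : Type*} [MeasurableSpace X] {μ : Measure X}
    [IsFiniteMeasure μ] {f : X → X} (hf : MeasurePreserving f μ μ) {a b : X → Λ}
    (ha : Measurable a) (hb : Measurable b) {D : Set X} (hD : MeasurableSet D)
    (hfD : ∀ x, f x ∈ D ↔ x ∈ D) :
    (μ.prod Measure.count).real (symmDiff
      ((fun p : X × Λ => (f p.1, a p.1 * p.2 * (b p.1)⁻¹)) ⁻¹' (D ×ˢ {1})) (D ×ˢ {1})) =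
      2 * μ.real {x | x ∈ D ∧ a x ≠ b x} := by
  set T := fun p : X × Λ => (f p.1, a p.1 * p.2 * (b p.1)⁻¹)
  set m := μ.prod (Measure.count : Measure Λ)
  have hmp : MeasurePreserving T m m := measurePreserving_skew hf ha hb
  have hE : MeasurableSet (D ×ˢ ({1} : Set Λ)) := hD.prod (measurableSet_singleton 1)
  have hfin : m (D ×ˢ ({1} : Set Λ)) ≠ ⊤ := by
    rw [Measure.prod_prod, Measure.count_singleton, mul_one]
    exact measure_ne_top _ _
  have hpre : m.real (T ⁻¹' (D ×ˢ {1})) = m.real (D ×ˢ {1}) :=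
    hmp.measureReal_preimage hE.nullMeasurableSet
  have hfin' : m (T ⁻¹' (D ×ˢ {1})) ≠ ⊤ := by
    rwa [hmp.measure_preimage hE.nullMeasurableSet]
  have h1 := measureReal_inter_add_sdiff (μ := m) (s := T ⁻¹' (D ×ˢ {1})) (t := D ×ˢ {1}) hE hfin'
  have h2 := measureReal_inter_add_sdiff (μ := m) (s := D ×ˢ {1}) (t := T ⁻¹' (D ×ˢ {1}))
    (hmp.measurable hE) hfin
  rw [Set.inter_comm] at h2
  have h3 : (D ×ˢ {1}) \ T ⁻¹' (D ×ˢ {1}) = {x | x ∈ D ∧ a x ≠ b x} ×ˢ ({1} : Set Λ) := by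
    ext ⟨x, l⟩
    simp only [Set.mem_sdiff, Set.mem_prod, Set.mem_singleton_iff, Set.mem_preimage, T, hfD,
      Set.mem_ofPred_eq, not_and, ne_eq]
    constructor
    · rintro ⟨⟨hx, rfl⟩, h⟩
      refine ⟨⟨hx, fun e => h hx ?_⟩, rfl⟩
      rw [e, mul_one, mul_inv_cancel]
    · rintro ⟨⟨hx, h⟩, rfl⟩
      refine ⟨⟨hx, rfl⟩, fun _ e => h ?_⟩
      rwa [mul_one, mul_inv_eq_one] at e
  have h4 : m.real ((D ×ˢ {1}) \ T ⁻¹' (D ×ˢ {1})) = μ.real {x | x ∈ D ∧ a x ≠ b x} := by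
    rw [h3, measureReal_prod_prod, count_real_singleton, mul_one]
  rw [Set.symmDiff_def, measureReal_union (Set.disjoint_left.mpr fun p hp hq => hp.2 hq.1)
    (hE.diff (hmp.measurable hE)) (measure_ne_top_of_subset Set.sdiff_subset hfin')
    (measure_ne_top_of_subset Set.sdiff_subset hfin)]
  linarith

namespace DivChain

variable {J : DivChain} {n : ℕ}

/-- The pairs of points in a common coset have the measure of a single coset. -/
theorem measureReal_same_cyl (i : ℕ) :
    ((J.limitMeasure n).prod (J.limitMeasure n)).real
      {p : J.limit n × J.limit n | p.1.1 i = p.2.1 i} = (cylCard J n i)⁻¹ := by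
  have h : {p : J.limit n × J.limit n | p.1.1 i = p.2.1 i} =
      ⋃ c ∈ (Finset.univ : Finset (Fin n → ZMod (J.d i))),
        ({x : J.limit n | x.1 i = c} ×ˢ {x : J.limit n | x.1 i = c}) := by
    ext p
    simp [eq_comm]
  rw [h, measureReal_biUnion_finset]
  · simp only [measureReal_prod_prod, measureReal_cyl, Finset.sum_const, nsmul_eq_mul,
      Finset.card_univ, card_cyl]
    have := (cylCard_pos J n i).ne'
    field_simp
  · intro a _ b _ hab
    refine Set.disjoint_left.mpr ?_
    rintro p ⟨h1, _⟩ ⟨h2, _⟩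
    exact hab (h1.symm.trans h2)
  · exact fun c _ => (measurableSet_cyl i c).prod (measurableSet_cyl i c)

/-- By the relative property (T), applied to the action `g (x, y, l) = (g x, g y, w(g, x) l
w(g, y)⁻¹)` and the set of triples `(x, y, 1)` with `x` and `y` in the same coset, a cocycle is
nearly constant on most cosets, uniformly over `ℤⁿ`. -/
theorem IsCocycle.exists_sum_discrepancy_le (hn : 2 ≤ n) {w : AffineSL n → J.limit n → Λ}
    (hw : IsCocycle w) {δ : ℝ} (hδ : 0 < δ) :
    ∃ i, (∀ v, ∑ c, discrepancy i (w (translElt v)) c ≤ δ / cylCard J n i) ∧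
      ∀ (k l : Fin n) (h : k ≠ l), ∑ c, discrepancy i
        (w (linElt (Matrix.SpecialLinearGroup.transvection h 1))) c ≤ δ / cylCard J n i := by
  set ε : ℝ := min 1 (δ / (104 * n ^ 2)) with hεdef
  have hn0 : (0 : ℝ) < n := by exact_mod_cast (by omega : 0 < n)
  have hε0 : 0 < ε := by positivity
  have hε1 : ε ≤ 1 := min_le_left _ _
  have hεδ : n ^ 2 * (104 * ε) ≤ δ := by
    have := min_le_right 1 (δ / (104 * n ^ 2))
    rw [← hεdef, le_div_iff₀ (by positivity)] at this
    linarith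
  set κ : ℝ := min δ (ε ^ 2 / 2)
  have hκ : 0 < κ := by positivity
  have ev1 : ∀ᶠ i in Filter.atTop, ∀ (k l : Fin n) (h : k ≠ l), ∑ c, discrepancy i
        (w (linElt (Matrix.SpecialLinearGroup.transvection h 1))) c ≤ κ / cylCard J n i := by
    simp only [Filter.eventually_all]
    intro k l h
    exact Filter.eventually_atTop.mpr (DivChain.exists_sum_discrepancy_le (hw.measurable _) hκ)
  have ev2 : ∀ᶠ i in Filter.atTop, ∀ (k : Fin n), ∑ c, discrepancy i
        (w (translElt (Pi.single k 1))) c ≤ κ / cylCard J n i := by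
    simp only [Filter.eventually_all]
    intro k
    exact Filter.eventually_atTop.mpr (DivChain.exists_sum_discrepancy_le (hw.measurable _) hκ)
  obtain ⟨i, hi1, hi2⟩ := (ev1.and ev2).exists
  have hN := cylCard_pos J n i
  refine ⟨i, ?_, fun k l h => (hi1 k l h).trans (by gcongr; exact min_le_left _ _)⟩
  let μ := J.limitMeasure n
  -- the action on triples `(x, y, l)`, and the set `D` of pairs `(x, y)` in a common coset
  let T : AffineSL n → (J.limit n × J.limit n) × Λ → (J.limit n × J.limit n) × Λ := fun g p =>
    (Prod.map (fun x => g • x) (fun x => g • x) p.1, w g p.1.1 * p.2 * (w g p.1.2)⁻¹)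
  have hmp : ∀ g : AffineSL n, MeasurePreserving (Prod.map (fun x : J.limit n => g • x)
      (fun x : J.limit n => g • x)) (μ.prod μ) (μ.prod μ) := fun g =>
    (measurePreserving_smul g μ).prod (measurePreserving_smul g μ)
  have hT : IsMeasurePreservingAction ((μ.prod μ).prod Measure.count) T :=
    { one := fun p => by simp [T, hw.one]
      mul := fun g h p => by simp [T, hw.mul, mul_smul, mul_assoc]; rfl
      mp := fun g => measurePreserving_skew (hmp g) ((hw.measurable g).comp measurable_fst)
        ((hw.measurable g).comp measurable_snd) }
  let D : Set (J.limit n × J.limit n) := {p | p.1.1 i = p.2.1 i}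
  have hD : MeasurableSet D := measurableSet_eq_fun
    ((measurable_apply i).comp measurable_fst) ((measurable_apply i).comp measurable_snd)
  have hsymm : ∀ g, ((μ.prod μ).prod Measure.count).real
      (symmDiff (T g ⁻¹' (D ×ˢ {1})) (D ×ˢ {1})) = 2 * ∑ c, discrepancy i (w g) c := by
    intro g
    rw [sum_discrepancy (hw.measurable g)]
    refine measureReal_symmDiff_skew (hmp g) ((hw.measurable g).comp measurable_fst)
        ((hw.measurable g).comp measurable_snd) hD fun p => ?_
    change (g • p.1).1 i = (g • p.2).1 i ↔ p.1.1 i = p.2.1 i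
    rw [smul_apply, smul_apply, (affineMap_injective _ g).eq_iff]
  have hmE : ((μ.prod μ).prod (Measure.count : Measure Λ)).real (D ×ˢ {1}) =
      (cylCard J n i)⁻¹ := by
    rw [measureReal_prod_prod, count_real_singleton, mul_one]
    exact measureReal_same_cyl i
  have hE : MeasurableSet (D ×ˢ ({1} : Set Λ)) := hD.prod (measurableSet_singleton 1)
  have hfin : ((μ.prod μ).prod (Measure.count : Measure Λ)) (D ×ˢ {1}) ≠ ⊤ := by
    rw [Measure.prod_prod, Measure.count_singleton, mul_one]
    exact measure_ne_top _ _
  have small : ∀ g, ∑ c, discrepancy i (w g) c ≤ κ / cylCard J n i →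
      ((μ.prod μ).prod Measure.count).real (symmDiff (T g ⁻¹' (D ×ˢ {1})) (D ×ˢ {1})) ≤
        ε ^ 2 * ((μ.prod μ).prod (Measure.count : Measure Λ)).real (D ×ˢ {1}) := by
    intro g hg
    rw [hsymm, hmE]
    have h1 : κ / cylCard J n i ≤ ε ^ 2 / 2 / cylCard J n i := by
      gcongr; exact min_le_right _ _
    have h2 : ε ^ 2 * (cylCard J n i)⁻¹ = 2 * (ε ^ 2 / 2 / cylCard J n i) := by
      field_simp
    linarith
  intro v
  have := measureReal_symmDiff_translElt_le hn hT hE hfin hε0.le hε1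
    (fun k l h => small _ (hi1 k l h)) (fun k => small _ (hi2 k)) v
  rw [hsymm, hmE, ← div_eq_mul_inv] at this
  have h1 : n ^ 2 * (104 * ε) / cylCard J n i ≤ δ / cylCard J n i := by gcongr
  have h2 : 0 ≤ ∑ c, discrepancy i (w (translElt v)) c :=
    Finset.sum_nonneg fun c _ => discrepancy_nonneg _ _ _
  linarith

end DivChain

end Cocycles

/-! ### Trivialization of cocycles on a single coset -/

section TranslationTrivialization

namespace DivChain

/-- The projection of a set to the first factor has at most the measure of the set, if the second
factor carries the counting measure. -/
theorem measureReal_exists_le {X Λ : Type*} [MeasurableSpace X]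
    [MeasurableSpace Λ] [DiscreteMeasurableSpace Λ] [Countable Λ] (μ : Measure X)
    [IsFiniteMeasure μ]
    {W : Set (X × Λ)} (hW : MeasurableSet W) (hfin : (μ.prod Measure.count) W ≠ ⊤) :
    μ.real {x | ∃ l, (x, l) ∈ W} ≤ (μ.prod Measure.count).real W := by
  refine ENNReal.toReal_mono hfin ?_
  have hm : MeasurableSet {x | ∃ l, (x, l) ∈ W} := by
    have : {x | ∃ l, (x, l) ∈ W} = ⋃ l, (fun x => (x, l)) ⁻¹' W := by ext x; simp
    rw [this]
    exact MeasurableSet.iUnion fun l => measurable_prodMk_right hW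
  rw [Measure.prod_apply hW, ← lintegral_indicator_one hm]
  refine lintegral_mono fun x => ?_
  by_cases hx : x ∈ {x | ∃ l, (x, l) ∈ W}
  · rw [Set.indicator_of_mem hx]
    obtain ⟨l, hl⟩ := hx
    have : Measure.count ({l} : Set Λ) ≤ Measure.count (Prod.mk x ⁻¹' W) :=
      measure_mono (by simpa using hl)
    rwa [Measure.count_singleton] at this
  · rw [Set.indicator_of_notMem hx]
    exact bot_le

variable {J : DivChain} {n : ℕ} {Λ : Type*} [Group Λ] [MeasurableSpace Λ]
  [DiscreteMeasurableSpace Λ] [Countable Λ]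

theorem affineMap_translElt (m : ℕ) (v : Fin n → ℤ) (c : Fin n → ZMod m) :
    affineMap n m (translElt v) c = (fun k => (v k : ZMod m)) + c := by
  ext k
  simp [affineMap, translElt, add_comm]

theorem affineMap_translElt_of_eq_zero {m : ℕ} {v : Fin n → ℤ} (hv : ∀ k, (v k : ZMod m) = 0)
    (c : Fin n → ZMod m) : affineMap n m (translElt v) c = c := by
  rw [affineMap_translElt]
  ext k
  simp [hv]

theorem measureReal_cyl_smul {i : ℕ} (g : AffineSL n) (c : Fin n → ZMod (J.d i))
    {P : J.limit n → Prop} (hP : MeasurableSet {x | P x}) :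
    (J.limitMeasure n).real {x | x.1 i = c ∧ P (g • x)} =
      (J.limitMeasure n).real {x | x.1 i = affineMap n (J.d i) g c ∧ P x} := by
  have hm : MeasurableSet {x : J.limit n | x.1 i = affineMap n (J.d i) g c ∧ P x} :=
    (measurableSet_cyl i _).inter hP
  rw [← (measurePreserving_smul g (J.limitMeasure n)).measureReal_preimage hm.nullMeasurableSet]
  congr 1
  ext x
  simp only [Set.mem_preimage, Set.mem_ofPred_eq, smul_mem_cyl_iff]

theorem IsCocycle.discrepancy_mul_le {w : AffineSL n → J.limit n → Λ} (hw : IsCocycle w)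
    {i : ℕ} (g h : AffineSL n) (c : Fin n → ZMod (J.d i)) :
    discrepancy i (w (g * h)) c ≤
      discrepancy i (w g) (affineMap n (J.d i) h c) + discrepancy i (w h) c := by
  rw [← discrepancy_comp_smul (hw.measurable g)]
  refine discrepancy_le_add fun x y _ _ h1 h2 => ?_
  rw [hw.mul, hw.mul, h1, h2]

theorem IsCocycle.discrepancy_inv_le {w : AffineSL n → J.limit n → Λ} (hw : IsCocycle w)
    {i : ℕ} (g : AffineSL n) (c : Fin n → ZMod (J.d i)) :
    discrepancy i (w g⁻¹) (affineMap n (J.d i) g c) ≤ discrepancy i (w g) c := by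
  rw [← discrepancy_comp_smul (hw.measurable g⁻¹)]
  refine discrepancy_mono fun x y _ _ h1 => ?_
  rw [hw.inv, hw.inv, h1]

/-- If a cocycle is nearly constant on most cosets, uniformly over `ℤⁿ`, then there is a single
coset on which it is nearly constant, uniformly over the elements of `ℤⁿ` preserving the coset. -/
theorem IsCocycle.exists_good_cyl {w : AffineSL n → J.limit n → Λ} (hw : IsCocycle w)
    {i : ℕ} {δ : ℝ}
    (h : ∀ v, ∑ c, discrepancy i (w (translElt v)) c ≤ δ / cylCard J n i)
    {u : (Fin n → ZMod (J.d i)) → Fin n → ℤ} (hu : ∀ c k, ((u c k : ℤ) : ZMod (J.d i)) = c k) :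
    ∃ c₀, ∑ c, discrepancy i (w (translElt (u c))) c₀ ≤ δ / cylCard J n i ∧
      ∀ v : Fin n → ℤ, (∀ k, (v k : ZMod (J.d i)) = 0) →
        discrepancy i (w (translElt v)) c₀ ≤ 3 * δ / cylCard J n i ^ 2 := by
  have hN := cylCard_pos J n i
  have hsum : ∑ c₀, ∑ c, discrepancy i (w (translElt (u c))) c₀ ≤
      ∑ _c₀ : Fin n → ZMod (J.d i), δ / cylCard J n i := by
    rw [Finset.sum_comm]
    exact Finset.sum_le_sum fun c _ => h (u c)
  obtain ⟨c₀, -, hc₀⟩ := Finset.exists_le_of_sum_le Finset.univ_nonempty hsum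
  refine ⟨c₀, hc₀, fun v hv => ?_⟩
  -- Conjugation by the translation `u c`, which commutes with `v`, compares the discrepancies of
  -- `w(v, ·)` on the cosets `c₀` and `c + c₀`; then average over `c`.
  have huc : ∀ c, affineMap n (J.d i) (translElt (u c)) c₀ = c + c₀ := by
    intro c
    rw [affineMap_translElt]
    congr 1
    ext k
    exact hu c k
  have h1 : ∀ c, discrepancy i (w (translElt v)) c₀ ≤
      2 * discrepancy i (w (translElt (u c))) c₀ + discrepancy i (w (translElt v)) (c + c₀) := by
    intro c
    have e : translElt v = (translElt (u c))⁻¹ * (translElt v * translElt (u c)) := by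
      rw [← translElt_add, add_comm v, translElt_add, inv_mul_cancel_left]
    have a1 := hw.discrepancy_mul_le (i := i) (translElt (u c))⁻¹ (translElt v * translElt (u c)) c₀
    have a2 := hw.discrepancy_mul_le (i := i) (translElt v) (translElt (u c)) c₀
    have a3 := hw.discrepancy_inv_le (i := i) (translElt (u c)) c₀
    rw [← e, affineMap_mul, huc, affineMap_translElt_of_eq_zero hv] at a1
    rw [huc] at a2 a3
    linarith
  have h2 := Finset.sum_le_sum fun c (_ : c ∈ Finset.univ) => h1 c
  rw [Finset.sum_add_distrib, ← Finset.mul_sum, Finset.sum_const, nsmul_eq_mul, Finset.card_univ,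
    card_cyl] at h2
  have h3 : ∑ c, discrepancy i (w (translElt v)) (c + c₀) =
      ∑ c, discrepancy i (w (translElt v)) c :=
    Equiv.sum_comp (Equiv.addRight c₀) (fun c => discrepancy i (w (translElt v)) c)
  rw [h3] at h2
  have h4 := h v
  rw [le_div_iff₀ (by positivity)]
  rw [le_div_iff₀ hN] at hc₀ h4
  nlinarith

/-- A cocycle which, uniformly over `d_i ℤⁿ`, is nearly constant on a coset, is cohomologous to
a homomorphism of `d_i ℤⁿ` there, by a transfer map which is mostly trivial. The homomorphism is
given by the most frequent values, and the transfer map by an invariant set in the skew product. -/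
theorem IsCocycle.exists_trivialization {w : AffineSL n → J.limit n → Λ} (hw : IsCocycle w)
    {i : ℕ} {c₀ : Fin n → ZMod (J.d i)} {κ : ℝ} (hκ : 8 * κ < 1)
    (h : ∀ v : Fin n → ℤ, (∀ k, (v k : ZMod (J.d i)) = 0) →
        discrepancy i (w (translElt v)) c₀ ≤ κ / cylCard J n i ^ 2) :
    ∃ (ρ : (Fin n → ℤ) → Λ) (φ : J.limit n → Λ), Measurable φ ∧
      (∀ a : Fin n → ℤ, ∀ᵐ x ∂J.limitMeasure n, x.1 i = c₀ →
        w (translElt ((J.d i : ℤ) • a)) x =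
          φ (translElt ((J.d i : ℤ) • a) • x) * ρ a * (φ x)⁻¹) ∧
      (J.limitMeasure n).real {x | x.1 i = c₀ ∧ φ x ≠ 1} ≤ 8 * κ / cylCard J n i := by
  classical
  set μ := J.limitMeasure n with hμ
  have hN := cylCard_pos J n i
  let τ : (Fin n → ℤ) → AffineSL n := fun a => translElt ((J.d i : ℤ) • a)
  have hτadd : ∀ a b, τ (a + b) = τ a * τ b := fun a b => by
    simp only [τ, smul_add, translElt_add]
  have hτ0 : ∀ (a : Fin n → ℤ) k, ((((J.d i : ℤ) • a) k : ℤ) : ZMod (J.d i)) = 0 := by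
    intro a k; simp
  have hτc : ∀ a, affineMap n (J.d i) (τ a) c₀ = c₀ := fun a =>
    affineMap_translElt_of_eq_zero (hτ0 a) c₀
  -- the most frequent values
  have hρ : ∀ a, ∃ l, μ.real {x | x.1 i = c₀ ∧ w (τ a) x ≠ l} ≤ κ / cylCard J n i := by
    intro a
    obtain ⟨l, hl⟩ := exists_measureReal_ne_le (hw.measurable (τ a)) c₀
    refine ⟨l, hl.trans ?_⟩
    have := h _ (hτ0 a)
    calc cylCard J n i * discrepancy i (w (τ a)) c₀
        ≤ cylCard J n i * (κ / cylCard J n i ^ 2) := by gcongr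
      _ = κ / cylCard J n i := by field_simp
  choose ρ hρ using hρ
  have hbad : ∀ (a : Fin n → ℤ) (l : Λ), MeasurableSet {x : J.limit n | w (τ a) x ≠ l} :=
    fun a l => ((hw.measurable (τ a)) (measurableSet_singleton l)).compl
  -- the three exceptional sets in the cocycle identity do not fill the coset
  have hρadd : ∀ a b, ρ (a + b) = ρ a * ρ b := by
    intro a b
    by_contra hne
    have hsub : {x : J.limit n | x.1 i = c₀} ⊆ {x | x.1 i = c₀ ∧ w (τ (a + b)) x ≠ ρ (a + b)} ∪
        ({x | x.1 i = c₀ ∧ w (τ a) (τ b • x) ≠ ρ a} ∪ {x | x.1 i = c₀ ∧ w (τ b) x ≠ ρ b}) := by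
      intro x hx
      by_contra hcon
      simp only [Set.mem_union, Set.mem_ofPred_eq, not_or, not_and, not_not] at hcon
      obtain ⟨h1, h2, h3⟩ := hcon
      apply hne
      rw [← h1 hx, ← h2 hx, ← h3 hx, hτadd, hw.mul]
    have h1 := measureReal_mono (μ := μ) hsub
    have h2 := measureReal_union_le (μ := μ) {x | x.1 i = c₀ ∧ w (τ (a + b)) x ≠ ρ (a + b)}
        ({x | x.1 i = c₀ ∧ w (τ a) (τ b • x) ≠ ρ a} ∪ {x | x.1 i = c₀ ∧ w (τ b) x ≠ ρ b})
    have h3 := measureReal_union_le (μ := μ) {x | x.1 i = c₀ ∧ w (τ a) (τ b • x) ≠ ρ a}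
        {x | x.1 i = c₀ ∧ w (τ b) x ≠ ρ b}
    have h4 := measureReal_cyl_smul (τ b) c₀ (hbad a (ρ a))
    rw [hτc] at h4
    rw [measureReal_cyl] at h1
    have h5 : 3 * (κ / cylCard J n i) < (cylCard J n i)⁻¹ := by
      rw [← mul_div_assoc, ← one_div, div_lt_div_iff_of_pos_right hN]
      linarith
    linarith [hρ (a + b), hρ a, hρ b]
  have hρ0 : ρ 0 = 1 := by
    have := hρadd 0 0
    rw [add_zero] at this
    exact left_eq_mul.mp this
  -- the skew product over the coset
  let ν := μ.restrict {x | x.1 i = c₀}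
  let m := ν.prod (Measure.count : Measure Λ)
  let T : Multiplicative (Fin n → ℤ) → J.limit n × Λ → J.limit n × Λ := fun a p =>
    (τ a.toAdd • p.1, w (τ a.toAdd) p.1 * p.2 * (ρ a.toAdd)⁻¹)
  have hmpν : ∀ a, MeasurePreserving (fun x => τ a • x) ν ν := by
    intro a
    have := (measurePreserving_smul (τ a) μ).restrict_preimage (measurableSet_cyl i c₀)
    have e : (fun x : J.limit n => τ a • x) ⁻¹' {x | x.1 i = c₀} = {x | x.1 i = c₀} := by
      ext x
      have := smul_mem_cyl_iff (τ a) x i c₀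
      rw [hτc] at this
      exact this
    rwa [e] at this
  have hT : IsMeasurePreservingAction m T :=
    { one := fun p => by
        have : τ 0 = 1 := by simp [τ, translElt_zero]
        simp [T, this, hw.one, hρ0]
      mul := fun a b p => by
        simp [T, hτadd, hρadd, hw.mul, mul_smul, mul_assoc]
      mp := fun a => measurePreserving_skew (hmpν _) (hw.measurable _) measurable_const }
  have hE : MeasurableSet (Set.univ ×ˢ ({1} : Set Λ) : Set (J.limit n × Λ)) :=
    MeasurableSet.univ.prod (measurableSet_singleton 1)
  have hfin : m (Set.univ ×ˢ ({1} : Set Λ)) ≠ ⊤ := by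
    rw [Measure.prod_prod, Measure.count_singleton, mul_one]
    exact measure_ne_top _ _
  obtain ⟨F, hF, hFinv, hFfin, hFE⟩ := exists_invariant_set hT hE hfin
    (δ := 2 * (κ / cylCard J n i)) (fun a => by
      have := measureReal_symmDiff_skew (hmpν a.toAdd) (hw.measurable (τ a.toAdd))
        (measurable_const (a := ρ a.toAdd)) MeasurableSet.univ (by simp)
      refine this.trans_le ?_
      have h2 := hρ a.toAdd
      have h3 : ν.real {x | x ∈ Set.univ ∧ w (τ a.toAdd) x ≠ ρ a.toAdd} =
          μ.real {x | x.1 i = c₀ ∧ w (τ a.toAdd) x ≠ ρ a.toAdd} := by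
        simp only [Set.mem_univ, true_and]
        rw [measureReal_restrict_apply (hbad _ _)]
        congr 1
        ext x
        exact and_comm
      rw [h3]
      linarith)
  -- The part of the coset where the fibre of `F` is the single point `l`. It contains most of the
  -- coset for `l = 1`, and the union over all `l` is invariant, hence fills the coset.
  let U : Λ → Set (J.limit n) := fun l => {x | (x, l) ∈ F ∧ ∀ l', l' ≠ l → (x, l') ∉ F}
  have hUm : ∀ l, MeasurableSet (U l) := by
    intro l
    have : U l = ((fun x => (x, l)) ⁻¹' F) ∩ ⋂ l', ⋂ (_ : l' ≠ l), ((fun x => (x, l')) ⁻¹' F)ᶜ := by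
      ext x
      simp [U]
    rw [this]
    exact (measurable_prodMk_right hF).inter (MeasurableSet.iInter fun l' =>
      MeasurableSet.iInter fun _ => (measurable_prodMk_right hF).compl)
  have hUuniq : ∀ {l l' x}, x ∈ U l → x ∈ U l' → l = l' := by
    intro l l' x hx hx'
    by_contra hne
    exact hx.2 l' (Ne.symm hne) hx'.1
  let φ : J.limit n → Λ := fun x => if hx : ∃ l, x ∈ U l then hx.choose else 1
  have hφU : ∀ {l x}, x ∈ U l → φ x = l := by
    intro l x hx
    have hx' : ∃ l, x ∈ U l := ⟨l, hx⟩
    simp only [φ, dif_pos hx']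
    exact hUuniq hx'.choose_spec hx
  have hφm : Measurable φ := by
    refine measurable_to_countable' fun l => ?_
    have : φ ⁻¹' {l} = U l ∪ (if l = 1 then (⋃ l, U l)ᶜ else ∅) := by
      ext x
      by_cases hx : ∃ l, x ∈ U l
      · obtain ⟨l', hl'⟩ := hx
        have hx2 : x ∈ ⋃ l, U l := Set.mem_iUnion.mpr ⟨l', hl'⟩
        simp only [Set.mem_preimage, Set.mem_singleton_iff, hφU hl', Set.mem_union]
        constructor
        · rintro rfl; exact Or.inl hl'
        · rintro (h1 | h1)
          · exact hUuniq hl' h1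
          · split_ifs at h1
            · exact absurd hx2 h1
            · exact absurd h1 (Set.notMem_empty x)
      · have hx2 : x ∉ ⋃ l, U l := fun hh => hx (Set.mem_iUnion.mp hh)
        have hxl : x ∉ U l := fun hh => hx ⟨l, hh⟩
        simp only [Set.mem_preimage, Set.mem_singleton_iff, φ, dif_neg hx, Set.mem_union, hxl,
          false_or]
        split_ifs with h1
        · simp only [h1, true_iff]
          exact hx2
        · simpa using Ne.symm h1
    rw [this]
    refine (hUm l).union ?_
    split_ifs
    · exact (MeasurableSet.iUnion hUm).compl
    · exact MeasurableSet.empty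
  have hU1 : μ.real {x | x.1 i = c₀ ∧ x ∉ U 1} ≤ 8 * κ / cylCard J n i := by
    have h1 := measureReal_exists_le ν (hF.symmDiff hE) hFfin
    have h2 : μ.real {x | x.1 i = c₀ ∧ x ∉ U 1} ≤
        ν.real {x | ∃ l, (x, l) ∈ symmDiff F (Set.univ ×ˢ ({1} : Set Λ))} := by
      have e : {x | x.1 i = c₀ ∧ x ∉ U 1} = (U 1)ᶜ ∩ {x : J.limit n | x.1 i = c₀} := by
        ext x; exact and_comm
      rw [e, ← measureReal_restrict_apply (hUm 1).compl]
      refine measureReal_mono ?_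
      intro x hx
      by_contra hcon
      simp only [Set.mem_ofPred_eq, not_exists, Set.mem_symmDiff, Set.mem_prod, Set.mem_univ,
        true_and, Set.mem_singleton_iff, not_or, not_and, not_not] at hcon
      exact hx ⟨(hcon 1).2 rfl, fun l' hl' hm => hl' ((hcon l').1 hm)⟩
    have h3 : 4 * (2 * (κ / cylCard J n i)) = 8 * κ / cylCard J n i := by ring
    linarith
  have hinv : ∀ a, ∀ᵐ x ∂μ, x.1 i = c₀ → ∀ l, (τ a • x, w (τ a) x * l * (ρ a)⁻¹) ∈ F ↔
      (x, l) ∈ F := by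
    intro a
    have h1 := Measure.ae_ae_of_ae_prod (hFinv (Multiplicative.ofAdd a))
    rw [ae_restrict_iff' (measurableSet_cyl i c₀)] at h1
    filter_upwards [h1] with x hx hxc l
    exact Measure.ae_count_iff.mp (hx hxc) l
  have hUinv : ∀ a, ∀ᵐ x ∂μ, x.1 i = c₀ → ∀ l, x ∈ U l ↔
      τ a • x ∈ U (w (τ a) x * l * (ρ a)⁻¹) := by
    intro a
    filter_upwards [hinv a] with x hx hxc l
    have hx := hx hxc
    have hsurj : ∀ l' : Λ, w (τ a) x * ((w (τ a) x)⁻¹ * l' * ρ a) * (ρ a)⁻¹ = l' := fun l' => by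
      group
    constructor
    · rintro ⟨h1, h2⟩
      refine ⟨(hx l).mpr h1, fun l' hl' hm => ?_⟩
      rw [← hsurj l', hx] at hm
      refine h2 _ (fun e => hl' ?_) hm
      rw [← e, hsurj]
    · rintro ⟨h1, h2⟩
      refine ⟨(hx l).mp h1, fun l' hl' hm => ?_⟩
      refine h2 _ (fun e => hl' ?_) ((hx l').mpr hm)
      exact mul_left_cancel (mul_right_cancel e)
  have hS : ∀ᵐ x ∂μ, x.1 i = c₀ → x ∈ ⋃ l, U l := by
    refine ae_mem_of_invariant_of_cyl (MeasurableSet.iUnion hUm) (fun v hv => ?_) ?_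
    · have hdvd : ∀ k, (J.d i : ℤ) ∣ v k := fun k =>
        (ZMod.intCast_zmod_eq_zero_iff_dvd _ _).mp (hv k)
      choose a ha using hdvd
      have hva : v = (J.d i : ℤ) • a := by ext k; simp [ha k]
      filter_upwards [hUinv a] with x hx hxc hmem
      rw [hva] at hmem
      obtain ⟨l, hl⟩ := Set.mem_iUnion.mp hmem
      refine Set.mem_iUnion.mpr ⟨(w (τ a) x)⁻¹ * l * ρ a, (hx hxc _).mpr ?_⟩
      have : w (τ a) x * ((w (τ a) x)⁻¹ * l * ρ a) * (ρ a)⁻¹ = l := by group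
      rwa [this]
    · intro h0
      have h1 : μ.real {x | x.1 i = c₀} ≤ μ.real {x | x.1 i = c₀ ∧ x ∉ U 1} := by
        have hsub : {x : J.limit n | x.1 i = c₀} ⊆ {x | x.1 i = c₀ ∧ x ∉ U 1} ∪
            ((⋃ l, U l) ∩ {x | x.1 i = c₀}) := by
          intro x hx
          by_cases hxU : x ∈ U 1
          · exact Or.inr ⟨Set.mem_iUnion.mpr ⟨1, hxU⟩, hx⟩
          · exact Or.inl ⟨hx, hxU⟩
        refine (measureReal_mono hsub).trans ((measureReal_union_le _ _).trans_eq ?_)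
        rw [measureReal_def μ ((⋃ l, U l) ∩ _), h0, ENNReal.toReal_zero, add_zero]
      rw [measureReal_cyl, ← one_div] at h1
      have h2 := h1.trans hU1
      rw [div_le_div_iff_of_pos_right hN] at h2
      linarith
  refine ⟨ρ, φ, hφm, fun a => ?_, ?_⟩
  · filter_upwards [hS, hUinv a] with x h1 h2 hxc
    obtain ⟨l, hl⟩ := Set.mem_iUnion.mp (h1 hxc)
    have h3 := hφU ((h2 hxc l).mp hl)
    change w (τ a) x = φ (τ a • x) * ρ a * (φ x)⁻¹
    rw [h3, hφU hl]
    group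
  · refine (measureReal_mono ?_).trans hU1
    rintro x ⟨h1, h2⟩
    exact ⟨h1, fun h3 => h2 (hφU h3)⟩

end DivChain

end TranslationTrivialization

/-! ### Cocycle superrigidity -/

section CocycleSuperrigidity

open Matrix

namespace DivChain

variable {J : DivChain} {n : ℕ} {Λ : Type*} [Group Λ] [MeasurableSpace Λ]

/-- The map `f` is almost everywhere constant on the coset `c`. -/
def IsAEConstOnCyl (i : ℕ) (f : J.limit n → Λ) (c : Fin n → ZMod (J.d i)) : Prop :=
  ∃ l, ∀ᵐ x ∂J.limitMeasure n, x.1 i = c → f x = l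

theorem IsCocycle.isAEConstOnCyl_mul {w : AffineSL n → J.limit n → Λ} (hw : IsCocycle w) {i : ℕ}
    {g h : AffineSL n} {c : Fin n → ZMod (J.d i)}
    (hg : IsAEConstOnCyl i (w g) (affineMap n (J.d i) h c)) (hh : IsAEConstOnCyl i (w h) c) :
    IsAEConstOnCyl i (w (g * h)) c := by
  obtain ⟨l, hl⟩ := hg
  obtain ⟨l', hl'⟩ := hh
  refine ⟨l * l', ?_⟩
  filter_upwards [(measurePreserving_smul h (J.limitMeasure n)).quasiMeasurePreserving.ae hl, hl']
    with x h1 h2 hx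
  rw [hw.mul, h2 hx, h1 ((smul_mem_cyl_iff h x i c).mpr hx)]

theorem IsCocycle.isAEConstOnCyl_inv {w : AffineSL n → J.limit n → Λ} (hw : IsCocycle w) {i : ℕ}
    {g : AffineSL n} {c : Fin n → ZMod (J.d i)} (hg : IsAEConstOnCyl i (w g) c) :
    IsAEConstOnCyl i (w g⁻¹) (affineMap n (J.d i) g c) := by
  obtain ⟨l, hl⟩ := hg
  refine ⟨l⁻¹, ?_⟩
  filter_upwards [(measurePreserving_smul g⁻¹ (J.limitMeasure n)).quasiMeasurePreserving.ae hl]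
    with x h1 hx
  have h2 : (g⁻¹ • x).1 i = c := by
    rw [← smul_mem_cyl_iff g, smul_inv_smul]; exact hx
  have h3 := hw.inv g (g⁻¹ • x)
  rw [smul_inv_smul] at h3
  rw [h3, h1 h2]

theorem IsCocycle.isAEConstOnCyl_one {w : AffineSL n → J.limit n → Λ} (hw : IsCocycle w) {i : ℕ}
    (c : Fin n → ZMod (J.d i)) : IsAEConstOnCyl i (w 1) c :=
  ⟨1, Filter.Eventually.of_forall fun x _ => hw.one x⟩

variable [DiscreteMeasurableSpace Λ] [Countable Λ]

/-- If a cocycle is almost everywhere constant on cosets for the translations, and a linear map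
`A` has a value of frequency larger than one half on a coset, then this value is taken almost
everywhere on the coset: the level set is invariant under `d_i ℤⁿ`. -/
theorem IsCocycle.isAEConstOnCyl_of_measureReal_lt {w : AffineSL n → J.limit n → Λ}
    (hw : IsCocycle w) {i : ℕ} (htr : ∀ v c, IsAEConstOnCyl i (w (translElt v)) c)
    (A : SpecialLinearGroup (Fin n) ℤ) (c : Fin n → ZMod (J.d i)) (l : Λ)
    (hl : (J.limitMeasure n).real {x | x.1 i = c ∧ w (linElt A) x ≠ l} <
      1 / 2 * (cylCard J n i)⁻¹) :
    IsAEConstOnCyl i (w (linElt A)) c := by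
  set μ := J.limitMeasure n
  have hE : MeasurableSet {x | w (linElt A) x = l} :=
    hw.measurable (linElt A) (measurableSet_singleton l)
  refine ⟨l, ae_mem_of_invariant_of_cyl hE (fun v hv => ?_) ?_⟩
  · obtain ⟨r, hr⟩ := htr v c
    obtain ⟨r', hr'⟩ := htr (A.1 *ᵥ v) (affineMap n (J.d i) (linElt A) c)
    have key : ∀ᵐ x ∂μ, x.1 i = c →
        w (linElt A) (translElt v • x) = r' * w (linElt A) x * r⁻¹ := by
      filter_upwards [hr,
        (measurePreserving_smul (linElt A) μ).quasiMeasurePreserving.ae hr'] with x h1 h2 hx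
      have h3 := hw.mul (linElt A) (translElt v) x
      rw [linElt_mul_translElt, hw.mul, h2 ((smul_mem_cyl_iff _ x i c).mpr hx), h1 hx] at h3
      rw [h3, mul_inv_cancel_right]
    have hl2 : r' * l * r⁻¹ = l := by
      by_contra hne
      have hsub : ∀ᵐ x ∂μ, x ∈ {x : J.limit n | x.1 i = c} →
          x ∈ {x : J.limit n | x.1 i = c ∧ w (linElt A) x ≠ l} ∪
            {x : J.limit n | x.1 i = c ∧ w (linElt A) (translElt v • x) ≠ l} := by
        filter_upwards [key] with x hx hxc
        by_cases h1 : w (linElt A) x = l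
        · refine Or.inr ⟨hxc, ?_⟩
          rw [hx hxc, h1]
          exact hne
        · exact Or.inl ⟨hxc, h1⟩
      have h1 : μ.real {x : J.limit n | x.1 i = c} ≤
          μ.real ({x : J.limit n | x.1 i = c ∧ w (linElt A) x ≠ l} ∪
            {x : J.limit n | x.1 i = c ∧ w (linElt A) (translElt v • x) ≠ l}) :=
        ENNReal.toReal_mono (measure_ne_top μ _) (measure_mono_ae hsub)
      have h2 := measureReal_union_le (μ := μ) {x | x.1 i = c ∧ w (linElt A) x ≠ l}
        {x | x.1 i = c ∧ w (linElt A) (translElt v • x) ≠ l}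
      have h4 := measureReal_cyl_smul (translElt v) c (P := fun x => w (linElt A) x ≠ l) hE.compl
      rw [affineMap_translElt_of_eq_zero hv] at h4
      have h3 := measureReal_cyl (n := n) i c
      rw [h3] at h1
      rw [h4] at h2
      have h5 := h1.trans h2
      change _ ≤ μ.real _ + μ.real _ at h5
      linarith
    filter_upwards [key] with x hx hxc hx2
    change w (linElt A) (translElt v • x) = l at hx2
    rw [hx hxc, ← hl2] at hx2
    exact mul_left_cancel (mul_right_cancel hx2)
  · intro h0
    have h1 := measureReal_union_le (μ := μ) ({x | w (linElt A) x = l} ∩ {x | x.1 i = c})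
      {x | x.1 i = c ∧ w (linElt A) x ≠ l}
    have h2 : ({x | w (linElt A) x = l} ∩ {x | x.1 i = c}) ∪
        {x : J.limit n | x.1 i = c ∧ w (linElt A) x ≠ l} = {x | x.1 i = c} := by
      ext x
      by_cases h : w (linElt A) x = l <;> simp [h]
    rw [h2, measureReal_cyl, measureReal_def, h0, ENNReal.toReal_zero, zero_add] at h1
    have := inv_pos.mpr (cylCard_pos J n i)
    linarith

/-- **Cocycle superrigidity.** Every measurable cocycle of the profinite action with values in a
countable group is cohomologous to a cocycle which is constant on the cosets of some level. -/
theorem IsCocycle.superrigidity (hn : 2 ≤ n) {w : AffineSL n → J.limit n → Λ} (hw : IsCocycle w) :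
    ∃ (i : ℕ) (φ : J.limit n → Λ), Measurable φ ∧
      ∀ (g : AffineSL n) (c : Fin n → ZMod (J.d i)), ∃ l, ∀ᵐ x ∂J.limitMeasure n,
        x.1 i = c → w g x = φ (g • x) * l * (φ x)⁻¹ := by
  classical
  set μ := J.limitMeasure n with hμ
  -- The bounds below multiply `δ = 1 / 400` by `3` (on the good coset), `24` (for the support of the
  -- transfer map there), `48` (for its discrepancy there), `49` (for its discrepancy on all cosets)
  -- and `99 = 49 + 1 + 49` (for the discrepancy of the new cocycle). In the end, `99 * δ < 1 / 2` is
  -- needed.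
  obtain ⟨i, htr, hgen⟩ := hw.exists_sum_discrepancy_le hn (δ := 1 / 400) (by norm_num)
  have hN := cylCard_pos J n i
  obtain ⟨u, hu, hu0⟩ : ∃ u : (Fin n → ZMod (J.d i)) → Fin n → ℤ,
      (∀ c k, ((u c k : ℤ) : ZMod (J.d i)) = c k) ∧ u 0 = 0 :=
    ⟨fun c k => ((c k).val : ℤ), fun c k => by simp, by ext k; simp⟩
  obtain ⟨c₀, hc₀, hc₀'⟩ := hw.exists_good_cyl htr hu
  obtain ⟨ρ, φ₀, hφ₀, hρ, hφ₀1⟩ := hw.exists_trivialization (κ := 3 * (1 / 400)) (by norm_num) hc₀'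
  have haff : ∀ e c, affineMap n (J.d i) (translElt (u e)) c = e + c := by
    intro e c
    rw [affineMap_translElt]
    congr 1
    ext k
    exact hu e k
  -- the transfer map, moved to all cosets by the translations `u e`
  let φ : J.limit n → Λ := fun x =>
    w (translElt (u (x.1 i - c₀))) ((translElt (u (x.1 i - c₀)))⁻¹ • x) *
      φ₀ ((translElt (u (x.1 i - c₀)))⁻¹ • x)
  have hφm : Measurable φ := by
    have h1 : Measurable fun p : (Fin n → ZMod (J.d i)) × J.limit n =>
        w (translElt (u (p.1 - c₀))) ((translElt (u (p.1 - c₀)))⁻¹ • p.2) *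
          φ₀ ((translElt (u (p.1 - c₀)))⁻¹ • p.2) := by
      refine measurable_from_prod_countable_right fun e => ?_
      have hs : Measurable fun x : J.limit n => (translElt (u (e - c₀)))⁻¹ • x :=
        measurable_const_smul _
      exact (Measurable.of_discrete (f := fun q : Λ × Λ => q.1 * q.2)).comp
        (((hw.measurable (translElt (u (e - c₀)))).comp hs).prodMk (hφ₀.comp hs))
    exact h1.comp ((measurable_apply i).prodMk measurable_id)
  have hφu : ∀ e (x : J.limit n), x.1 i = c₀ →
      φ (translElt (u e) • x) = w (translElt (u e)) x * φ₀ x := by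
    intro e x hx
    have : (translElt (u e) • x).1 i - c₀ = e := by
      rw [smul_apply, haff, hx, add_sub_cancel_right]
    simp only [φ, this, inv_smul_smul]
  have hφ0 : ∀ x : J.limit n, x.1 i = c₀ → φ x = φ₀ x := by
    intro x hx
    have := hφu 0 x hx
    rwa [hu0, translElt_zero, one_smul, hw.one, one_mul] at this
  -- the new cocycle
  let w' : AffineSL n → J.limit n → Λ := fun g x => (φ (g • x))⁻¹ * w g x * φ x
  have hw' : IsCocycle w' := by
    refine ⟨fun g => ?_, fun g h x => ?_⟩
    · exact (Measurable.of_discrete (f := fun q : Λ × Λ × Λ => q.1⁻¹ * q.2.1 * q.2.2)).comp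
        ((hφm.comp (measurable_const_smul g)).prodMk ((hw.measurable g).prodMk hφm))
    · simp only [w', hw.mul, mul_smul]
      group
  -- The new cocycle is constant on cosets for the translations: first on `c₀`, for the
  -- representatives `u e` by the choice of `φ` and for `d_i ℤⁿ` by the choice of `φ₀`.
  have hT1 : ∀ e, IsAEConstOnCyl i (w' (translElt (u e))) c₀ := by
    refine fun e => ⟨1, Filter.Eventually.of_forall fun x hx => ?_⟩
    simp only [w', hφu e x hx, hφ0 x hx]
    group
  have hT2 : ∀ v, IsAEConstOnCyl i (w' (translElt v)) c₀ := by
    intro v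
    have h1 : ∀ k, ∃ a : ℤ, v k - u (fun k => (v k : ZMod (J.d i))) k = J.d i * a := by
      intro k
      have : ((v k - u (fun k => (v k : ZMod (J.d i))) k : ℤ) : ZMod (J.d i)) = 0 := by
        rw [Int.cast_sub, hu, sub_self]
      exact (ZMod.intCast_zmod_eq_zero_iff_dvd _ _).mp this
    choose a ha using h1
    have h2 : translElt v = translElt (u (fun k => (v k : ZMod (J.d i)))) *
        translElt ((J.d i : ℤ) • a) := by
      rw [← translElt_add]
      congr 1
      ext k
      have := ha k
      simp only [Pi.add_apply, Pi.smul_apply, smul_eq_mul]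
      linarith
    have h0 : affineMap n (J.d i) (translElt ((J.d i : ℤ) • a)) c₀ = c₀ :=
      affineMap_translElt_of_eq_zero (by simp) c₀
    rw [h2]
    refine hw'.isAEConstOnCyl_mul (by rw [h0]; exact hT1 _) ⟨ρ a, ?_⟩
    filter_upwards [hρ a] with x hx hxc
    have hxc' : (translElt ((J.d i : ℤ) • a) • x).1 i = c₀ := by
      rw [← h0, smul_mem_cyl_iff]; exact hxc
    simp only [w', hφ0 x hxc, hφ0 _ hxc', hx hxc]
    group
  have hT : ∀ v c, IsAEConstOnCyl i (w' (translElt v)) c := by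
    intro v c
    have h1 : translElt v = translElt (v + u (c - c₀)) * (translElt (u (c - c₀)))⁻¹ := by
      rw [← translElt_neg, ← translElt_add, add_neg_cancel_right]
    have h2 := hw'.isAEConstOnCyl_inv (hT1 (c - c₀))
    rw [haff, sub_add_cancel] at h2
    rw [h1]
    refine hw'.isAEConstOnCyl_mul ?_ h2
    have h3 := affineMap_inv_left (J.d i) (translElt (u (c - c₀))) c₀
    rw [haff, sub_add_cancel] at h3
    rw [h3]
    exact hT2 _
  -- the transfer map is nearly constant on most cosets
  have hφd : ∑ c, discrepancy i φ c ≤ 49 * (1 / 400) / cylCard J n i := by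
    have h1 : ∀ e, discrepancy i φ (e + c₀) ≤ discrepancy i (w (translElt (u e))) c₀ +
        16 * (3 * (1 / 400)) / cylCard J n i ^ 2 := by
      intro e
      rw [← haff, ← discrepancy_comp_smul hφm]
      refine (discrepancy_le_add (g₁ := w (translElt (u e))) (g₂ := φ₀) ?_).trans ?_
      · intro x y hx hy h1 h2
        rw [hφu e x hx, hφu e y hy, h1, h2]
      · gcongr
        refine (discrepancy_le_of_measureReal_ne c₀ 1).trans ?_
        calc _ ≤ 2 * (8 * (3 * (1 / 400)) / cylCard J n i) / cylCard J n i := by gcongr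
          _ = _ := by field_simp; norm_num
    rw [← Equiv.sum_comp (Equiv.addRight c₀) (fun c => discrepancy i φ c)]
    refine (Finset.sum_le_sum fun e _ => h1 e).trans ?_
    rw [Finset.sum_add_distrib, Finset.sum_const, nsmul_eq_mul, Finset.card_univ, card_cyl]
    calc _ ≤ 1 / 400 / cylCard J n i +
          cylCard J n i * (16 * (3 * (1 / 400)) / cylCard J n i ^ 2) := by gcongr
      _ = _ := by field_simp; norm_num
  -- For an elementary matrix, there is a coset on which the new cocycle has a value of frequency
  -- larger than one half; translations carry the conclusion to the other cosets.
  have hG : ∀ k l (h : k ≠ l) c,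
      IsAEConstOnCyl i (w' (linElt (SpecialLinearGroup.transvection h 1))) c := by
    intro k l h
    set A : SpecialLinearGroup (Fin n) ℤ := SpecialLinearGroup.transvection h 1
    have h1 : ∑ c, discrepancy i (w' (linElt A)) c ≤ 99 * (1 / 400) / cylCard J n i := by
      have h2 : ∀ c, discrepancy i (w' (linElt A)) c ≤
          discrepancy i φ (affineMap n (J.d i) (linElt A) c) +
            discrepancy i (w (linElt A)) c + discrepancy i φ c := by
        intro c
        rw [← discrepancy_comp_smul hφm]
        refine (discrepancy_le_add (g₁ := fun x => (φ (linElt A • x))⁻¹ * w (linElt A) x) (g₂ := φ)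
          ?_).trans (add_le_add_left (discrepancy_le_add ?_) _)
        · intro x y _ _ e1 e2
          simp only [w']
          rw [e1, e2]
        · intro x y _ _ e1 e2
          rw [e1, e2]
      refine (Finset.sum_le_sum fun c _ => h2 c).trans ?_
      have h4 : ∑ c, discrepancy i φ (affineMap n (J.d i) (linElt A) c) =
          ∑ c, discrepancy i φ c :=
        Equiv.sum_comp (Equiv.ofBijective _ (affineMap_bijective (J.d i) (linElt A)))
          (fun c => discrepancy i φ c)
      rw [Finset.sum_add_distrib, Finset.sum_add_distrib, h4]
      have h3 := hgen k l h
      calc _ ≤ 49 * (1 / 400) / cylCard J n i + 1 / 400 / cylCard J n i +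
            49 * (1 / 400) / cylCard J n i := by gcongr
        _ = _ := by ring
    obtain ⟨c, hc⟩ : ∃ c, discrepancy i (w' (linElt A)) c ≤
        99 * (1 / 400) / cylCard J n i ^ 2 := by
      by_contra! hcon
      have h2 := Finset.sum_lt_sum_of_nonempty (Finset.univ_nonempty
        (α := Fin n → ZMod (J.d i))) fun c _ => hcon c
      rw [Finset.sum_const, nsmul_eq_mul, Finset.card_univ, card_cyl] at h2
      have h3 : cylCard J n i * (99 * (1 / 400) / cylCard J n i ^ 2) =
          99 * (1 / 400) / cylCard J n i := by field_simp
      linarith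
    obtain ⟨r, hr⟩ := exists_measureReal_ne_le (hw'.measurable (linElt A)) c
    have hcA : IsAEConstOnCyl i (w' (linElt A)) c := by
      refine hw'.isAEConstOnCyl_of_measureReal_lt hT A c r (hr.trans_lt ?_)
      calc _ ≤ cylCard J n i * (99 * (1 / 400) / cylCard J n i ^ 2) := by gcongr
        _ = 99 / 400 * (cylCard J n i)⁻¹ := by field_simp
        _ < _ := mul_lt_mul_of_pos_right (by norm_num) (inv_pos.mpr hN)
    intro c'
    have h3 : linElt A = (translElt (A.1 *ᵥ u (c - c')))⁻¹ *
        (linElt A * translElt (u (c - c'))) := by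
      rw [linElt_mul_translElt, inv_mul_cancel_left]
    rw [h3]
    refine hw'.isAEConstOnCyl_mul ?_ (hw'.isAEConstOnCyl_mul ?_ (hT _ _))
    · rw [← translElt_neg]
      exact hT _ _
    · rw [haff, sub_add_cancel]
      exact hcA
  have hL : ∀ A c, IsAEConstOnCyl i (w' (linElt A)) c := by
    intro A
    have hA : A ∈ elementarySubgroup n := by
      rw [elementarySubgroup_eq_top]; trivial
    induction hA using Subgroup.closure_induction with
    | mem x hx =>
      obtain ⟨k, l, h, rfl⟩ := hx
      exact hG k l h
    | one => exact fun c => hw'.isAEConstOnCyl_one c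
    | mul x y _ _ hx hy =>
      intro c
      rw [linElt_mul]
      exact hw'.isAEConstOnCyl_mul (hx _) (hy c)
    | inv x _ hx =>
      intro c
      rw [linElt_inv]
      obtain ⟨c', rfl⟩ := (affineMap_bijective (J.d i) (linElt x)).2 c
      exact hw'.isAEConstOnCyl_inv (hx c')
  refine ⟨i, φ, hφm, fun g c => ?_⟩
  have hg : IsAEConstOnCyl i (w' g) c := by
    rw [eq_translElt_mul_linElt g]
    exact hw'.isAEConstOnCyl_mul (hT _ _) (hL _ c)
  obtain ⟨l, hl⟩ := hg
  refine ⟨l, ?_⟩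
  filter_upwards [hl] with x hx hxc
  rw [← hx hxc]
  simp only [w']
  group

end DivChain

end CocycleSuperrigidity

/-! ### Freeness of the profinite action, and stabilizers of cosets -/

section Freeness

open Matrix

namespace DivChain

variable {J : DivChain} {n : ℕ}

theorem le_d (J : DivChain) (i : ℕ) : i ≤ J.d i := (strictMono_nat_of_lt_succ J.lt).le_apply

theorem diag_injective (J : DivChain) (n : ℕ) : Function.Injective (J.diag n) := by
  intro v w h
  ext k
  by_contra hne
  have h0 : v k - w k ≠ 0 := sub_ne_zero.mpr hne
  -- `d_i` divides `v k - w k` for all `i`, and `d_i` is unbounded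
  have h1 : (J.d ((v k - w k).natAbs + 1) : ℤ) ∣ v k - w k := by
    rw [← ZMod.intCast_zmod_eq_zero_iff_dvd, Int.cast_sub, sub_eq_zero]
    exact congrFun (congrFun (congrArg Subtype.val h) _) k
  have h2 := Int.natAbs_dvd_natAbs.mpr h1
  rw [Int.natAbs_natCast] at h2
  have h3 := Nat.le_of_dvd (Int.natAbs_pos.mpr h0) h2
  have h4 := J.le_d ((v k - w k).natAbs + 1)
  omega

theorem mul_translElt (g : AffineSL n) (v : Fin n → ℤ) :
    g * translElt v = translElt (g.right.1 *ᵥ v) * g := by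
  calc g * translElt v = translElt g.left.toAdd * linElt g.right * translElt v := by
        rw [← eq_translElt_mul_linElt]
    _ = translElt (g.right.1 *ᵥ v) * (translElt g.left.toAdd * linElt g.right) := by
        rw [mul_assoc, linElt_mul_translElt, ← mul_assoc, ← mul_assoc, ← translElt_add,
          ← translElt_add, add_comm]
    _ = _ := by rw [← eq_translElt_mul_linElt]

theorem translElt_right_eq_one {g : AffineSL n} (hg : g.right = 1) :
    g = translElt g.left.toAdd := by
  conv_lhs => rw [eq_translElt_mul_linElt g, hg]
  exact mul_one _

/-- The action is essentially free. If `g` has linear part `A ≠ 1`, then the set of fixed points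
of `g` meets its translates by multiples of `v` only in the empty set whenever `A v ≠ v`, so that
it is null by recurrence. -/
theorem ae_smul_ne {g : AffineSL n} (hg : g ≠ 1) : ∀ᵐ x ∂J.limitMeasure n, g • x ≠ x := by
  by_cases hA : g.right = 1
  · refine Filter.Eventually.of_forall fun x hx => hg ?_
    rw [translElt_right_eq_one hA, translElt_smul, add_eq_right] at hx
    rw [translElt_right_eq_one hA, J.diag_injective n (hx.trans (_ : 0 = J.diag n 0)),
      translElt_zero]
    ext i k
    simp [diag]
  · obtain ⟨v, hv⟩ : ∃ v, g.right.1 *ᵥ v ≠ v := by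
      by_contra! hcon
      refine hA (Subtype.ext (Matrix.ext_of_mulVec_single fun i => ?_))
      rw [hcon]
      exact (one_mulVec _).symm
    have hm : MeasurableSet {x : J.limit n | g • x = x} :=
      measurableSet_eq_fun (measurable_const_smul g) measurable_id
    rw [ae_iff]
    by_contra hne
    simp only [ne_eq, not_not] at hne
    obtain ⟨x, hx, m, hm0, hmx⟩ := (measurePreserving_smul (translElt v)
      (J.limitMeasure n)).exists_mem_iterate_mem hm.nullMeasurableSet hne
    have h1 : (fun x : J.limit n => translElt v • x)^[m] x = translElt ((m : ℤ) • v) • x := by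
      rw [smul_iterate, translElt_zsmul, zpow_natCast]
    rw [h1] at hmx
    change g • translElt ((m : ℤ) • v) • x = translElt ((m : ℤ) • v) • x at hmx
    change g • x = x at hx
    rw [← mul_smul, mul_translElt, mul_smul, hx, translElt_smul, translElt_smul, add_left_inj]
      at hmx
    have h2 := J.diag_injective n hmx
    rw [mulVec_smul] at h2
    exact hv (smul_right_injective _ (by exact_mod_cast hm0) h2)

/-- The subgroup of `SL_n(ℤ) ⋉ ℤⁿ` preserving the coset of zero modulo `d_i`. -/
def cylStabilizer (J : DivChain) (n i : ℕ) : Subgroup (AffineSL n) where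
  carrier := {g | affineMap n (J.d i) g 0 = 0}
  one_mem' := affineMap_one n _ 0
  mul_mem' {g h} hg hh := by
    change affineMap n (J.d i) (g * h) 0 = 0
    rw [affineMap_mul, show affineMap n (J.d i) h 0 = 0 from hh]
    exact hg
  inv_mem' {g} hg := by
    change affineMap n (J.d i) g⁻¹ 0 = 0
    conv_lhs => rw [← show affineMap n (J.d i) g 0 = 0 from hg]
    exact affineMap_inv_left _ g 0

theorem mem_cylStabilizer {i : ℕ} {g : AffineSL n} :
    g ∈ J.cylStabilizer n i ↔ affineMap n (J.d i) g 0 = 0 := Iff.rfl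

theorem translElt_mem_cylStabilizer {i : ℕ} {v : Fin n → ℤ}
    (hv : ∀ k, (v k : ZMod (J.d i)) = 0) : translElt v ∈ J.cylStabilizer n i :=
  affineMap_translElt_of_eq_zero hv 0

theorem smul_apply_eq_zero_iff {i : ℕ} {g : AffineSL n} (hg : g ∈ J.cylStabilizer n i)
    (x : J.limit n) : (g • x).1 i = 0 ↔ x.1 i = 0 := by
  conv_lhs => rw [← mem_cylStabilizer.mp hg]
  exact smul_mem_cyl_iff g x i 0

theorem mem_cylStabilizer_of_smul {i : ℕ} {g : AffineSL n} {x : J.limit n} (hx : x.1 i = 0)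
    (hgx : (g • x).1 i = 0) : g ∈ J.cylStabilizer n i := by
  rwa [smul_apply, hx] at hgx

end DivChain

end Freeness

/-! ### Maps sending orbits to orbits -/

section OrbitMaps

open Matrix
open scoped Pointwise

namespace DivChain

variable {J : DivChain} {n : ℕ} {Λ Z : Type*} [Group Λ] [MeasurableSpace Z] [MulAction Λ Z]

/-- The map `q` sends orbits of the profinite action to orbits of the action of `Λ` on `Z`,
injectively on the level of orbits and on each of the countably many level sets of an index
function `s`, where it scales the measure by `t⁻¹`. All this is required to hold everywhere on the
invariant conull set `X₀`, at whose points `Λ` moreover acts freely. Such maps arise from orbit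
equivalences between an amplification of the profinite action and the action of `Λ`. -/
structure IsOrbitMap (Λ : Type*) [Group Λ] [MulAction Λ Z] (η : Measure Z) (t : ℝ)
    (X₀ : Set (J.limit n)) (q : J.limit n → Z) (s : J.limit n → ℕ) : Prop where
  measurableSet : MeasurableSet X₀
  ae_mem : ∀ᵐ x ∂J.limitMeasure n, x ∈ X₀
  smul_mem : ∀ (g : AffineSL n), ∀ x ∈ X₀, g • x ∈ X₀
  measurable : Measurable q
  measurable_index : Measurable s
  exists_smul_eq : ∀ (g : AffineSL n), ∀ x ∈ X₀, ∃ l : Λ, q (g • x) = l • q x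
  exists_eq_smul : ∀ x ∈ X₀, ∀ x' ∈ X₀, ∀ l : Λ, q x' = l • q x → ∃ g : AffineSL n, x' = g • x
  free : ∀ x ∈ X₀, ∀ l : Λ, l • q x = q x → l = 1
  injOn : ∀ m, Set.InjOn q (X₀ ∩ s ⁻¹' {m})
  measure_image : ∀ m (A : Set (J.limit n)), MeasurableSet A → A ⊆ X₀ ∩ s ⁻¹' {m} →
    ENNReal.ofReal t * η (q '' A) = J.limitMeasure n A

theorem exists_of_ae_cyl {i : ℕ} {c : Fin n → ZMod (J.d i)} {P : J.limit n → Prop}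
    (h : ∀ᵐ x ∂J.limitMeasure n, x.1 i = c → P x) : ∃ x : J.limit n, x.1 i = c ∧ P x := by
  by_contra! hcon
  have h1 : J.limitMeasure n {x | x.1 i = c} = 0 := by
    refine measure_eq_zero_iff_ae_notMem.mpr ?_
    filter_upwards [h] with x hx hxc using hcon x hxc (hx hxc)
  have h2 := measureReal_cyl (n := n) i c
  rw [measureReal_def, h1, ENNReal.toReal_zero] at h2
  exact (inv_pos.mpr (cylCard_pos J n i)).ne h2

variable [MeasurableSpace Λ] [Countable Λ]

/-- The cocycle of an orbit map. -/
theorem IsOrbitMap.exists_cocycle [StandardBorelSpace Z] [MeasurableConstSMul Λ Z]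
    {η : Measure Z} {t : ℝ} {X₀ : Set (J.limit n)} {q : J.limit n → Z} {s : J.limit n → ℕ}
    (h : IsOrbitMap Λ η t X₀ q s) :
    ∃ w : AffineSL n → J.limit n → Λ, IsCocycle w ∧ ∀ g, ∀ x ∈ X₀, q (g • x) = w g x • q x := by
  classical
  let w : AffineSL n → J.limit n → Λ := fun g x =>
    if hx : x ∈ X₀ then (h.exists_smul_eq g x hx).choose else 1
  have hw : ∀ g, ∀ x ∈ X₀, q (g • x) = w g x • q x := by
    intro g x hx
    simp only [w, dif_pos hx]
    exact (h.exists_smul_eq g x hx).choose_spec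
  -- uniqueness by freeness gives both measurability and the cocycle identity
  have huniq : ∀ x ∈ X₀, ∀ l l' : Λ, l • q x = l' • q x → l = l' := by
    intro x hx l l' hl
    have := h.free x hx (l'⁻¹ * l) (by rw [mul_smul, hl, inv_smul_smul])
    exact (inv_mul_eq_one.mp this).symm
  refine ⟨w, ⟨fun g => measurable_to_countable' fun l => ?_, fun g g' x => ?_⟩, hw⟩
  · have h1 : w g ⁻¹' {l} = (X₀ ∩ {x | q (g • x) = l • q x}) ∪ (X₀ᶜ ∩ {_x | 1 = l}) := by
      ext x
      by_cases hx : x ∈ X₀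
      · simp only [Set.mem_preimage, Set.mem_singleton_iff, Set.mem_union, Set.mem_inter_iff, hx,
          Set.mem_ofPred_eq, true_and, Set.mem_compl_iff, not_true_eq_false, false_and, or_false]
        constructor
        · rintro rfl
          exact hw g x hx
        · intro h1
          exact huniq x hx _ _ ((hw g x hx).symm.trans h1)
      · simp [w, hx]
    rw [h1]
    refine (h.measurableSet.inter ?_).union (h.measurableSet.compl.inter (MeasurableSet.const _))
    exact measurableSet_eq_fun (h.measurable.comp (measurable_const_smul g))
      (h.measurable.const_smul l)
  · by_cases hx : x ∈ X₀
    · have hx' := h.smul_mem g' x hx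
      refine huniq x hx _ _ ?_
      rw [← hw _ x hx, mul_smul, mul_smul, ← hw _ x hx, ← hw _ _ hx']
    · have hx' : g' • x ∉ X₀ := fun hh => hx (by
        have := h.smul_mem g'⁻¹ _ hh
        rwa [inv_smul_smul] at this)
      simp [w, hx, hx']

variable [DiscreteMeasurableSpace Λ]

theorem measurable_smul_of_countable [MeasurableConstSMul Λ Z] {X : Type*} [MeasurableSpace X]
    {f : X → Λ} (hf : Measurable f) {q : X → Z} (hq : Measurable q) :
    Measurable fun x => f x • q x := by
  have h : Measurable fun p : Λ × Z => p.1 • p.2 :=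
    measurable_from_prod_countable_right fun l => measurable_const_smul l
  exact h.comp (hf.prodMk hq)

/-- An orbit map can be twisted by a transfer map so as to become equivariant, along a
homomorphism `ρ`, for the stabilizer of a coset of some level. -/
theorem IsOrbitMap.exists_equivariant (hn : 2 ≤ n) [StandardBorelSpace Z]
    [MeasurableConstSMul Λ Z] {η : Measure Z} {t : ℝ} {X₀ : Set (J.limit n)} {q : J.limit n → Z}
    {s : J.limit n → ℕ} (h : IsOrbitMap Λ η t X₀ q s) :
    ∃ (i : ℕ) (φ : J.limit n → Λ) (ρ : J.cylStabilizer n i →* Λ) (E : Set (J.limit n)),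
      Measurable φ ∧ MeasurableSet E ∧ E ⊆ X₀ ∧ (∀ x ∈ E, x.1 i = 0) ∧
      (∀ᵐ x ∂J.limitMeasure n, x.1 i = 0 → x ∈ E) ∧
      (∀ g : J.cylStabilizer n i, ∀ x ∈ E, g.1 • x ∈ E ∧
        φ (g.1 • x) • q (g.1 • x) = ρ g • φ x • q x) := by
  obtain ⟨w, hw, hwq⟩ := h.exists_cocycle
  obtain ⟨i, φ, hφ, hφw⟩ := hw.superrigidity hn
  choose ρ hρ using fun g => hφw g 0
  let q' : J.limit n → Z := fun x => (φ x)⁻¹ • q x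
  have hφ' : Measurable fun x => (φ x)⁻¹ := Measurable.of_discrete.comp hφ
  have hq' : Measurable q' := measurable_smul_of_countable hφ' h.measurable
  have hfree : ∀ x ∈ X₀, ∀ l l' : Λ, l • q' x = l' • q' x → l = l' := by
    intro x hx l l' hl
    simp only [q', ← mul_smul] at hl
    have h1 := h.free x hx ((l' * (φ x)⁻¹)⁻¹ * (l * (φ x)⁻¹)) (by
      rw [mul_smul, hl, inv_smul_smul])
    exact (mul_right_cancel (inv_mul_eq_one.mp h1)).symm
  let E : Set (J.limit n) := X₀ ∩ {x | x.1 i = 0} ∩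
    ⋂ g : J.cylStabilizer n i, {x | q' (g.1 • x) = ρ g.1 • q' x}
  have hE : MeasurableSet E := by
    refine (h.measurableSet.inter (measurableSet_cyl i 0)).inter (MeasurableSet.iInter fun g => ?_)
    exact measurableSet_eq_fun (hq'.comp (measurable_const_smul g.1)) (hq'.const_smul (ρ g.1))
  have hEae : ∀ᵐ x ∂J.limitMeasure n, x.1 i = 0 → x ∈ E := by
    have h1 : ∀ᵐ x ∂J.limitMeasure n, ∀ g : J.cylStabilizer n i, x.1 i = 0 →
        q' (g.1 • x) = ρ g.1 • q' x := by
      rw [ae_all_iff]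
      intro g
      filter_upwards [hρ g.1, h.ae_mem] with x hx hxX hx0
      simp only [q', hwq g.1 x hxX, hx hx0, ← mul_smul]
      congr 1
      group
    filter_upwards [h1, h.ae_mem] with x hx hxX hx0
    exact ⟨⟨hxX, hx0⟩, Set.mem_iInter.mpr fun g => hx g hx0⟩
  have hEq : ∀ (g : J.cylStabilizer n i), ∀ x ∈ E, q' (g.1 • x) = ρ g.1 • q' x :=
    fun g x hx => Set.mem_iInter.mp hx.2 g
  have hmul : ∀ g g' : J.cylStabilizer n i, ρ (g * g').1 = ρ g.1 * ρ g'.1 := by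
    intro g g'
    have h1 := (measurePreserving_smul g'.1 (J.limitMeasure n)).quasiMeasurePreserving.ae hEae
    obtain ⟨x, hx0, hx1, hx2⟩ := exists_of_ae_cyl (P := fun x => x ∈ E ∧ g'.1 • x ∈ E) (by
      filter_upwards [hEae, h1] with x hx hx' hx0
      exact ⟨hx hx0, hx' ((smul_apply_eq_zero_iff g'.2 x).mpr hx0)⟩)
    refine hfree x hx1.1.1 _ _ ?_
    rw [← hEq (g * g') x hx1, mul_smul, ← hEq g' x hx1, ← hEq g _ hx2, ← mul_smul]
    rfl
  refine ⟨i, fun x => (φ x)⁻¹, MonoidHom.mk' (fun g => ρ g.1) hmul, E, hφ', hE,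
    fun x hx => hx.1.1, fun x hx => hx.1.2, hEae, fun g x hx => ⟨?_, hEq g x hx⟩⟩
  refine ⟨⟨h.smul_mem g.1 x hx.1.1, (smul_apply_eq_zero_iff g.2 x).mpr hx.1.2⟩,
    Set.mem_iInter.mpr fun g' => ?_⟩
  change q' (g'.1 • g.1 • x) = ρ g'.1 • q' (g.1 • x)
  rw [hEq g x hx, ← mul_smul, ← mul_smul, ← hmul]
  exact hEq (g' * g) x hx

/-- The homomorphism of an equivariant orbit map is injective. Its kernel contains no translation,
by recurrence on a set where the map is injective, and a normal subgroup without translations is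
trivial. -/
theorem IsOrbitMap.injective_hom {η : Measure Z} {t : ℝ} {X₀ : Set (J.limit n)}
    {q : J.limit n → Z} {s : J.limit n → ℕ} (h : IsOrbitMap Λ η t X₀ q s) {i : ℕ}
    {φ : J.limit n → Λ} {ρ : J.cylStabilizer n i →* Λ} {E : Set (J.limit n)} (hφ : Measurable φ)
    (hE : MeasurableSet E) (hEX : E ⊆ X₀) (hEae : ∀ᵐ x ∂J.limitMeasure n, x.1 i = 0 → x ∈ E)
    (hEq : ∀ g : J.cylStabilizer n i, ∀ x ∈ E, g.1 • x ∈ E ∧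
        φ (g.1 • x) • q (g.1 • x) = ρ g • φ x • q x) : Function.Injective ρ := by
  -- A translation in the kernel: by recurrence, some power of it maps a point of a set on which
  -- `φ` and the index `s` are constant back into this set, where the equivariant map is injective.
  have htr : ∀ (v : Fin n → ℤ) (hv : ∀ k, (v k : ZMod (J.d i)) = 0),
      ρ ⟨translElt v, translElt_mem_cylStabilizer hv⟩ = 1 → v = 0 := by
    intro v hv hρv
    obtain ⟨⟨m, l⟩, hml⟩ : ∃ p : ℕ × Λ,
        J.limitMeasure n (E ∩ (s ⁻¹' {p.1} ∩ φ ⁻¹' {p.2})) ≠ 0 := by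
      by_contra! hcon
      have h1 := measure_iUnion_null hcon
      obtain ⟨x, hx0, hxE, hx⟩ := exists_of_ae_cyl (i := i) (c := 0)
        (P := fun x => x ∈ E ∧ x ∉ ⋃ p : ℕ × Λ, E ∩ (s ⁻¹' {p.1} ∩ φ ⁻¹' {p.2})) (by
          filter_upwards [hEae, measure_eq_zero_iff_ae_notMem.mp h1] with x hx hx' hx0
          exact ⟨hx hx0, hx'⟩)
      exact hx (Set.mem_iUnion.mpr ⟨(s x, φ x), hxE, rfl, rfl⟩)
    have hm : MeasurableSet (E ∩ (s ⁻¹' {m} ∩ φ ⁻¹' {l})) :=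
      hE.inter ((h.measurable_index (measurableSet_singleton m)).inter
        (hφ (measurableSet_singleton l)))
    obtain ⟨x, ⟨hxE, hxs, hxφ⟩, k, hk0, hkE, hks, hkφ⟩ :=
      (measurePreserving_smul (translElt v)
        (J.limitMeasure n)).exists_mem_iterate_mem hm.nullMeasurableSet hml
    have hiter : ∀ k : ℕ, (fun x : J.limit n => translElt v • x)^[k] x ∈ E ∧
        φ ((fun x : J.limit n => translElt v • x)^[k] x) •
          q ((fun x : J.limit n => translElt v • x)^[k] x) = φ x • q x := by
      intro k
      induction k with
      | zero => exact ⟨hxE, rfl⟩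
      | succ k ih =>
        rw [Function.iterate_succ_apply']
        obtain ⟨h1, h2⟩ := hEq ⟨translElt v, translElt_mem_cylStabilizer hv⟩ _ ih.1
        refine ⟨h1, h2.trans ?_⟩
        rw [hρv, one_smul, ih.2]
    have h1 := (hiter k).2
    rw [show φ _ = l from hkφ, show φ x = l from hxφ] at h1
    have h2 := h.injOn m ⟨hEX hkE, hks⟩ ⟨hEX hxE, hxs⟩ (MulAction.injective l h1)
    rw [smul_iterate, ← zpow_natCast, ← translElt_zsmul] at h2
    change translElt _ • x = x at h2
    rw [translElt_smul, add_eq_right] at h2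
    have h3 : (k : ℤ) • v = 0 := J.diag_injective n (h2.trans (by ext i k; simp [diag]))
    exact (smul_eq_zero.mp h3).resolve_left (by exact_mod_cast hk0)
  rw [injective_iff_map_eq_one]
  intro g hg
  have hd : ∀ (v : Fin n → ℤ) k, ((((J.d i : ℤ) • v) k : ℤ) : ZMod (J.d i)) = 0 := by
    intro v k; simp
  have hA : g.1.right = 1 := by
    refine Subtype.ext (Matrix.ext_of_mulVec_single fun k => ?_)
    -- the commutator of `g` and the translation by `d_i v` is the translation by
    -- `d_i (A v - v)`, where `A` is the linear part of `g`
    set v : Fin n → ℤ := Pi.single k 1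
    have h1 : g * ⟨translElt ((J.d i : ℤ) • v), translElt_mem_cylStabilizer (hd v)⟩ =
        ⟨translElt ((J.d i : ℤ) • (g.1.right.1 *ᵥ v - v)), translElt_mem_cylStabilizer (hd _)⟩ *
        ⟨translElt ((J.d i : ℤ) • v), translElt_mem_cylStabilizer (hd v)⟩ * g := by
      refine Subtype.ext ?_
      change g.1 * translElt _ = translElt _ * translElt _ * g.1
      rw [mul_translElt, ← translElt_add, ← smul_add, sub_add_cancel, mulVec_smul]
    have h2 := congrArg ρ h1
    rw [map_mul, map_mul, map_mul, hg, one_mul, mul_one, right_eq_mul] at h2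
    have h3 := htr _ (hd _) h2
    have h4 := (smul_eq_zero.mp h3).resolve_left (by exact_mod_cast (J.pos i).ne')
    rw [sub_eq_zero.mp h4]
    exact (one_mulVec _).symm
  have h5 := translElt_right_eq_one hA
  have h6 : ∀ k, ((g.1.left.toAdd k : ℤ) : ZMod (J.d i)) = 0 := by
    intro k
    have h7 := g.2
    rw [h5, mem_cylStabilizer, affineMap_translElt, add_zero] at h7
    exact congrFun h7 k
  have h8 := htr _ h6 (by
    rw [← hg]
    exact congrArg ρ (Subtype.ext h5.symm))
  refine Subtype.ext ?_
  rw [h5, h8]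
  rfl

end DivChain

end OrbitMaps

/-! ### The scaling factor of an orbit map -/

section Index

open scoped Pointwise ENNReal

/-- If the translates of a set of positive measure by a countable group acting ergodically
coincide or are disjoint, according to whether they are given by the same coset of a subgroup or
not, then the subgroup has finite index and the measure of the set is the inverse of the index. -/
theorem exists_card_mul_measure_eq_one {Λ Z : Type*} [Group Λ] [Countable Λ] [MeasurableSpace Z]
    [MulAction Λ Z] [MeasurableConstSMul Λ Z] {η : Measure Z} [IsProbabilityMeasure η]
    [ErgodicSMul Λ Z η] (R : Subgroup Λ) {S : Set Z} (hS : MeasurableSet S) (hS0 : η S ≠ 0)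
    (hR : ∀ l ∈ R, ∀ z ∈ S, l • z ∈ S)
    (hdis : ∀ l : Λ, ∀ z ∈ S, l • z ∈ S → l ∈ R) :
    ∃ k : ℕ, 1 ≤ k ∧ (k : ℝ≥0∞) * η S = 1 := by
  have : Countable (Λ ⧸ R) := QuotientGroup.mk_surjective.countable
  -- one translate of `S` for each coset of `R`; their union is invariant, hence conull
  let W : Λ ⧸ R → Set Z := fun c => c.out • S
  have hW : ∀ c, MeasurableSet (W c) := fun c => hS.const_smul c.out
  have hηW : ∀ c, η (W c) = η S := fun c => MeasureTheory.measure_smul η c.out S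
  have hWdis : Pairwise (Function.onFun Disjoint W) := by
    intro c c' hcc'
    refine Set.disjoint_left.mpr ?_
    rintro _ ⟨z, hz, rfl⟩ ⟨z', hz', hzz'⟩
    refine hcc' ?_
    have h1 : (c.out⁻¹ * c'.out) • z' = z := by
      rw [mul_smul, inv_smul_eq_iff]
      exact hzz'
    have h2 := hdis _ z' hz' (h1 ▸ hz)
    rw [← QuotientGroup.out_eq' c, ← QuotientGroup.out_eq' c']
    exact QuotientGroup.eq.mpr h2
  have hU : ⋃ c, W c = {z | ∃ l : Λ, l • z ∈ S} := by
    ext z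
    simp only [Set.mem_iUnion, Set.mem_ofPred_eq]
    constructor
    · rintro ⟨c, z', hz', rfl⟩
      exact ⟨c.out⁻¹, by simpa using hz'⟩
    · rintro ⟨l, hl⟩
      refine ⟨(l⁻¹ : Λ), (((l⁻¹ : Λ) : Λ ⧸ R).out⁻¹ * l⁻¹) • (l • z), hR _ ?_ _ hl, ?_⟩
      · refine QuotientGroup.eq.mp ?_
        exact QuotientGroup.out_eq' _
      · simp [mul_smul]
  have hUm : MeasurableSet (⋃ c, W c) := MeasurableSet.iUnion hW
  have hconst := ErgodicSMul.aeconst_of_forall_preimage_smul_ae_eq (G := Λ) (μ := η) hUm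
    fun g => by
      refine Filter.EventuallyEq.of_eq ?_
      rw [hU]
      ext z
      constructor
      · rintro ⟨l, hl⟩
        exact ⟨l * g, by rwa [mul_smul]⟩
      · rintro ⟨l, hl⟩
        exact ⟨l * g⁻¹, by rwa [mul_smul, inv_smul_smul]⟩
  have hU1 : η (⋃ c, W c) = 1 := by
    rcases Filter.eventuallyConst_set.mp hconst with h1 | h1
    · exact prob_compl_eq_zero_iff hUm |>.mp h1
    · refine absurd (measure_mono_null ?_ (measure_eq_zero_iff_ae_notMem.mpr h1)) hS0
      rw [hU]
      exact fun z hz => ⟨1, by rwa [one_smul]⟩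
  rw [measure_iUnion hWdis hW] at hU1
  simp only [hηW] at hU1
  -- infinitely many disjoint sets of the same positive measure do not fit into a probability space
  rcases finite_or_infinite (Λ ⧸ R) with hfin | hinf
  · have := Fintype.ofFinite (Λ ⧸ R)
    refine ⟨Fintype.card (Λ ⧸ R), Fintype.card_pos, ?_⟩
    rw [tsum_fintype] at hU1
    simpa using hU1
  · rw [ENNReal.tsum_const_eq_top_of_ne_zero hS0] at hU1
    exact absurd hU1 ENNReal.top_ne_one

namespace DivChain

variable {J : DivChain} {n : ℕ} {Λ Z : Type*} [Group Λ] [MeasurableSpace Z] [MulAction Λ Z]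
  [MeasurableSpace Λ] [Countable Λ] [DiscreteMeasurableSpace Λ]

/-- The scaling factor of an orbit map is an integral multiple of the measure of a coset: the image
of the coset is a fundamental domain for the cosets of the image of its stabilizer in `Λ`. -/
theorem IsOrbitMap.exists_scaling_eq (hn : 2 ≤ n) [StandardBorelSpace Z]
    [MeasurableConstSMul Λ Z] {η : Measure Z} [IsProbabilityMeasure η] [ErgodicSMul Λ Z η]
    {t : ℝ} (ht : 0 < t) {X₀ : Set (J.limit n)} {q : J.limit n → Z}
    {s : J.limit n → ℕ} (h : IsOrbitMap Λ η t X₀ q s) :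
    ∃ k i : ℕ, 1 ≤ k ∧ t = (k : ℝ) / (J.d i : ℝ) ^ n := by
  obtain ⟨i, φ, ρ, E, hφ, hE, hEX, hE0, hEae, hEq⟩ := h.exists_equivariant hn
  have hρ := h.injective_hom hφ hE hEX hEae hEq
  let q' : J.limit n → Z := fun x => φ x • q x
  have hq' : Measurable q' := measurable_smul_of_countable hφ h.measurable
  -- points of the image of `E` in the same orbit are related by the range of `ρ`, by freeness
  have horb : ∀ x ∈ E, ∀ x' ∈ E, ∀ l : Λ, q' x' = l • q' x →
      ∃ g : J.cylStabilizer n i, x' = g.1 • x ∧ l = ρ g := by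
    intro x hx x' hx' l hl
    obtain ⟨g, hg⟩ := h.exists_eq_smul x (hEX hx) x' (hEX hx') ((φ x')⁻¹ * l * φ x) (by
      rw [mul_smul, mul_smul]
      exact eq_inv_smul_iff.mpr hl)
    have hgs : g ∈ J.cylStabilizer n i :=
      mem_cylStabilizer_of_smul (hE0 x hx) (hg ▸ hE0 x' hx')
    refine ⟨⟨g, hgs⟩, hg, ?_⟩
    have h1 : ρ ⟨g, hgs⟩ • q' x = l • q' x := by
      rw [← hl, hg]
      exact ((hEq ⟨g, hgs⟩ x hx).2).symm
    have h2 := h.free x (hEX hx) ((φ x)⁻¹ * (l⁻¹ * ρ ⟨g, hgs⟩) * φ x) (by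
      rw [mul_smul, mul_smul, mul_smul]
      change (φ x)⁻¹ • l⁻¹ • ρ ⟨g, hgs⟩ • q' x = q x
      rw [h1, inv_smul_smul]
      exact inv_smul_smul _ _)
    rw [mul_assoc, inv_mul_eq_one, eq_comm, mul_eq_right] at h2
    exact inv_mul_eq_one.mp h2
  have hinj : Set.InjOn q' E := by
    intro x hx x' hx' hxx'
    obtain ⟨g, hg, hl⟩ := horb x hx x' hx' 1 (by rw [one_smul, hxx'])
    rw [hg, hρ ((map_one ρ).trans hl).symm]
    exact (one_smul _ x).symm
  have hS : MeasurableSet (q' '' E) := hE.image_of_measurable_injOn hq' hinj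
  -- the measure of the image, computed on the pieces where `s` and `φ` are constant
  let P : ℕ × Λ → Set (J.limit n) := fun p => E ∩ (s ⁻¹' {p.1} ∩ φ ⁻¹' {p.2})
  have hP : ∀ p, MeasurableSet (P p) := fun p =>
    hE.inter ((h.measurable_index (measurableSet_singleton p.1)).inter
        (hφ (measurableSet_singleton p.2)))
  have hPdis : Pairwise (Function.onFun Disjoint P) := by
    intro p p' hpp'
    refine Set.disjoint_left.mpr ?_
    rintro x ⟨_, h1, h2⟩ ⟨_, h3, h4⟩
    exact hpp' (Prod.ext (h1.symm.trans h3) (h2.symm.trans h4))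
  have hPE : ⋃ p, P p = E := by
    ext x
    simp only [Set.mem_iUnion]
    exact ⟨fun ⟨p, hp⟩ => hp.1, fun hx => ⟨(s x, φ x), hx, rfl, rfl⟩⟩
  have hPm : ∀ p, ENNReal.ofReal t * η (q' '' P p) = J.limitMeasure n (P p) := by
    intro p
    have h1 : q' '' P p = p.2 • (q '' P p) := by
      rw [← Set.image_smul, Set.image_image]
      refine Set.image_congr fun x hx => ?_
      simp only [q', show φ x = p.2 from hx.2.2]
    rw [h1, MeasureTheory.measure_smul,
      h.measure_image p.1 (P p) (hP p) fun x hx => ⟨hEX hx.1, hx.2.1⟩]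
  have hSm : ENNReal.ofReal t * η (q' '' E) = J.limitMeasure n {x | x.1 i = 0} := by
    have h1 : J.limitMeasure n {x | x.1 i = 0} = J.limitMeasure n E := by
      refine measure_congr ?_
      filter_upwards [hEae] with x hx
      exact propext ⟨hx, hE0 x⟩
    rw [h1, ← hPE, Set.image_iUnion, measure_iUnion _ fun p => (hP p).image_of_measurable_injOn hq'
      (hinj.mono Set.inter_subset_left), ← ENNReal.tsum_mul_left, measure_iUnion hPdis hP]
    · exact tsum_congr hPm
    · intro p p' hpp'
      refine Set.disjoint_left.mpr ?_
      rintro _ ⟨x, hx, rfl⟩ ⟨x', hx', hxx'⟩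
      exact Set.disjoint_left.mp (hPdis hpp') hx (hinj hx'.1 hx.1 hxx' ▸ hx')
  have hS0 : η (q' '' E) ≠ 0 := by
    intro h0
    rw [h0, mul_zero, limitMeasure_fiber] at hSm
    exact absurd hSm (ENNReal.inv_ne_zero.mpr (ENNReal.pow_ne_top (ENNReal.natCast_ne_top _))).symm
  obtain ⟨k, hk, hk1⟩ := exists_card_mul_measure_eq_one (Λ := Λ) ρ.range hS hS0 (by
    rintro _ ⟨g, rfl⟩ _ ⟨x, hx, rfl⟩
    exact ⟨g.1 • x, hEq g x hx⟩) (by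
    rintro l _ ⟨x, hx, rfl⟩ ⟨x', hx', hxx'⟩
    obtain ⟨g, _, hg⟩ := horb x hx x' hx' l hxx'
    exact ⟨g, hg.symm⟩)
  refine ⟨k, i, hk, ?_⟩
  have h1 : ENNReal.ofReal t = k * ((J.d i : ENNReal) ^ n)⁻¹ := by
    rw [← limitMeasure_fiber J n i 0, ← hSm, mul_left_comm, hk1, mul_one]
  have h2 := congrArg ENNReal.toReal h1
  rw [ENNReal.toReal_ofReal ht.le] at h2
  rw [h2, div_eq_mul_inv]
  simp

end DivChain

end Index

/-! ### Measures of amplifications -/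

section Amplifications

variable {X : Type} [MeasurableSpace X] {μ : Measure X}

theorem amplifiedMeasure_preimage {Y : Set (X × ℕ)} (hY : MeasurableSet Y) {A : Set X} {j : ℕ}
    (hAY : A ×ˢ {j} ⊆ Y) :
    amplifiedMeasure μ Y (Subtype.val ⁻¹' (A ×ˢ {j})) = (stabMeasure μ Y)⁻¹ * μ A := by
  rw [amplifiedMeasure, Measure.smul_apply, smul_eq_mul,
    comap_subtype_coe_apply hY, Subtype.image_preimage_coe, Set.inter_eq_self_of_subset_right hAY,
    stabMeasure, Measure.prod_prod, Measure.count_singleton, mul_one]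

theorem measurable_apply_index {Z : Type*} [MeasurableSpace Z] {f : ℕ → X → Z}
    (hf : ∀ m, Measurable (f m)) {s : X → ℕ} (hs : Measurable s) :
    Measurable fun x => f (s x) x := by
  have h1 : Measurable fun p : ℕ × X => f p.1 p.2 := measurable_from_prod_countable_right hf
  exact h1.comp (hs.prodMk measurable_id)

variable [SFinite μ]

/-- The measure `μ × c` is the sum of copies of `μ` on the levels. -/
theorem stabMeasure_eq_sum : stabMeasure μ = Measure.sum fun j : ℕ => μ.map fun x => (x, j) := by
  rw [stabMeasure, Measure.count, Measure.prod_sum_right]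
  simp only [Measure.prod_dirac]

theorem stabMeasure_apply {Y : Set (X × ℕ)} (hY : MeasurableSet Y) :
    stabMeasure μ Y = ∑' j, μ {x | (x, j) ∈ Y} := by
  rw [stabMeasure_eq_sum, Measure.sum_apply _ hY]
  exact tsum_congr fun j => Measure.map_apply measurable_prodMk_right hY

theorem ae_stabMeasure_iff {P : X × ℕ → Prop} :
    (∀ᵐ p ∂stabMeasure μ, P p) ↔ ∀ j, ∀ᵐ x ∂μ, P (x, j) := by
  rw [stabMeasure_eq_sum, Measure.ae_sum_iff]
  refine forall_congr' fun j => ?_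
  exact (measurableEmbedding_prod_mk_right j).ae_map_iff

theorem ae_amplifiedMeasure_iff {Y : Set (X × ℕ)} (hY : MeasurableSet Y)
    (hfin : stabMeasure μ Y ≠ ⊤) {P : Y → Prop} :
    (∀ᵐ y ∂amplifiedMeasure μ Y, P y) ↔ ∀ j, ∀ᵐ x ∂μ, ∀ h : (x, j) ∈ Y, P ⟨(x, j), h⟩ := by
  rw [amplifiedMeasure, Measure.ae_ennreal_smul_measure_iff (ENNReal.inv_ne_zero.mpr hfin)]
  have h1 : (∀ y : Y, P y ↔ (fun p : X × ℕ => ∀ h : p ∈ Y, P ⟨p, h⟩) y.1) :=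
    fun y => ⟨fun h _ => h, fun h => h y.2⟩
  refine (Filter.eventually_congr (Filter.Eventually.of_forall h1)).trans
    ((ae_restrict_iff_subtype hY (p := fun p => ∀ h : p ∈ Y, P ⟨p, h⟩)).symm.trans ?_)
  rw [ae_restrict_iff' hY, ae_stabMeasure_iff]
  refine forall_congr' fun j => Filter.eventually_congr (Filter.Eventually.of_forall fun x => ?_)
  exact ⟨fun h h' => h h' h', fun h h' _ => h h'⟩

end Amplifications

/-! ### Orbit maps from orbit equivalences -/

section OrbitMapOfOrbitEquivalence

namespace DivChain

variable {J : DivChain} {n : ℕ} {Λ Z : Type} [Group Λ] [MulAction Λ Z]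

theorem ae_forall_smul {P : J.limit n → Prop} (h : ∀ᵐ x ∂J.limitMeasure n, P x) :
    ∀ᵐ x ∂J.limitMeasure n, ∀ g : AffineSL n, P (g • x) := by
  rw [ae_all_iff]
  exact fun g => (measurePreserving_smul g (J.limitMeasure n)).quasiMeasurePreserving.ae h

theorem exists_smul_of_bijOn {Y : Set (J.limit n × ℕ)} {θ : Y → Z} {y y' : Y}
    (h : Set.BijOn θ {y' | amplifiedRel (J.rel n) Y y y'}
      {z | MulAction.orbitRel Λ Z (θ y) z}) {g : AffineSL n} (hg : g • y'.1.1 = y.1.1) :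
    ∃ l : Λ, θ y' = l • θ y := by
  have h1 : amplifiedRel (J.rel n) Y y y' := ⟨g, hg⟩
  have h2 : MulAction.orbitRel Λ Z (θ y) (θ y') := h.mapsTo h1
  obtain ⟨l, hl⟩ := MulAction.orbitRel_apply.mp (Setoid.symm' _ h2)
  exact ⟨l, hl.symm⟩

theorem exists_preimage_of_bijOn {Y : Set (J.limit n × ℕ)} {θ : Y → Z} {y : Y}
    (h : Set.BijOn θ {y' | amplifiedRel (J.rel n) Y y y'}
      {z | MulAction.orbitRel Λ Z (θ y) z}) (l : Λ) :
    ∃ (y' : Y) (g : AffineSL n), y'.1.1 = g • y.1.1 ∧ θ y' = l • θ y := by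
  have h2 : MulAction.orbitRel Λ Z (θ y) (l • θ y) :=
    Setoid.symm' _ (MulAction.orbitRel_apply.mpr ⟨l, rfl⟩)
  obtain ⟨y', h3, hy'⟩ := h.surjOn h2
  obtain ⟨g, hg⟩ := MulAction.orbitRel_apply.mp (Setoid.symm' (J.rel n) h3)
  exact ⟨y', g, hg.symm, hy'⟩

variable [Countable Λ] [MeasurableSpace Z] [StandardBorelSpace Z]

/-- An orbit equivalence between an amplification of the profinite action and a free action
gives rise to an orbit map, by moving points into a fixed level of the amplification. -/
theorem exists_isOrbitMap {η : Measure Z} [IsProbabilityMeasure η] {t : ℝ} (ht : 0 < t)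
    {Y : Set (J.limit n × ℕ)} (hY : MeasurableSet Y)
    (hYt : stabMeasure (J.limitMeasure n) Y = ENNReal.ofReal t)
    (hfree : ∀ l : Λ, l ≠ 1 → ∀ᵐ z ∂η, l • z ≠ z)
    (hoe : OrbitEquivalent (amplifiedRel (J.rel n) Y) (amplifiedMeasure (J.limitMeasure n) Y)
      (MulAction.orbitRel Λ Z) η) :
    ∃ (X₀ : Set (J.limit n)) (q : J.limit n → Z) (s : J.limit n → ℕ),
      IsOrbitMap Λ η t X₀ q s := by
  classical
  set μ := J.limitMeasure n with hμ
  have hne : Nonempty Z := η.nonempty_of_neZero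
  obtain ⟨θ, ⟨hθ, θ', hθ', hleft, -⟩, hbij⟩ := hoe
  have hYfin : stabMeasure μ Y ≠ ⊤ := hYt ▸ ENNReal.ofReal_ne_top
  -- The points at which the almost sure properties of `θ` and of the action hold. The conull
  -- invariant set `X₀` below consists of points whose whole orbit is good on all levels.
  let Good : Y → Prop := fun y => (∀ l : Λ, l ≠ 1 → l • θ y ≠ θ y) ∧ θ' (θ y) = y ∧
    (∀ (y' : Y) (g : AffineSL n), g • y'.1.1 = y.1.1 → ∃ l : Λ, θ y' = l • θ y) ∧
    ∀ l : Λ, ∃ (y' : Y) (g : AffineSL n), y'.1.1 = g • y.1.1 ∧ θ y' = l • θ y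
  have hgood : ∀ᵐ x ∂μ, ∀ j, ∀ h : (x, j) ∈ Y, Good ⟨(x, j), h⟩ := by
    rw [ae_all_iff]
    refine (ae_amplifiedMeasure_iff hY hYfin).mp ?_
    have h1 : ∀ᵐ z ∂η, ∀ l : Λ, l ≠ 1 → l • z ≠ z := by
      rw [ae_all_iff]
      intro l
      by_cases hl : l = 1
      · exact Filter.Eventually.of_forall fun z h => absurd hl h
      · filter_upwards [hfree l hl] with z hz _ using hz
    filter_upwards [hθ.quasiMeasurePreserving.ae h1, hleft, hbij] with y a b c
    exact ⟨a, b, fun y' g => exists_smul_of_bijOn c, exists_preimage_of_bijOn c⟩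
  obtain ⟨B, hBm, hB0, hBgood⟩ : ∃ B : Set (J.limit n), MeasurableSet B ∧ (∀ᵐ x ∂μ, x ∉ B) ∧
      ∀ x, x ∉ B → ∀ j, ∀ h : (x, j) ∈ Y, Good ⟨(x, j), h⟩ := by
    refine ⟨toMeasurable μ {x | ¬ ∀ j, ∀ h : (x, j) ∈ Y, Good ⟨(x, j), h⟩},
      measurableSet_toMeasurable _ _, ?_, fun x hx => ?_⟩
    · refine measure_eq_zero_iff_ae_notMem.mp ?_
      rw [measure_toMeasurable]
      exact hgood
    · by_contra hcon
      exact hx (subset_toMeasurable _ _ hcon)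
  -- a level `j₀` on which `Y` has positive measure; almost every point can be moved into it
  obtain ⟨j₀, hj₀⟩ : ∃ j, μ {x | (x, j) ∈ Y} ≠ 0 := by
    by_contra! hcon
    rw [stabMeasure_apply hY] at hYt
    simp only [hcon, tsum_zero] at hYt
    exact (ENNReal.ofReal_pos.mpr ht).ne hYt
  let Y₀ : Set (J.limit n) := {x | (x, j₀) ∈ Y}
  have hY₀ : MeasurableSet Y₀ := measurable_prodMk_right hY
  obtain ⟨e, he⟩ := exists_surjective_nat (AffineSL n)
  let U : Set (J.limit n) := ⋃ m, {x | e m • x ∈ Y₀}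
  have hUm : MeasurableSet U := MeasurableSet.iUnion fun m => measurable_const_smul (e m) hY₀
  have hUinv : ∀ (g : AffineSL n) x, x ∈ U → g • x ∈ U := by
    intro g x hx
    obtain ⟨m, hm⟩ := Set.mem_iUnion.mp hx
    obtain ⟨m', hm'⟩ := he (e m * g⁻¹)
    refine Set.mem_iUnion.mpr ⟨m', ?_⟩
    change e m' • g • x ∈ Y₀
    rwa [hm', mul_smul, inv_smul_smul]
  have hUae : ∀ᵐ x ∂μ, x ∈ U := by
    have hconst := ErgodicSMul.aeconst_of_forall_preimage_smul_ae_eq (G := AffineSL n) (μ := μ) hUm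
      fun g => Filter.EventuallyEq.of_eq <| by
        ext x
        refine ⟨fun hx => ?_, hUinv g x⟩
        have := hUinv g⁻¹ _ hx
        rwa [inv_smul_smul] at this
    rcases Filter.eventuallyConst_set.mp hconst with h1 | h1
    · exact h1
    · refine absurd (measure_mono_null ?_ (measure_eq_zero_iff_ae_notMem.mpr h1)) hj₀
      intro x hx
      obtain ⟨m, hm⟩ := he 1
      refine Set.mem_iUnion.mpr ⟨m, ?_⟩
      change e m • x ∈ Y₀
      rwa [hm, one_smul]
  let X₀ : Set (J.limit n) := (⋂ g : AffineSL n, {x | g • x ∈ Bᶜ}) ∩ U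
  -- `s x` is the first index in an enumeration `e` of the group that moves `x` into the level
  obtain ⟨s, hs, hsU⟩ : ∃ s : J.limit n → ℕ, Measurable s ∧
      ∀ x ∈ X₀, (e (s x) • x, j₀) ∈ Y := by
    have hsp : ∀ x : J.limit n, ∃ m, e m • x ∈ Y₀ ∨ x ∉ U := by
      intro x
      by_cases hx : x ∈ U
      · obtain ⟨m, hm⟩ := Set.mem_iUnion.mp hx
        exact ⟨m, Or.inl hm⟩
      · exact ⟨0, Or.inr hx⟩
    exact ⟨fun x => Nat.find (hsp x), measurable_find hsp fun m =>
      MeasurableSet.union (measurable_const_smul (e m) hY₀) hUm.compl, fun x hx =>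
      (Nat.find_spec (hsp x)).resolve_right fun h => h hx.2⟩
  obtain ⟨θe, hθe, hθeθ⟩ := (MeasurableEmbedding.subtype_coe hY).exists_measurable_extend
    hθ.measurable fun _ => hne
  let q : J.limit n → Z := fun x => θe (e (s x) • x, j₀)
  have hq : Measurable q := measurable_apply_index (f := fun m x => θe (e m • x, j₀))
    (fun m => hθe.comp ((measurable_const_smul (e m)).prodMk measurable_const)) hs
  let y : X₀ → Y := fun x => ⟨(e (s x.1) • x.1, j₀), hsU x.1 x.2⟩
  have hqy : ∀ x : X₀, q x.1 = θ (y x) := fun x => congrFun hθeθ (y x)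
  have hX₀smul : ∀ (g : AffineSL n), ∀ x ∈ X₀, g • x ∈ X₀ := by
    intro g x hx
    refine ⟨Set.mem_iInter.mpr fun g' => ?_, hUinv g x hx.2⟩
    have := Set.mem_iInter.mp hx.1 (g' * g)
    change g' • g • x ∈ Bᶜ
    rwa [← mul_smul]
  have hX₀good : ∀ x ∈ X₀, ∀ y' : Y, (∃ g : AffineSL n, y'.1.1 = g • x) → Good y' := by
    rintro x hx ⟨⟨x', j⟩, hy'⟩ ⟨g, hg⟩
    refine hBgood x' ?_ j hy'
    have := Set.mem_iInter.mp hx.1 g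
    rw [show x' = g • x from hg]
    exact this
  have hygood : ∀ x : X₀, Good (y x) := fun x => hX₀good x.1 x.2 (y x) ⟨_, rfl⟩
  have hinj : ∀ x x' : X₀, q x.1 = q x'.1 → y x = y x' := by
    intro x x' h
    rw [← (hygood x).2.1, ← (hygood x').2.1, ← hqy, ← hqy, h]
  have hX₀m : MeasurableSet X₀ :=
    (MeasurableSet.iInter fun g => measurable_const_smul g hBm.compl).inter hUm
  refine ⟨X₀, q, s, hX₀m, ?_, hX₀smul, hq, hs, ?_, ?_, ?_, ?_, ?_⟩
  · filter_upwards [ae_forall_smul hB0, hUae] with x hx hx'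
    exact ⟨Set.mem_iInter.mpr hx, hx'⟩
  · intro g x hx
    have hgx := hX₀smul g x hx
    obtain ⟨l, hl⟩ := (hygood ⟨x, hx⟩).2.2.1 (y ⟨g • x, hgx⟩)
      (e (s x) * g⁻¹ * (e (s (g • x)))⁻¹) (by
        change (e (s x) * g⁻¹ * (e (s (g • x)))⁻¹) • e (s (g • x)) • g • x = e (s x) • x
        rw [mul_smul, inv_smul_smul, mul_smul, inv_smul_smul])
    exact ⟨l, by rw [hqy ⟨x, hx⟩, hqy ⟨g • x, hgx⟩, hl]⟩
  · intro x hx x' hx' l hl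
    obtain ⟨y', g, hg, hy'⟩ := (hygood ⟨x, hx⟩).2.2.2 l
    have hg' : y'.1.1 = g • e (s x) • x := hg
    have hgy' : Good y' := hX₀good x hx y' ⟨g * e (s x), by rw [mul_smul, hg']⟩
    have h1 : y' = y ⟨x', hx'⟩ := by
      rw [← hgy'.2.1, hy', ← hqy ⟨x, hx⟩, ← hl, hqy ⟨x', hx'⟩, (hygood ⟨x', hx'⟩).2.1]
    rw [h1] at hg'
    change e (s x') • x' = g • e (s x) • x at hg'
    refine ⟨(e (s x'))⁻¹ * (g * e (s x)), ?_⟩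
    rw [mul_smul, mul_smul, ← hg', inv_smul_smul]
  · intro x hx l hl
    by_contra hne
    rw [hqy ⟨x, hx⟩] at hl
    exact (hygood ⟨x, hx⟩).1 l hne hl
  · intro m x hx x' hx' hxx'
    have h1 := congrArg (fun y : Y => y.1.1) (hinj ⟨x, hx.1⟩ ⟨x', hx'.1⟩ hxx')
    change e (s x) • x = e (s x') • x' at h1
    rw [show s x = m from hx.2, show s x' = m from hx'.2] at h1
    exact MulAction.injective _ h1
  · intro m A hA hAX
    have hinjA : Set.InjOn q A := by
      intro x hx x' hx' hxx'
      have h1 := congrArg (fun y : Y => y.1.1) (hinj ⟨x, (hAX hx).1⟩ ⟨x', (hAX hx').1⟩ hxx')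
      change e (s x) • x = e (s x') • x' at h1
      rw [show s x = m from (hAX hx).2, show s x' = m from (hAX hx').2] at h1
      exact MulAction.injective _ h1
    have hqA : MeasurableSet (q '' A) := hA.image_of_measurable_injOn hq hinjA
    let A' : Set (J.limit n) := {x | (e m)⁻¹ • x ∈ A}
    have hA' : MeasurableSet A' := measurable_const_smul (e m)⁻¹ hA
    have hyA : ∀ x (hx : x ∈ A), y ⟨x, (hAX hx).1⟩ ∈ (Subtype.val ⁻¹' (A' ×ˢ {j₀}) : Set Y) := by
      intro x hx
      refine ⟨?_, rfl⟩
      change (e m)⁻¹ • e (s x) • x ∈ A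
      rwa [show s x = m from (hAX hx).2, inv_smul_smul]
    have hA'Y : A' ×ˢ {j₀} ⊆ Y := by
      rintro ⟨x, j⟩ ⟨hx, hj⟩
      have h1 := hsU _ (hAX hx).1
      rw [show s ((e m)⁻¹ • x) = m from (hAX hx).2, smul_inv_smul] at h1
      rwa [show j = j₀ from hj]
    have hpre : θ ⁻¹' (q '' A) =ᵐ[amplifiedMeasure μ Y] Subtype.val ⁻¹' (A' ×ˢ {j₀}) := by
      filter_upwards [hleft] with y' hy'
      refine propext ⟨?_, ?_⟩
      · rintro ⟨x, hx, hxy⟩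
        rw [hqy ⟨x, (hAX hx).1⟩] at hxy
        have h1 : y' = y ⟨x, (hAX hx).1⟩ := by
          rw [← hy', ← hxy, (hygood _).2.1]
        change y' ∈ (Subtype.val ⁻¹' (A' ×ˢ {j₀}) : Set Y)
        rw [h1]
        exact hyA x hx
      · rintro ⟨hx, hj⟩
        refine ⟨(e m)⁻¹ • y'.1.1, hx, ?_⟩
        rw [hqy ⟨_, (hAX hx).1⟩]
        congr 1
        refine Subtype.ext (Prod.ext ?_ hj.symm)
        change e (s ((e m)⁻¹ • y'.1.1)) • (e m)⁻¹ • y'.1.1 = y'.1.1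
        rw [show s ((e m)⁻¹ • y'.1.1) = m from (hAX hx).2, smul_inv_smul]
    rw [← hθ.measure_preimage hqA.nullMeasurableSet, measure_congr hpre,
      amplifiedMeasure_preimage hY hA'Y, hYt, ← mul_assoc,
      ENNReal.mul_inv_cancel (ENNReal.ofReal_pos.mpr ht).ne' ENNReal.ofReal_ne_top, one_mul]
    exact (measurePreserving_smul (e m)⁻¹ μ).measure_preimage hA.nullMeasurableSet

/-- The invariant `𝓢` only contains integral multiples of the numbers `1 / d_iⁿ`. -/
theorem exists_eq_of_mem_sInvariant (hn : 2 ≤ n) {t : ℝ}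
    (h : t ∈ sInvariant (J.rel n) (J.limitMeasure n)) :
    ∃ k i : ℕ, 1 ≤ k ∧ t = (k : ℝ) / (J.d i : ℝ) ^ n := by
  obtain ⟨ht, Y, hY, hYt, Λ, _, _, Z, _, _, _, _, η, _, _, _, hfree, hoe⟩ := h
  obtain ⟨X₀, q, s, hq⟩ := exists_isOrbitMap ht hY hYt hfree hoe
  let _ : MeasurableSpace Λ := ⊤
  have : DiscreteMeasurableSpace Λ := ⟨fun _ => trivial⟩
  exact hq.exists_scaling_eq hn ht

end DivChain

end OrbitMapOfOrbitEquivalence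

/-! ### Free ergodic actions on copies of a coset -/

section AmplifiedCyls

theorem amplifiedMeasure_apply {X : Type} [MeasurableSpace X] {μ : Measure X} [SFinite μ]
    {Y : Set (X × ℕ)} (hY : MeasurableSet Y) {s : Set Y} (hs : MeasurableSet s) :
    amplifiedMeasure μ Y s =
      (stabMeasure μ Y)⁻¹ * ∑' j, μ {x | ∃ h : (x, j) ∈ Y, (⟨(x, j), h⟩ : Y) ∈ s} := by
  rw [amplifiedMeasure, Measure.smul_apply, smul_eq_mul, comap_subtype_coe_apply hY,
    stabMeasure_apply (hY.subtype_image hs)]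
  congr 2
  funext j
  congr 1
  ext x
  simp

namespace DivChain

variable (J : DivChain) (n i k : ℕ)

/-- The disjoint union of `k` copies of the coset of zero modulo `d_i`. -/
def cylCopies : Set (J.limit n × ℕ) := {p | p.1.1 i = 0 ∧ p.2 < k}

theorem measurableSet_cylCopies : MeasurableSet (J.cylCopies n i k) :=
  (measurable_fst (measurableSet_cyl i 0)).inter
    (measurable_snd (MeasurableSet.of_discrete (s := {j | j < k})))

theorem stabMeasure_cylCopies :
    stabMeasure (J.limitMeasure n) (J.cylCopies n i k) = k * ((J.d i : ENNReal) ^ n)⁻¹ := by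
  have h1 : J.cylCopies n i k = {x | x.1 i = 0} ×ˢ ((Finset.range k : Finset ℕ) : Set ℕ) := by
    ext p
    simp [cylCopies]
  rw [h1, stabMeasure, Measure.prod_prod, limitMeasure_fiber, Measure.count_apply_finset,
    Finset.card_range, mul_comm]

variable {J n i k}

theorem stabMeasure_cylCopies_ne_top :
    stabMeasure (J.limitMeasure n) (J.cylCopies n i k) ≠ ⊤ := by
  rw [stabMeasure_cylCopies]
  refine ENNReal.mul_ne_top (ENNReal.natCast_ne_top k) (ENNReal.inv_ne_top.mpr ?_)
  exact pow_ne_zero _ (by exact_mod_cast (J.pos i).ne')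

theorem ae_cylCopies_iff {P : J.cylCopies n i k → Prop} :
    (∀ᵐ y ∂amplifiedMeasure (J.limitMeasure n) (J.cylCopies n i k), P y) ↔
      ∀ j, ∀ᵐ x ∂J.limitMeasure n, ∀ h : (x, j) ∈ J.cylCopies n i k, P ⟨(x, j), h⟩ :=
  ae_amplifiedMeasure_iff (J.measurableSet_cylCopies n i k) stabMeasure_cylCopies_ne_top

/-- The Haar measure has no atoms, by recurrence under a translation without periodic points. -/
theorem limitMeasure_singleton (hn : n ≠ 0) (x : J.limit n) : J.limitMeasure n {x} = 0 := by
  by_contra hne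
  let v : Fin n → ℤ := fun _ => 1
  obtain ⟨y, hy, m, hm0, hmy⟩ := (measurePreserving_smul (translElt v)
    (J.limitMeasure n)).exists_mem_iterate_mem (measurableSet_singleton x).nullMeasurableSet hne
  rw [smul_iterate, ← zpow_natCast, ← translElt_zsmul] at hmy
  change translElt ((m : ℤ) • v) • y = x at hmy
  rw [show y = x from hy, translElt_smul, add_eq_right] at hmy
  have h1 := J.diag_injective n (hmy.trans (by ext i k; simp [diag] : 0 = J.diag n 0))
  have h2 := congrFun h1 ⟨0, Nat.pos_of_ne_zero hn⟩
  simp [v] at h2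
  exact hm0 h2

theorem nullSingletonClass_cylCopies (hn : n ≠ 0) :
    NullSingletonClass (amplifiedMeasure (J.limitMeasure n) (J.cylCopies n i k)) := by
  refine ⟨fun y => ?_⟩
  refine measure_eq_zero_iff_ae_notMem.mpr (ae_cylCopies_iff.mpr fun j => ?_)
  filter_upwards [measure_eq_zero_iff_ae_notMem.mp (limitMeasure_singleton hn y.1.1)] with x hx h hy
  have h1 : (⟨(x, j), h⟩ : J.cylCopies n i k) = y := hy
  exact hx (by rw [← h1]; rfl)

variable [NeZero k]

/-- The stabilizer of the coset of zero modulo `d_i` acts on each of the `k` copies of the coset,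
and `ℤ/kℤ` permutes the copies cyclically. -/
instance : MulAction (J.cylStabilizer n i × Multiplicative (ZMod k)) (J.cylCopies n i k) where
  smul g y := ⟨(g.1.1 • y.1.1, ((y.1.2 : ZMod k) + g.2.toAdd).val),
    (smul_apply_eq_zero_iff g.1.2 _).mpr y.2.1, ZMod.val_lt _⟩
  one_smul y := Subtype.ext <| Prod.ext (one_smul _ y.1.1) <| by
    change ((y.1.2 : ZMod k) + 0).val = y.1.2
    rw [add_zero, ZMod.val_cast_of_lt y.2.2]
  mul_smul g g' y := Subtype.ext <| Prod.ext (mul_smul g.1.1 g'.1.1 y.1.1) <| by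
    change ((y.1.2 : ZMod k) + (g.2.toAdd + g'.2.toAdd)).val =
      (((((y.1.2 : ZMod k) + g'.2.toAdd).val : ℕ) : ZMod k) + g.2.toAdd).val
    rw [ZMod.natCast_zmod_val]
    congr 1
    ring

instance : MeasurableConstSMul (J.cylStabilizer n i × Multiplicative (ZMod k))
    (J.cylCopies n i k) where
  measurable_const_smul g := by
    refine Measurable.subtype_mk ?_
    exact ((measurable_const_smul g.1.1).comp (measurable_fst.comp measurable_subtype_coe)).prodMk
      ((Measurable.of_discrete (f := fun j : ℕ => ((j : ZMod k) + g.2.toAdd).val)).comp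
        (measurable_snd.comp measurable_subtype_coe))

theorem stabMeasure_cylCopies_ne_zero :
    stabMeasure (J.limitMeasure n) (J.cylCopies n i k) ≠ 0 := by
  rw [stabMeasure_cylCopies]
  refine mul_ne_zero (by exact_mod_cast NeZero.ne k) (ENNReal.inv_ne_zero.mpr ?_)
  exact ENNReal.pow_ne_top (ENNReal.natCast_ne_top _)

instance : IsProbabilityMeasure (amplifiedMeasure (J.limitMeasure n) (J.cylCopies n i k)) := by
  refine ⟨?_⟩
  rw [amplifiedMeasure, Measure.smul_apply, smul_eq_mul,
    comap_subtype_coe_apply (J.measurableSet_cylCopies n i k), Set.image_univ, Subtype.range_coe]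
  exact ENNReal.inv_mul_cancel stabMeasure_cylCopies_ne_zero stabMeasure_cylCopies_ne_top

theorem ae_cylCopies_smul_ne (g : J.cylStabilizer n i × Multiplicative (ZMod k)) (hg : g ≠ 1) :
    ∀ᵐ y ∂amplifiedMeasure (J.limitMeasure n) (J.cylCopies n i k), g • y ≠ y := by
  refine ae_cylCopies_iff.mpr fun j => ?_
  by_cases h1 : g.1.1 = 1
  · refine Filter.Eventually.of_forall fun x h hy => hg (Prod.ext (Subtype.ext h1) ?_)
    have h2 : ((j : ZMod k) + g.2.toAdd).val = j := congrArg (fun y => y.1.2) hy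
    have h3 := congrArg (Nat.cast : ℕ → ZMod k) h2
    rw [ZMod.natCast_zmod_val, add_eq_left] at h3
    exact h3
  · filter_upwards [ae_smul_ne h1] with x hx h hy
    exact hx (congrArg (fun y => y.1.1) hy)

/-- The action on the copies preserves the measure: `ℤ/kℤ` permutes the levels, and the stabilizer
preserves the measure on each of them. -/
theorem measure_cylCopies_preimage_smul (g : J.cylStabilizer n i × Multiplicative (ZMod k))
    {s : Set (J.cylCopies n i k)} (hs : MeasurableSet s) :
    amplifiedMeasure (J.limitMeasure n) (J.cylCopies n i k) ((fun y => g • y) ⁻¹' s) =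
      amplifiedMeasure (J.limitMeasure n) (J.cylCopies n i k) s := by
  have hY := J.measurableSet_cylCopies n i k
  have key : ∀ s : Set (J.cylCopies n i k), ∑' j : ℕ, J.limitMeasure n
      {x | ∃ h : (x, j) ∈ J.cylCopies n i k, (⟨(x, j), h⟩ : J.cylCopies n i k) ∈ s} =
      ∑ a : ZMod k, J.limitMeasure n {x | ∃ h : (x, a.val) ∈ J.cylCopies n i k,
        (⟨(x, a.val), h⟩ : J.cylCopies n i k) ∈ s} := by
    intro s
    rw [← tsum_fintype (L := .unconditional _)]
    refine ((ZMod.val_injective k).tsum_eq ?_).symm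
    intro j hj
    by_contra hcon
    refine hj ?_
    have : {x | ∃ h : (x, j) ∈ J.cylCopies n i k, (⟨(x, j), h⟩ : J.cylCopies n i k) ∈ s} = ∅ := by
      refine Set.eq_empty_iff_forall_notMem.mpr ?_
      rintro x ⟨h, -⟩
      exact hcon ⟨(j : ZMod k), ZMod.val_cast_of_lt h.2⟩
    exact (congrArg _ this).trans measure_empty
  rw [amplifiedMeasure_apply hY hs, amplifiedMeasure_apply hY (measurable_const_smul g hs),
    key, key, ← Equiv.sum_comp (Equiv.addRight g.2.toAdd) fun a : ZMod k => J.limitMeasure n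
      {x | ∃ h : (x, a.val) ∈ J.cylCopies n i k, (⟨(x, a.val), h⟩ : J.cylCopies n i k) ∈ s}]
  congr 1
  refine Finset.sum_congr rfl fun a _ => ?_
  set b : ZMod k := a + g.2.toAdd
  have hb : MeasurableSet {x | ∃ h : (x, b.val) ∈ J.cylCopies n i k,
      (⟨(x, b.val), h⟩ : J.cylCopies n i k) ∈ s} := by
    have h1 : {x | ∃ h : (x, b.val) ∈ J.cylCopies n i k,
        (⟨(x, b.val), h⟩ : J.cylCopies n i k) ∈ s} =
        (fun x => (x, b.val)) ⁻¹' (Subtype.val '' s) := by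
      ext x
      simp
    rw [h1]
    exact measurable_prodMk_right (hY.subtype_image hs)
  change _ = J.limitMeasure n {x | ∃ h : (x, b.val) ∈ J.cylCopies n i k,
      (⟨(x, b.val), h⟩ : J.cylCopies n i k) ∈ s}
  rw [← (measurePreserving_smul g.1.1 (J.limitMeasure n)).measure_preimage hb.nullMeasurableSet]
  congr 1
  ext x
  have hab : ((a.val : ZMod k) + g.2.toAdd).val = b.val := by rw [ZMod.natCast_zmod_val]
  constructor
  · rintro ⟨h, hx⟩
    refine ⟨⟨(smul_apply_eq_zero_iff g.1.2 x).mpr h.1, ZMod.val_lt b⟩, ?_⟩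
    have h1 : g • (⟨(x, a.val), h⟩ : J.cylCopies n i k) ∈ s := hx
    convert h1 using 1
    exact Subtype.ext (Prod.ext rfl hab.symm)
  · rintro ⟨h, hx⟩
    refine ⟨⟨(smul_apply_eq_zero_iff g.1.2 x).mp h.1, ZMod.val_lt a⟩, ?_⟩
    change g • (⟨(x, a.val), _⟩ : J.cylCopies n i k) ∈ s
    convert hx using 1
    exact Subtype.ext (Prod.ext rfl hab)

/-- The action on the copies is ergodic, since `d_i ℤⁿ` acts ergodically on the coset and `ℤ/kℤ`
permutes the copies transitively. -/
instance : ErgodicSMul (J.cylStabilizer n i × Multiplicative (ZMod k)) (J.cylCopies n i k)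
    (amplifiedMeasure (J.limitMeasure n) (J.cylCopies n i k)) where
  measure_preimage_smul g _ hs := measure_cylCopies_preimage_smul g hs
  aeconst_of_forall_preimage_smul_ae_eq {s} hs hinv := by
    have hk : 0 < k := Nat.pos_of_ne_zero (NeZero.ne k)
    let s₀ : Set (J.limit n) := {x | ∃ h : (x, 0) ∈ J.cylCopies n i k,
      (⟨(x, 0), h⟩ : J.cylCopies n i k) ∈ s}
    have hs₀ : MeasurableSet s₀ := by
      have h1 : s₀ = (fun x => (x, 0)) ⁻¹' (Subtype.val '' s) := by
        ext x
        simp [s₀]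
      rw [h1]
      exact measurable_prodMk_right ((J.measurableSet_cylCopies n i k).subtype_image hs)
    -- almost surely, membership in `s` does not depend on the copy
    have hcopy : ∀ᵐ y ∂amplifiedMeasure (J.limitMeasure n) (J.cylCopies n i k),
        y ∈ s ↔ y.1.1 ∈ s₀ := by
      refine ae_cylCopies_iff.mpr fun j => ?_
      have h1 := ae_cylCopies_iff.mp (hinv (1, Multiplicative.ofAdd (j : ZMod k))).mem_iff 0
      filter_upwards [h1] with x hx h
      have h0 : (x, 0) ∈ J.cylCopies n i k := ⟨h.1, hk⟩
      have h2 : ((1, Multiplicative.ofAdd (j : ZMod k)) :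
          J.cylStabilizer n i × Multiplicative (ZMod k)) •
          (⟨(x, 0), h0⟩ : J.cylCopies n i k) = ⟨(x, j), h⟩ := by
        refine Subtype.ext (Prod.ext (one_smul _ x) ?_)
        change (((0 : ℕ) : ZMod k) + (j : ZMod k)).val = j
        rw [Nat.cast_zero, zero_add, ZMod.val_cast_of_lt h.2]
      rw [← h2]
      exact (hx h0).trans ⟨fun h => ⟨h0, h⟩, fun ⟨_, h⟩ => h⟩
    rw [Filter.eventuallyConst_set]
    by_cases h0 : J.limitMeasure n s₀ = 0
    · right
      have h1 := measure_eq_zero_iff_ae_notMem.mp h0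
      have h2 : ∀ᵐ y ∂amplifiedMeasure (J.limitMeasure n) (J.cylCopies n i k), y.1.1 ∉ s₀ := by
        refine ae_cylCopies_iff.mpr fun j => ?_
        filter_upwards [h1] with x hx _ using hx
      filter_upwards [hcopy, h2] with y hy hy' hys
      exact hy' (hy.mp hys)
    · left
      have h1 : ∀ᵐ x ∂J.limitMeasure n, x.1 i = 0 → x ∈ s₀ := by
        refine ae_mem_of_invariant_of_cyl hs₀ (fun v hv => ?_) ?_
        · have h2 := ae_cylCopies_iff.mp
            (hinv (⟨translElt v, translElt_mem_cylStabilizer hv⟩, 1)).mem_iff 0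
          filter_upwards [h2] with x hx hx0 ⟨h3, h4⟩
          have h5 : (x, 0) ∈ J.cylCopies n i k := ⟨hx0, hk⟩
          refine ⟨h5, (hx h5).mp ?_⟩
          change _ • _ ∈ s
          convert h4 using 1
          refine Subtype.ext (Prod.ext rfl ?_)
          change (((0 : ℕ) : ZMod k) + 0).val = 0
          simp
        · have h2 : s₀ ∩ {x | x.1 i = 0} = s₀ :=
            Set.inter_eq_self_of_subset_left fun x hx => hx.1.1
          rwa [h2]
      have h2 : ∀ᵐ y ∂amplifiedMeasure (J.limitMeasure n) (J.cylCopies n i k), y.1.1 ∈ s₀ := by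
        refine ae_cylCopies_iff.mpr fun j => ?_
        filter_upwards [h1] with x hx h using hx h.1
      filter_upwards [hcopy, h2] with y hy hy'
      exact hy.mpr hy'

/-- The relation of the profinite action, restricted to copies of a coset, is the orbit relation
of the action of the stabilizer of the coset and the cyclic group. -/
theorem amplifiedRel_cylCopies :
    amplifiedRel (J.rel n) (J.cylCopies n i k) =
      MulAction.orbitRel (J.cylStabilizer n i × Multiplicative (ZMod k)) (J.cylCopies n i k) := by
  ext y y'
  constructor
  · rintro ⟨g, hg⟩
    have hg' : g • y'.1.1 = y.1.1 := hg
    have hgs : g ∈ J.cylStabilizer n i := mem_cylStabilizer_of_smul y'.2.1 (hg' ▸ y.2.1)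
    refine ⟨(⟨g, hgs⟩, Multiplicative.ofAdd ((y.1.2 : ZMod k) - (y'.1.2 : ZMod k))), ?_⟩
    refine Subtype.ext (Prod.ext hg' ?_)
    change ((y'.1.2 : ZMod k) + ((y.1.2 : ZMod k) - (y'.1.2 : ZMod k))).val = y.1.2
    rw [add_sub_cancel, ZMod.val_cast_of_lt y.2.2]
  · rintro ⟨g, hg⟩
    exact ⟨g.1.1, congrArg (fun y => y.1.1) hg⟩

/-- The invariant `𝓢` contains all positive integral multiples of the numbers `1 / d_iⁿ`. -/
theorem mem_sInvariant (hn : n ≠ 0) (J : DivChain) (k i : ℕ) (hk : 1 ≤ k) :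
    (k : ℝ) / (J.d i : ℝ) ^ n ∈ sInvariant (J.rel n) (J.limitMeasure n) := by
  have : NeZero k := ⟨by omega⟩
  have hd : (0 : ℝ) < (J.d i : ℝ) ^ n := pow_pos (by exact_mod_cast J.pos i) n
  have hY := J.measurableSet_cylCopies n i k
  refine ⟨div_pos (by exact_mod_cast hk) hd, J.cylCopies n i k, hY, ?_, ?_⟩
  · rw [stabMeasure_cylCopies, div_eq_mul_inv, ENNReal.ofReal_mul (by positivity),
      ENNReal.ofReal_natCast, ENNReal.ofReal_inv_of_pos hd, ENNReal.ofReal_pow (by positivity),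
      ENNReal.ofReal_natCast]
  · refine ⟨J.cylStabilizer n i × Multiplicative (ZMod k), inferInstance, inferInstance,
      J.cylCopies n i k, inferInstance, hY.standardBorel, inferInstance, inferInstance,
      amplifiedMeasure (J.limitMeasure n) (J.cylCopies n i k), inferInstance,
      nullSingletonClass_cylCopies hn, inferInstance, ae_cylCopies_smul_ne, id,
      ⟨MeasurePreserving.id _, id, MeasurePreserving.id _,
        Filter.Eventually.of_forall fun _ => rfl, Filter.Eventually.of_forall fun _ => rfl⟩,
      Filter.Eventually.of_forall fun y => ?_⟩
    rw [amplifiedRel_cylCopies]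
    exact Set.bijOn_id _

end DivChain

end AmplifiedCyls

/-! ### Invariance under orbit equivalence -/

section OrbitEquivalenceInvariance

variable {X Y Z : Type} [MeasurableSpace X] [MeasurableSpace Y] [MeasurableSpace Z]
  {μ : Measure X} {ν : Measure Y} {η : Measure Z}

/-- An almost everywhere inverse of a measure preserving map is automatically measure
preserving. -/
theorem isMeasureIso_of_ae_leftInverse {θ : X → Y} (hθ : MeasurePreserving θ μ ν) {θ' : Y → X}
    (hθ' : Measurable θ') (h : ∀ᵐ x ∂μ, θ' (θ x) = x) (h' : ∀ᵐ y ∂ν, θ (θ' y) = y) :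
    IsMeasureIso μ ν θ := by
  refine ⟨hθ, θ', ⟨hθ', ?_⟩, h, h'⟩
  rw [← hθ.map_eq, Measure.map_map hθ' hθ.measurable]
  exact (Measure.map_congr h).trans Measure.map_id

theorem OrbitEquivalent.trans {R : Setoid X} {S : Setoid Y} {T : Setoid Z}
    (h₁ : OrbitEquivalent R μ S ν) (h₂ : OrbitEquivalent S ν T η) : OrbitEquivalent R μ T η := by
  obtain ⟨θ₁, ⟨hθ₁, θ₁', hθ₁', hl₁, hr₁⟩, hb₁⟩ := h₁
  obtain ⟨θ₂, ⟨hθ₂, θ₂', hθ₂', hl₂, hr₂⟩, hb₂⟩ := h₂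
  refine ⟨θ₂ ∘ θ₁, ⟨hθ₂.comp hθ₁, θ₁' ∘ θ₂', hθ₁'.comp hθ₂', ?_, ?_⟩, ?_⟩
  · filter_upwards [hl₁, hθ₁.quasiMeasurePreserving.ae hl₂] with x h1 h2
    simp only [Function.comp_apply, h2, h1]
  · filter_upwards [hr₂, hθ₂'.quasiMeasurePreserving.ae hr₁] with z h1 h2
    simp only [Function.comp_apply, h2, h1]
  · filter_upwards [hb₁, hθ₁.quasiMeasurePreserving.ae hb₂] with x h1 h2
    exact h2.comp h1

/-- An orbit equivalence restricts to an orbit equivalence of amplifications. -/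
theorem OrbitEquivalent.amplified [SFinite μ] [SFinite ν] {R : Setoid X} {S : Setoid Y}
    {θ : X → Y} (hθ : IsMeasureIso μ ν θ)
    (hb : ∀ᵐ x ∂μ, Set.BijOn θ {x' | R x x'} {y | S (θ x) y})
    {B : Set (Y × ℕ)} (hB : MeasurableSet B) (hB0 : stabMeasure ν B ≠ 0)
    (hBfin : stabMeasure ν B ≠ ⊤) :
    stabMeasure μ (Prod.map θ id ⁻¹' B) = stabMeasure ν B ∧
    OrbitEquivalent (amplifiedRel R (Prod.map θ id ⁻¹' B))
      (amplifiedMeasure μ (Prod.map θ id ⁻¹' B)) (amplifiedRel S B) (amplifiedMeasure ν B) := by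
  classical
  obtain ⟨hθ, θ', hθ', hl, hr⟩ := hθ
  have hmp : MeasurePreserving (Prod.map θ id) (stabMeasure μ) (stabMeasure ν) :=
    hθ.prod (MeasurePreserving.id (Measure.count : Measure ℕ))
  set A : Set (X × ℕ) := Prod.map θ id ⁻¹' B with hAdef
  have hA : MeasurableSet A := hmp.measurable hB
  have hAB : stabMeasure μ A = stabMeasure ν B := hmp.measure_preimage hB.nullMeasurableSet
  refine ⟨hAB, ?_⟩
  let Θ : A → B := fun a => ⟨(θ a.1.1, a.1.2), a.2⟩
  have hΘm : Measurable Θ := (hmp.measurable.comp measurable_subtype_coe).subtype_mk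
  have hΘ : MeasurePreserving Θ (amplifiedMeasure μ A) (amplifiedMeasure ν B) := by
    refine ⟨hΘm, Measure.ext fun s hs => ?_⟩
    rw [Measure.map_apply hΘm hs, amplifiedMeasure, amplifiedMeasure, Measure.smul_apply,
      Measure.smul_apply, comap_subtype_coe_apply hA, comap_subtype_coe_apply hB, hAB,
      ← hmp.measure_preimage (hB.subtype_image hs).nullMeasurableSet]
    congr 2
    ext p
    constructor
    · rintro ⟨a, ha, rfl⟩
      exact ⟨Θ a, ha, rfl⟩
    · rintro ⟨b, hb, hbp⟩
      have hp : p ∈ A := by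
        change Prod.map θ id p ∈ B
        rw [← hbp]
        exact b.2
      refine ⟨⟨p, hp⟩, ?_, rfl⟩
      change Θ ⟨p, hp⟩ ∈ s
      rwa [show Θ ⟨p, hp⟩ = b from Subtype.ext hbp.symm]
  obtain ⟨a₀, ha₀⟩ : A.Nonempty := by
    by_contra hcon
    rw [Set.not_nonempty_iff_eq_empty.mp hcon, measure_empty] at hAB
    exact hB0 hAB.symm
  -- the inverse only maps into `A` almost everywhere; elsewhere it takes the constant value `a₀`
  let Θ' : B → A := fun b => ⟨if Prod.map θ' id b.1 ∈ A then Prod.map θ' id b.1 else a₀, by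
    split_ifs with h
    · exact h
    · exact ha₀⟩
  have hpm : Measurable (Prod.map θ' id : Y × ℕ → X × ℕ) := hθ'.measurable.prodMap measurable_id
  have hΘ'm : Measurable Θ' := by
    refine Measurable.subtype_mk (Measurable.ite ?_ ?_ measurable_const)
    · exact measurable_subtype_coe (hpm hA)
    · exact hpm.comp measurable_subtype_coe
  have hΘ'val : ∀ b : B, Prod.map θ' id b.1 ∈ A → (Θ' b).1 = Prod.map θ' id b.1 :=
    fun b hb => if_pos hb
  refine ⟨Θ, isMeasureIso_of_ae_leftInverse hΘ hΘ'm ?_ ?_, ?_⟩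
  · rw [ae_amplifiedMeasure_iff hA (hAB ▸ hBfin)]
    intro j
    filter_upwards [hl] with x hx h
    have h1 : Prod.map θ' id (Θ ⟨(x, j), h⟩).1 = (x, j) := Prod.ext hx rfl
    refine Subtype.ext ?_
    rw [hΘ'val _ (by rw [h1]; exact h), h1]
  · rw [ae_amplifiedMeasure_iff hB hBfin]
    intro j
    filter_upwards [hr] with y hy h
    have h1 : Prod.map θ' id (y, j) ∈ A := by
      change (θ (θ' y), j) ∈ B
      rwa [hy]
    refine Subtype.ext ?_
    change Prod.map θ id (Θ' ⟨(y, j), h⟩).1 = (y, j)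
    rw [hΘ'val ⟨(y, j), h⟩ h1]
    exact Prod.ext hy rfl
  · rw [ae_amplifiedMeasure_iff hA (hAB ▸ hBfin)]
    intro j
    filter_upwards [hb] with x hx h
    refine ⟨fun a ha => hx.mapsTo ha, fun a ha a' ha' haa' => ?_, fun b hbS => ?_⟩
    · refine Subtype.ext (Prod.ext ?_ ?_)
      · exact hx.injOn ha ha' (congrArg (fun b : B => b.1.1) haa')
      · exact congrArg (fun b : B => b.1.2) haa'
    · obtain ⟨x', hx', hxb⟩ := hx.surjOn hbS
      have h1 : (x', b.1.2) ∈ A := by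
        change (θ x', b.1.2) ∈ B
        rw [hxb]
        exact b.2
      exact ⟨⟨(x', b.1.2), h1⟩, hx', Subtype.ext (Prod.ext hxb rfl)⟩

/-- An orbit equivalence `θ` pulls back a realization of an amplification of `S` to one of an
amplification of `R` of the same measure. -/
theorem OrbitEquivalent.sInvariant_subset [SFinite μ] [SFinite ν] {R : Setoid X} {S : Setoid Y}
    (h : OrbitEquivalent R μ S ν) : sInvariant S ν ⊆ sInvariant R μ := by
  obtain ⟨θ, hθ, hb⟩ := h
  rintro t ⟨ht, B, hB, hBt, Λ, i₁, i₂, W, i₃, i₄, i₅, i₆, η, i₇, i₈, herg, hfree, hoe⟩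
  obtain ⟨h1, h2⟩ := OrbitEquivalent.amplified hθ hb hB
    (by rw [hBt]; exact (ENNReal.ofReal_pos.mpr ht).ne') (by rw [hBt]; exact ENNReal.ofReal_ne_top)
  exact ⟨ht, _, (hθ.1.measurable.prodMap measurable_id) hB, h1.trans hBt, Λ, i₁, i₂, W, i₃, i₄, i₅,
    i₆, η, i₇, i₈, herg, hfree, h2.trans hoe⟩

namespace DivChain

/-- The inverse of an orbit equivalence is an orbit equivalence. What is used about the relation of
the profinite action is that saturations of null sets are null sets. -/
theorem orbitEquivalent_symm {J : DivChain} {n : ℕ} {S : Setoid Y}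
    (h : OrbitEquivalent (J.rel n) (J.limitMeasure n) S ν) :
    OrbitEquivalent S ν (J.rel n) (J.limitMeasure n) := by
  obtain ⟨θ, ⟨hθ, θ', hθ', hl, hr⟩, hb⟩ := h
  refine ⟨θ', ⟨hθ', θ, hθ, hr, hl⟩, ?_⟩
  filter_upwards [hr, hθ'.quasiMeasurePreserving.ae hb,
    hθ'.quasiMeasurePreserving.ae (ae_forall_smul hl)] with y hy hby hly
  rw [hy] at hby
  have hly' : ∀ x, J.rel n (θ' y) x → θ' (θ x) = x := by
    intro x hx
    obtain ⟨g, hg⟩ := Setoid.symm' (J.rel n) hx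
    have hg' : g • θ' y = x := hg
    rw [← hg']
    exact hly g
  refine ⟨fun y' hy' => ?_, fun y₁ hy₁ y₂ hy₂ h12 => ?_, fun x hx => ?_⟩
  · obtain ⟨x, hx, rfl⟩ := hby.surjOn hy'
    change J.rel n (θ' y) (θ' (θ x))
    rw [hly' x hx]
    exact hx
  · obtain ⟨x₁, hx₁, rfl⟩ := hby.surjOn hy₁
    obtain ⟨x₂, hx₂, rfl⟩ := hby.surjOn hy₂
    rw [hly' x₁ hx₁, hly' x₂ hx₂] at h12
    rw [h12]
  · exact ⟨θ x, hby.mapsTo hx, hly' x hx⟩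

theorem sInvariant_rel {n : ℕ} (hn : 2 ≤ n) (J : DivChain) :
    sInvariant (J.rel n) (J.limitMeasure n) =
      {t : ℝ | ∃ k i : ℕ, 1 ≤ k ∧ t = (k : ℝ) / (J.d i : ℝ) ^ n} := by
  ext t
  constructor
  · exact exists_eq_of_mem_sInvariant hn
  · rintro ⟨k, i, hk, rfl⟩
    exact mem_sInvariant (by omega) J k i hk

/-- The sequence `(i + 1)!`, which every positive integer eventually divides. -/
def factorial : DivChain where
  d i := (i + 1).factorial
  lt _ := (Nat.factorial_lt (Nat.succ_pos _)).mpr (Nat.lt_succ_self _)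
  dvd _ := Nat.factorial_dvd_factorial (Nat.le_succ _)

/-- Every positive rational number has a denominator of the form `((i + 1)!)ⁿ`. -/
theorem setOf_factorial {n : ℕ} (hn : n ≠ 0) :
    {t : ℝ | ∃ k i : ℕ, 1 ≤ k ∧ t = (k : ℝ) / (factorial.d i : ℝ) ^ n} =
      {t : ℝ | ∃ q : ℚ, 0 < q ∧ t = (q : ℝ)} := by
  ext t
  constructor
  · rintro ⟨k, i, hk, rfl⟩
    have hd := factorial.pos i
    exact ⟨k / (factorial.d i : ℚ) ^ n, by positivity, by push_cast; rfl⟩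
  · rintro ⟨q, hq, rfl⟩
    obtain ⟨m, hm⟩ : q.den ∣ factorial.d q.den ^ n :=
      (Nat.dvd_factorial q.den_pos (Nat.le_succ _)).trans (dvd_pow_self _ hn)
    have hd : 0 < factorial.d q.den ^ n := pow_pos (factorial.pos _) n
    have hm0 : 0 < m := Nat.pos_of_ne_zero fun h => by
      rw [h, mul_zero] at hm
      exact hd.ne' hm
    have hnum : 0 < q.num := Rat.num_pos.mpr hq
    refine ⟨q.num.toNat * m, q.den, Nat.mul_pos (by omega) hm0, ?_⟩
    have h1 : ((factorial.d q.den : ℝ)) ^ n = q.den * m := by exact_mod_cast hm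
    have h2 : ((q.num.toNat : ℕ) : ℝ) = (q.num : ℝ) := by
      exact_mod_cast Int.toNat_of_nonneg hnum.le
    have h3 : (q.den : ℝ) ≠ 0 := by exact_mod_cast q.den_pos.ne'
    have h4 : (m : ℝ) ≠ 0 := by exact_mod_cast hm0.ne'
    rw [h1, Nat.cast_mul, h2, mul_div_mul_right _ _ h4]
    exact Rat.cast_def q

/-- For orbit equivalent actions, `1 / d_iⁿ` for the second sequence is of the form `k / d_jⁿ` for
the first one, so that `d_i` divides `d_j`. -/
theorem exists_dvd_of_orbitEquivalent {n : ℕ} (hn : 2 ≤ n) {J₁ J₂ : DivChain}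
    (h : OrbitEquivalent (J₁.rel n) (J₁.limitMeasure n) (J₂.rel n) (J₂.limitMeasure n)) (i : ℕ) :
    ∃ j, J₂.d i ∣ J₁.d j := by
  have h1 := h.sInvariant_subset (mem_sInvariant (by omega) J₂ 1 i le_rfl)
  rw [sInvariant_rel hn] at h1
  obtain ⟨k, j, -, hk⟩ := h1
  refine ⟨j, (Nat.pow_dvd_pow_iff (n := n) (by omega)).mp ⟨k, ?_⟩⟩
  have h2 : ((J₁.d j : ℝ)) ^ n ≠ 0 := pow_ne_zero _ (by exact_mod_cast (J₁.pos j).ne')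
  have h3 : ((J₂.d i : ℝ)) ^ n ≠ 0 := pow_ne_zero _ (by exact_mod_cast (J₂.pos i).ne')
  rw [div_eq_div_iff h3 h2, Nat.cast_one, one_mul, mul_comm] at hk
  exact_mod_cast hk

end DivChain

end OrbitEquivalenceInvariance

theorem corollary5p8 (n : ℕ) (hn : 2 ≤ n) :
    (∀ J : DivChain, sInvariant (J.rel n) (J.limitMeasure n) =
      {t : ℝ | ∃ k i : ℕ, 1 ≤ k ∧ t = (k : ℝ) / (J.d i : ℝ) ^ n}) ∧
    (∃ J : DivChain, sInvariant (J.rel n) (J.limitMeasure n) =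
      {t : ℝ | ∃ q : ℚ, 0 < q ∧ t = (q : ℝ)}) ∧
    (∀ J₁ J₂ : DivChain,
      ((∃ i, ∀ j, ¬ J₂.d i ∣ J₁.d j) ∨ (∃ i, ∀ j, ¬ J₁.d i ∣ J₂.d j)) →
      ¬ OrbitEquivalent (J₁.rel n) (J₁.limitMeasure n) (J₂.rel n) (J₂.limitMeasure n)) := by
  refine ⟨DivChain.sInvariant_rel hn, ⟨DivChain.factorial, ?_⟩, ?_⟩
  · rw [DivChain.sInvariant_rel hn, DivChain.setOf_factorial (by omega)]
  · rintro J₁ J₂ (⟨i, hi⟩ | ⟨i, hi⟩) h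
    · obtain ⟨j, hj⟩ := DivChain.exists_dvd_of_orbitEquivalent hn h i
      exact hi j hj
    · obtain ⟨j, hj⟩ :=
        DivChain.exists_dvd_of_orbitEquivalent hn (DivChain.orbitEquivalent_symm h) i
      exact hi j hj
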